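/- Let $U:\mathbb R\to\mathbb R$ be a smooth Morse function ($U'(x)=0\Rightarrow U''(x)\neq 0$). A cooling schedule is a non-increasing function $t\mapsto\varepsilon_t>0$ on $[0,\infty)$ (it need not tend to $0$). The velocity jump process $(X_t,Y_t)$ on $\mathbb R\times\{\pm1\}$ with generator \[L_tf(x,y)=y\,\partial_xf(x,y)+\frac1{\varepsilon_t}\big(yU'(x)\big)_+\big(f(x,-y)-f(x,y)\big),\] started at a time $s_0\ge 0$ from a random state $(X_{s_0},Y_{s_0})$, is constructed as follows. Let $(E_i)_{i\ge0}$ be i.i.d. exponential variables of mean $1$, independent of the initial state. Put $T_0=s_0$, let \[T_{i+1}=\inf\Big\{t>T_i:\ \int_{T_i}^t\frac{\big(Y_{T_i}U'(X_{T_i}+Y_{T_i}(r-T_i))\big)_+}{\varepsilon_r}\,dr\ge E_i\Big\}\qquad(\inf\emptyset=\infty),\] $X_t=X_{T_i}+Y_{T_i}(t-T_i)$ and $Y_t=Y_{T_i}$ on $[T_i,T_{i+1})$, with $X$ continuous and $Y_{T_{i+1}}=-Y_{T_i}$. A cusp of $U$ is an interval $C=(z_l,z_r)$, $z_l<z_r$,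 with $U(z_l)=U(z_r)$ and $U(x)<U(z_l)$ for all $x\in C$. Its depth is $d=U(z_l)-\min_CU$. Let $\mathcal N$ be the set of local extrema of $U$ in $C$, and let \[u=U(z_l)-\max_{\mathcal N}U,\quad x_l=\inf\{x\in C:U(z_l)-U(x)\ge u\},\quad x_r=\sup\{x\in C:U(z_r)-U(x)\ge u\},\] \[A_C=(z_l,x_l)\times\{-1\}\,\cup\,(x_r,z_r)\times\{1\},\qquad \bar A_C=(C\times\{\pm1\})\setminus A_C .\] For $t_0>0$ let $\tau_C=\inf\{t>t_0:X_t\notin C\}\in(t_0,\infty]$. Theorem. Let $C=(z_l,z_r)$ be a cusp of $U$, of depth $d$. There exist constants $\varepsilon_0>0$ and $c>0$ (depending only on $U$ and $C$) such that for every cooling schedule $(\varepsilon_t)$, all times $t_0>0$ and $s_0\in[0,t_0]$ and every initial law at time $s_0$: if $\varepsilon_{t_0}\le\varepsilon_0$, if \[\int_{t_0}^\infty\varepsilon_s^{-1/2}e^{-d/\varepsilon_s}\,ds=\infty,\] and if the event $\{(X_{t_0},Y_{t_0})\in\bar A_C\}$ has positive probability, then, conditionally on this event, \[\mathbb E\Big[\int_{t_0}^{\tau_C}\varepsilon_s^{-1/2}e^{-d/\varepsilon_s}\,ds\Big]\le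 c \qquad\text{and}\qquad \mathbb P\big(\tau_C<\infty,\ X_{\tau_C}=z\big)\ge\frac1c\quad\text{for each }z\in\{z_l,z_r\}.\] -/

import Mathlib

open MeasureTheory ProbabilityTheory Set
open scoped ENNReal

noncomputable section

namespace VelocityJump

/-! ### Potential, cusps, cooling schedules -/

/-- A function on the line is Morse if all its critical points are non-degenerate. -/
def IsMorse (U : ℝ → ℝ) : Prop :=
  ∀ x, deriv U x = 0 → deriv (deriv U) x ≠ 0

/-- The open interval `(zl, zr)` is a cusp of `U`. -/
structure IsCusp (U : ℝ → ℝ) (zl zr : ℝ) : Prop where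
  lt : zl < zr
  ends_eq : U zl = U zr
  below : ∀ x ∈ Ioo zl zr, U x < U zl

/-- The depth `d = U(zl) - min_C U` of the cusp `C = (zl, zr)`. -/
def cuspDepth (U : ℝ → ℝ) (zl zr : ℝ) : ℝ :=
  U zl - sInf (U '' Ioo zl zr)

/-- The set of local extrema of `U` in the cusp. -/
def extremaIn (U : ℝ → ℝ) (zl zr : ℝ) : Set ℝ :=
  {x | x ∈ Ioo zl zr ∧ IsLocalExtr U x}

/-- `u = U(zl) - max {U(z) : z a local extremum of U in C}`. -/
def exitHeight (U : ℝ → ℝ) (zl zr : ℝ) : ℝ :=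
  U zl - sSup (U '' extremaIn U zl zr)

/-- `x_l = inf {x ∈ C : U(zl) - U(x) ≥ u}`. -/
def innerLeft (U : ℝ → ℝ) (zl zr : ℝ) : ℝ :=
  sInf {x | x ∈ Ioo zl zr ∧ exitHeight U zl zr ≤ U zl - U x}

/-- `x_r = sup {x ∈ C : U(zr) - U(x) ≥ u}`. -/
def innerRight (U : ℝ → ℝ) (zl zr : ℝ) : ℝ :=
  sSup {x | x ∈ Ioo zl zr ∧ exitHeight U zl zr ≤ U zr - U x}

/-- The exiting set `A_C = (zl, x_l) × {-1} ∪ (x_r, zr) × {1}`. -/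
def exitingSet (U : ℝ → ℝ) (zl zr : ℝ) : Set (ℝ × ℤˣ) :=
  Ioo zl (innerLeft U zl zr) ×ˢ {-1} ∪ Ioo (innerRight U zl zr) zr ×ˢ {1}

/-- The non-exiting set `(C × {±1}) \ A_C`. -/
def nonExitingSet (U : ℝ → ℝ) (zl zr : ℝ) : Set (ℝ × ℤˣ) :=
  (Ioo zl zr ×ˢ univ) \ exitingSet U zl zr

/-- A cooling schedule: positive and non-increasing on `[0, ∞)`. It need not tend to `0`. -/
structure IsCoolingSchedule (ε : ℝ → ℝ) : Prop where
  pos : ∀ t, 0 ≤ t → 0 < ε t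
  antitone : AntitoneOn ε (Ici 0)

/-! ### The inhomogeneous velocity jump process, path by path -/

/-- The jump rate `(y U'(x))₊ / ε_t`. -/
def jumpRate (U ε : ℝ → ℝ) (t x : ℝ) (y : ℤˣ) : ℝ :=
  max (((y : ℤ) : ℝ) * deriv U x) 0 / ε t

/-- State at a jump time: the time `T_i` (`⊤` if there are fewer than `i` jumps), and the position
and velocity just after it. If the time is `⊤`, then position and velocity are meaningless and are
never used. -/
structure JumpState where
  time : EReal
  pos : ℝ
  vel : ℤˣ

/-- The next jump time
`T' = inf {t > T : ∫_T^t (y U'(x + y (r - T)))₊ / ε_r dr ≥ e}`, with `inf ∅ = ⊤`. -/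
def nextJumpTime (U ε : ℝ → ℝ) (e : ℝ) (S : JumpState) : EReal :=
  sInf ((fun t : ℝ => (t : EReal)) '' {t : ℝ | S.time < (t : EReal) ∧
    e ≤ ∫ r in S.time.toReal..t,
      jumpRate U ε r (S.pos + ((S.vel : ℤ) : ℝ) * (r - S.time.toReal)) S.vel})

/-- The process started at time `s₀` from `(x₀, y₀)` and driven by the thresholds `e 0, e 1, …`,
recorded at its jump times (the initial time being the zeroth). -/
def jumpChain (U ε : ℝ → ℝ) (s₀ x₀ : ℝ) (y₀ : ℤˣ) (e : ℕ → ℝ) : ℕ → JumpState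
  | 0 => ⟨(s₀ : EReal), x₀, y₀⟩
  | i + 1 =>
    let S := jumpChain U ε s₀ x₀ y₀ e i
    let T := nextJumpTime U ε (e i) S
    ⟨T, S.pos + ((S.vel : ℤ) : ℝ) * (T.toReal - S.time.toReal), -S.vel⟩

/-- The number of jumps up to time `t`, i.e. the largest `i` with `T_i ≤ t`. (Almost surely only
finitely many jumps occur in a finite time, so the supremum is a maximum.) -/
def jumpCount (U ε : ℝ → ℝ) (s₀ x₀ : ℝ) (y₀ : ℤˣ) (e : ℕ → ℝ) (t : ℝ) : ℕ :=
  sSup {i : ℕ | (jumpChain U ε s₀ x₀ y₀ e i).time ≤ (t : EReal)}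

/-- The position and velocity `(X_t, Y_t)` at time `t ≥ s₀`: linear motion since the last jump. -/
def path (U ε : ℝ → ℝ) (s₀ x₀ : ℝ) (y₀ : ℤˣ) (e : ℕ → ℝ) (t : ℝ) : ℝ × ℤˣ :=
  let S := jumpChain U ε s₀ x₀ y₀ e (jumpCount U ε s₀ x₀ y₀ e t)
  (S.pos + ((S.vel : ℤ) : ℝ) * (t - S.time.toReal), S.vel)

/-- The exit time `inf {t > t₀ : x_t ∉ (zl, zr)}` of a trajectory, with `inf ∅ = ⊤`. -/
def exitTime (zl zr t₀ : ℝ) (x : ℝ → ℝ) : EReal :=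
  sInf ((fun t : ℝ => (t : EReal)) '' {t : ℝ | t₀ < t ∧ x t ∉ Ioo zl zr})

/-! ### The random process -/

/-- `(X₀, Y₀)` is a random initial state of arbitrary law and, independently of it, `E 0, E 1, …`
are i.i.d. exponential variables of mean one. -/
structure IsDriving {Ω : Type*} [MeasurableSpace Ω] (P : Measure Ω)
    (X₀ : Ω → ℝ) (Y₀ : Ω → ℤˣ) (E : ℕ → Ω → ℝ) : Prop where
  measurable_pos : Measurable X₀
  measurable_vel : Measurable Y₀
  measurable_clock : ∀ k, Measurable (E k)
  law_clock : ∀ k, P.map (E k) = expMeasure 1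
  indep_clock : iIndepFun E P
  indep_init : IndepFun (fun ω => (X₀ ω, Y₀ ω)) (fun ω k => E k ω) P

/-- The velocity jump process `(X_t, Y_t)` with generator
`L_t f(x, y) = y f'(x, y) + (y U'(x))₊ / ε_t * (f(x, -y) - f(x, y))`,
started at time `s₀` from `(X₀, Y₀)`. -/
def process {Ω : Type*} (U ε : ℝ → ℝ) (s₀ : ℝ) (X₀ : Ω → ℝ) (Y₀ : Ω → ℤˣ) (E : ℕ → Ω → ℝ)
    (t : ℝ) (ω : Ω) : ℝ × ℤˣ :=
  path U ε s₀ (X₀ ω) (Y₀ ω) (fun k => E k ω) t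

/-- The exit time `τ_C` of the process from the cusp `C = (zl, zr)` after time `t₀`. -/
def cuspExitTime {Ω : Type*} (U ε : ℝ → ℝ) (s₀ : ℝ) (X₀ : Ω → ℝ) (Y₀ : Ω → ℤˣ)
    (E : ℕ → Ω → ℝ) (zl zr t₀ : ℝ) (ω : Ω) : EReal :=
  exitTime zl zr t₀ (fun t => (process U ε s₀ X₀ Y₀ E t ω).1)

/-- The weight `ε_s^{-1/2} exp(-d / ε_s)`. -/
def weight (ε : ℝ → ℝ) (d s : ℝ) : ℝ :=
  (ε s) ^ (-(1 / 2) : ℝ) * Real.exp (-d / ε s)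

end VelocityJump

end

/-! Write f = U - U(zl) and p = 1/ε. The proof constructs a function V(t, x, y) on the cusp that
decreases along every flight at least at the rate of a running cost plus the jump rate times (V
after the velocity flip minus V). Then V at the start dominates the expected running cost up to the
exit plus the expected terminal cost (`IsBarrierFor.lintegral_J_le`). With running cost 1/Z, where Z
is the partition function of the cusp, and V bounded, this controls the weighted exit time, because
Laplace's method bounds the weight by a multiple of 1/Z. With terminal cost 1 at one end and V at
most 2/3 on non-exiting states, it bounds the probability of leaving at that end. Divergence of the
weight integral forces the exit to be almost surely finite, so each end has probability at least
1/3.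

At constant inverse temperature q the equation for V is solved explicitly by `CuspData.F`, since the
difference between the two velocities is e^{qf} times an affine function of the Gibbs distribution
function. The difficulty is that p is only monotone: it may jump and grow arbitrarily fast. The cusp
is therefore cut near its ends at height -η. Below the cut e^{qf} is exponentially small, so adding
a multiple of c(q) = e^{-ηq/2} makes the solution non-increasing in q (`CuspData.F_add_anti`), and
cooling only helps. In the two monotone end pieces another expression is used. A descent has no
jumps. A climb matters only through the probability G of completing it, and G satisfies its equation
along a flight exactly, for every schedule. The pieces fit together if V does not increase on
entering a climb (`Barrier.entry`). To ensure this, the inverse temperature is looked up at a later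
time t + s(x), and the term H pays for the discrepancy with p(t). The outcome is
`Barrier.decreases`.

The remaining ingredients are the law of one flight (`Dyn.lintegral_nextT_le`), non-explosion
(`Dyn.exists_time_gt`), the Markov property at time t₀ through the absence of memory of the
exponential law (`Dyn.exists_cond_bound`), and the geometry of a Morse cusp
(`IsCusp.exists_cuspData`, `CuspData.exists_Z_le`). -/

namespace VelocityJump

/-! ### Calculus along a flight -/

/-- A function whose increments over short intervals are of second order is non-increasing. -/
theorem le_of_increment_le {D Q : ℝ → ℝ} {K r₁ r₂ : ℝ} (h12 : r₁ ≤ r₂)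
    (h : ∀ s t, r₁ ≤ s → s ≤ t → t ≤ r₂ → D t - D s ≤ K * (t - s) * (Q t - Q s)) :
    D r₂ ≤ D r₁ := by
  -- Cut into n + 1 equal pieces: the increments of `Q` telescope, so the total error is O(1/n). No
  -- continuity of `D` or `Q` is needed, which matters because the temperature may jump.
  have key : ∀ n : ℕ, D r₂ - D r₁ ≤ K * (r₂ - r₁) * (Q r₂ - Q r₁) * (1 / ((n : ℝ) + 1)) := by
    intro n
    have hn : (0 : ℝ) < (n : ℝ) + 1 := by positivity
    let g : ℕ → ℝ := fun k => r₁ + (k : ℝ) * ((r₂ - r₁) / ((n : ℝ) + 1))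
    have hstep : ∀ k, g (k + 1) - g k = (r₂ - r₁) / ((n : ℝ) + 1) := by
      intro k; simp only [g]; push_cast; ring
    have hw : 0 ≤ (r₂ - r₁) / ((n : ℝ) + 1) := div_nonneg (by linarith) hn.le
    have g0 : g 0 = r₁ := by simp [g]
    have gn : g (n + 1) = r₂ := by
      simp only [g]; push_cast; field_simp; ring
    have hmono : Monotone g := monotone_nat_of_le_succ fun k => by linarith [hstep k]
    have e1 : D r₂ - D r₁ = ∑ k ∈ Finset.range (n + 1), (D (g (k + 1)) - D (g k)) := by
      rw [Finset.sum_range_sub (fun k => D (g k)), g0, gn]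
    have e2 : Q r₂ - Q r₁ = ∑ k ∈ Finset.range (n + 1), (Q (g (k + 1)) - Q (g k)) := by
      rw [Finset.sum_range_sub (fun k => Q (g k)), g0, gn]
    have e3 : K * (r₂ - r₁) * (Q r₂ - Q r₁) * (1 / ((n : ℝ) + 1))
        = ∑ k ∈ Finset.range (n + 1),
          K * (g (k + 1) - g k) * (Q (g (k + 1)) - Q (g k)) := by
      rw [e2, Finset.mul_sum, Finset.sum_mul]
      refine Finset.sum_congr rfl fun k _ => ?_
      rw [hstep]; ring
    rw [e1, e3]
    refine Finset.sum_le_sum fun k hk => h _ _ ?_ (hmono (Nat.le_succ k)) ?_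
    · rw [← g0]; exact hmono (Nat.zero_le k)
    · rw [← gn]; exact hmono (Finset.mem_range.mp hk)
  have hl : Filter.Tendsto
      (fun n : ℕ => K * (r₂ - r₁) * (Q r₂ - Q r₁) * (1 / ((n : ℝ) + 1))) Filter.atTop (nhds 0) := by
    simpa using tendsto_one_div_add_atTop_nhds_zero_nat.const_mul
      (K * (r₂ - r₁) * (Q r₂ - Q r₁))
  linarith [ge_of_tendsto' hl key]

section Survival

variable {a b : ℝ → ℝ} {s₀ s₁ M : ℝ}

theorem intervalIntegrable_of_bounded (ha : Measurable a) (hs : s₀ ≤ s₁)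
    (hM : ∀ s ∈ Icc s₀ s₁, |a s| ≤ M) : IntervalIntegrable a volume s₀ s₁ := by
  rw [intervalIntegrable_iff_integrableOn_Ioc_of_le hs]
  refine Measure.integrableOn_of_bounded (M := M) (by simp) ha.aestronglyMeasurable ?_
  filter_upwards [ae_restrict_mem measurableSet_Ioc] with s hs
  exact hM s (Ioc_subset_Icc_self hs)

theorem abs_integral_sub_le (ha : Measurable a) (hM : ∀ s ∈ Icc s₀ s₁, |a s| ≤ M)
    {x y : ℝ} (hx : x ∈ Icc s₀ s₁) (hy : y ∈ Icc s₀ s₁) :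
    |(∫ r in s₀..x, a r) - ∫ r in s₀..y, a r| ≤ M * |x - y| := by
  have i1 : IntervalIntegrable a volume s₀ x :=
    intervalIntegrable_of_bounded ha hx.1 fun s hs => hM s ⟨hs.1, hs.2.trans hx.2⟩
  have i2 : IntervalIntegrable a volume s₀ y :=
    intervalIntegrable_of_bounded ha hy.1 fun s hs => hM s ⟨hs.1, hs.2.trans hy.2⟩
  rw [intervalIntegral.integral_interval_sub_left i1 i2]
  have := intervalIntegral.norm_integral_le_of_norm_le_const (a := y) (b := x) (C := M) (f := a)
    (fun s hs => hM s (Set.uIcc_subset_Icc hy hx (Set.uIoc_subset_uIcc hs)))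
  simpa using this

theorem absolutelyContinuous_survival (ha : Measurable a) (hs : s₀ ≤ s₁)
    (hM : ∀ s ∈ Icc s₀ s₁, |a s| ≤ M) (h0 : ∀ s ∈ Icc s₀ s₁, 0 ≤ a s) :
    AbsolutelyContinuousOnInterval (fun s => Real.exp (-∫ r in s₀..s, a r)) s₀ s₁ := by
  have hM0 : 0 ≤ M := (abs_nonneg _).trans (hM s₀ ⟨le_rfl, hs⟩)
  refine LipschitzOnWith.absolutelyContinuousOnInterval (K := ⟨M, hM0⟩) ?_
  rw [uIcc_of_le hs]
  refine LipschitzOnWith.of_dist_le_mul fun x hx y hy => ?_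
  rw [Real.dist_eq, Real.dist_eq]
  refine le_trans ?_ (abs_integral_sub_le ha hM hx hy)
  have nn : ∀ x ∈ Icc s₀ s₁, 0 ≤ ∫ r in s₀..x, a r := fun x hx =>
    intervalIntegral.integral_nonneg hx.1 fun s hs => h0 s ⟨hs.1, hs.2.trans hx.2⟩
  have key : ∀ u v : ℝ, 0 ≤ u → u ≤ v → |Real.exp (-u) - Real.exp (-v)| ≤ |u - v| := by
    intro u v hu huv
    have h1 : Real.exp (-v) ≤ Real.exp (-u) := Real.exp_le_exp.2 (by linarith)
    rw [abs_of_nonneg (by linarith), abs_sub_comm, abs_of_nonneg (by linarith)]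
    have h2 : Real.exp (-v) = Real.exp (-u) * Real.exp (-(v - u)) := by
      rw [← Real.exp_add]; ring_nf
    have h3 := Real.add_one_le_exp (-(v - u))
    have h4 : Real.exp (-u) ≤ 1 := Real.exp_le_one_iff.2 (by linarith)
    have h5 := Real.exp_pos (-u)
    rw [h2]; nlinarith
  rcases le_total (∫ r in s₀..x, a r) (∫ r in s₀..y, a r) with h | h
  · exact key _ _ (nn x hx) h
  · rw [abs_sub_comm, abs_sub_comm (∫ r in s₀..x, a r)]; exact key _ _ (nn y hy) h

/-- Integration by parts for two absolutely continuous functions. The rate is only measurable and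
bounded, so the product rule is available almost everywhere and not pointwise. -/
theorem survival_mul_eq (ha : Measurable a) (hs : s₀ ≤ s₁)
    (hM : ∀ s ∈ Icc s₀ s₁, |a s| ≤ M) (h0 : ∀ s ∈ Icc s₀ s₁, 0 ≤ a s)
    (hb : IntervalIntegrable b volume s₀ s₁) (y₀ : ℝ) :
    Real.exp (-∫ r in s₀..s₁, a r) * (y₀ + ∫ r in s₀..s₁, b r) =
      y₀ + ∫ s in s₀..s₁, Real.exp (-∫ r in s₀..s, a r) *
        (b s - a s * (y₀ + ∫ r in s₀..s, b r)) := by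
  have hai := intervalIntegrable_of_bounded ha hs hM
  have hE := absolutelyContinuous_survival ha hs hM h0
  have hY : AbsolutelyContinuousOnInterval (fun s => y₀ + ∫ r in s₀..s, b r) s₀ s₁ := by
    have h1 : AbsolutelyContinuousOnInterval (fun _ : ℝ => y₀) s₀ s₁ :=
      ((LipschitzWith.const y₀).lipschitzOnWith (s := uIcc s₀ s₁)).absolutelyContinuousOnInterval
    exact h1.add (hb.absolutelyContinuousOnInterval_intervalIntegral left_mem_uIcc)
  have key := hE.integral_deriv_mul_eq_sub hY
  simp only [intervalIntegral.integral_same, neg_zero, Real.exp_zero, add_zero, one_mul] at key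
  rw [eq_sub_iff_add_eq'] at key
  rw [← key]
  congr 1
  refine intervalIntegral.integral_congr_ae ?_
  filter_upwards [hai.ae_hasDerivAt_integral, hb.ae_hasDerivAt_integral] with s h1 h2 hmem
  have hmem' := Set.uIoc_subset_uIcc hmem
  have d1 := (h1 hmem' s₀ left_mem_uIcc).neg.exp
  have d2 := (h2 hmem' s₀ left_mem_uIcc).const_add y₀
  have e1 : deriv (fun s => Real.exp (-∫ r in s₀..s, a r)) s = _ := d1.deriv
  have e2 : deriv (fun s => y₀ + ∫ r in s₀..s, b r) s = _ := d2.deriv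
  rw [e1, e2]
  simp only [Pi.neg_apply]
  ring

theorem survival_eq (ha : Measurable a) (hs : s₀ ≤ s₁)
    (hM : ∀ s ∈ Icc s₀ s₁, |a s| ≤ M) (h0 : ∀ s ∈ Icc s₀ s₁, 0 ≤ a s) :
    Real.exp (-∫ r in s₀..s₁, a r) =
      1 - ∫ s in s₀..s₁, a s * Real.exp (-∫ r in s₀..s, a r) := by
  have := survival_mul_eq (b := fun _ => 0) ha hs hM h0 (by simp) 1
  simp only [intervalIntegral.integral_zero, add_zero, mul_one, zero_sub, mul_neg,
    intervalIntegral.integral_neg] at this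
  rw [this, sub_eq_add_neg]
  simp only [mul_comm]

/-- If `v` decreases at least at rate `l + a (φ - v)`, then `v s₀` dominates the expected reward
collected before the first point of a Poisson process of rate `a`. -/
theorem survival_supersolution {v φ l : ℝ → ℝ} (ha : Measurable a) (hs : s₀ ≤ s₁)
    (hM : ∀ s ∈ Icc s₀ s₁, |a s| ≤ M) (h0 : ∀ s ∈ Icc s₀ s₁, 0 ≤ a s)
    (hvi : IntervalIntegrable v volume s₀ s₁)
    (hbi : IntervalIntegrable (fun s => l s + a s * (φ s - v s)) volume s₀ s₁)
    (hv : ∀ s ∈ Icc s₀ s₁, v s ≤ v s₀ - ∫ r in s₀..s, (l r + a r * (φ r - v r))) :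
    Real.exp (-∫ r in s₀..s₁, a r) * v s₁ +
      ∫ s in s₀..s₁, Real.exp (-∫ r in s₀..s, a r) * (l s + a s * φ s) ≤ v s₀ := by
  have hai := intervalIntegrable_of_bounded ha hs hM
  have hE := (absolutelyContinuous_survival ha hs hM h0).continuousOn
  set E : ℝ → ℝ := fun s => Real.exp (-∫ r in s₀..s, a r) with hEdef
  set b : ℝ → ℝ := fun s => -(l s + a s * (φ s - v s)) with hbdef
  have hb : IntervalIntegrable b volume s₀ s₁ := hbi.neg
  have key := survival_mul_eq ha hs hM h0 hb (v s₀)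
  have hv' : ∀ s ∈ Icc s₀ s₁, v s ≤ v s₀ + ∫ r in s₀..s, b r := by
    intro s hs; have := hv s hs
    simp only [hbdef, intervalIntegral.integral_neg]; linarith
  have hY : ContinuousOn (fun s => v s₀ + ∫ r in s₀..s, b r) (uIcc s₀ s₁) :=
    continuousOn_const.add
      (hb.absolutelyContinuousOnInterval_intervalIntegral left_mem_uIcc).continuousOn
  have hav : IntervalIntegrable (fun s => a s * v s) volume s₀ s₁ := by
    rw [intervalIntegrable_iff_integrableOn_Ioc_of_le hs] at hvi ⊢
    refine hvi.bdd_mul (c := M) ha.aestronglyMeasurable ?_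
    filter_upwards [ae_restrict_mem measurableSet_Ioc] with s hs
    exact hM s (Ioc_subset_Icc_self hs)
  have i1 : IntervalIntegrable (fun s => E s * (l s + a s * φ s)) volume s₀ s₁ := by
    have : (fun s => E s * (l s + a s * φ s)) =
        fun s => E s * ((l s + a s * (φ s - v s)) + a s * v s) := by
      funext s; ring
    rw [this]; exact (hbi.add hav).continuousOn_mul hE
  have i2 : IntervalIntegrable
      (fun s => E s * (b s - a s * (v s₀ + ∫ r in s₀..s, b r))) volume s₀ s₁ :=
    (hb.sub (hai.mul_continuousOn hY)).continuousOn_mul hE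
  -- `v` itself need not be absolutely continuous, so the identity is applied to its majorant `v s₀
  -- + ∫ b`. The sum of the two integrands is -E·a·(majorant - v), which has a sign.
  have hle : (∫ s in s₀..s₁, E s * (l s + a s * φ s)) +
      ∫ s in s₀..s₁, E s * (b s - a s * (v s₀ + ∫ r in s₀..s, b r)) ≤ 0 := by
    rw [← intervalIntegral.integral_add i1 i2]
    have := intervalIntegral.integral_mono_on hs (i1.add i2) (g := fun _ => (0 : ℝ)) (by simp) ?_
    · simpa using this
    · intro s hs'
      have e1 : E s * (l s + a s * φ s) + E s * (b s - a s * (v s₀ + ∫ r in s₀..s, b r))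
          = -(E s * a s * ((v s₀ + ∫ r in s₀..s, b r) - v s)) := by
        simp only [hbdef]; ring
      rw [e1]
      have h3 : 0 ≤ E s := (Real.exp_pos _).le
      have h4 := mul_nonneg (mul_nonneg h3 (h0 s hs')) (sub_nonneg.2 (hv' s hs'))
      linarith
  have hend := mul_le_mul_of_nonneg_left (hv' s₁ ⟨hs, le_rfl⟩) (Real.exp_pos (-∫ r in s₀..s₁, a r)).le
  linarith

end Survival

end VelocityJump

/-! ### The cusp and the explicit solution at constant temperature -/

namespace VelocityJump

/-- The velocity as a real number. -/
noncomputable def sg (y : ℤˣ) : ℝ := ((y : ℤ) : ℝ)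

@[simp] theorem sg_one : sg 1 = 1 := by simp [sg]

@[simp] theorem sg_neg (y : ℤˣ) : sg (-y) = -sg y := by simp [sg]

theorem sg_mul_self (y : ℤˣ) : sg y * sg y = 1 := by
  rcases Int.units_eq_one_or y with rfl | rfl <;> simp

theorem abs_sg (y : ℤˣ) : |sg y| = 1 := by
  rcases Int.units_eq_one_or y with rfl | rfl <;> simp

theorem sg_mul_sg_mul (y : ℤˣ) (x : ℝ) : sg y * (sg y * x) = x := by
  rw [← mul_assoc, sg_mul_self, one_mul]

instance : MeasurableSingletonClass ℤˣ where
  measurableSet_singleton y := by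
    have : ({y} : Set ℤˣ) = Units.val ⁻¹' {(y : ℤ)} := by
      ext u; simp [Units.ext_iff]
    rw [this]
    exact (comap_measurable (Units.val : ℤˣ → ℤ)) (measurableSet_singleton _)

/-- A potential `f` on a cusp `(z (-1), z 1)`, normalized to vanish at the ends, together with
levels `b (-1)`, `b 1` at height `-η`, outside of which `f` is monotone. -/
structure CuspData where
  f : ℝ → ℝ
  z : ℤˣ → ℝ
  b : ℤˣ → ℝ
  η : ℝ
  d : ℝ
  M : ℝ
  contDiff : ContDiff ℝ 1 f
  η_pos : 0 < η
  lt_left : z (-1) < b (-1)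
  lt_mid : b (-1) < b 1
  lt_right : b 1 < z 1
  f_z : ∀ y, f (z y) = 0
  f_b : ∀ y, f (b y) = -η
  f_le : ∀ x ∈ Icc (b (-1)) (b 1), f x ≤ -η
  f_nonpos : ∀ x ∈ Icc (z (-1)) (z 1), f x ≤ 0
  le_f : ∀ x ∈ Icc (z (-1)) (z 1), -d ≤ f x
  deriv_le : ∀ x ∈ Icc (z (-1)) (z 1), |deriv f x| ≤ M
  uphill : ∀ y x, 0 ≤ sg y * (x - b y) → 0 ≤ sg y * (z y - x) → 0 ≤ sg y * deriv f x
  -- Each end piece is at most half as long as the inner interval. Hence the cost of a climb is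
  -- dominated by the inner part of `Z`, and the inner interval takes longer to cross than a climb.
  short : ∀ y, 2 * (sg y * (z y - b y)) ≤ b 1 - b (-1)

namespace CuspData

variable (D : CuspData)

/-- The length of the cusp. -/
noncomputable def L : ℝ := D.z 1 - D.z (-1)

theorem L_pos : 0 < D.L := by
  unfold L; linarith [D.lt_left, D.lt_mid, D.lt_right]

theorem zz : D.z (-1) < D.z 1 := by linarith [D.lt_left, D.lt_mid, D.lt_right]

theorem inner_sub {x : ℝ} (hx : x ∈ Icc (D.b (-1)) (D.b 1)) : x ∈ Icc (D.z (-1)) (D.z 1) :=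
  ⟨D.lt_left.le.trans hx.1, hx.2.trans D.lt_right.le⟩

theorem b_mem (y : ℤˣ) : D.b y ∈ Icc (D.b (-1)) (D.b 1) := by
  rcases Int.units_eq_one_or y with rfl | rfl
  · exact ⟨D.lt_mid.le, le_rfl⟩
  · exact ⟨le_rfl, D.lt_mid.le⟩

theorem η_le_d : D.η ≤ D.d := by
  have := D.le_f _ (D.inner_sub (D.b_mem 1)); rw [D.f_b] at this; linarith

theorem d_pos : 0 < D.d := D.η_pos.trans_le D.η_le_d

theorem M_nonneg : 0 ≤ D.M :=
  (abs_nonneg _).trans (D.deriv_le _ (D.inner_sub (D.b_mem 1)))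

theorem continuous_f : Continuous D.f := D.contDiff.continuous

theorem continuous_deriv : Continuous (deriv D.f) := D.contDiff.continuous_deriv le_rfl

theorem hasDerivAt_f (x : ℝ) : HasDerivAt D.f (deriv D.f x) x :=
  (D.contDiff.differentiable (by simp) x).hasDerivAt

/-- Unnormalized distribution function of the Gibbs measure on the cusp. -/
noncomputable def N (q x : ℝ) : ℝ := ∫ u in D.z (-1)..x, Real.exp (-(q * D.f u))

/-- Partition function of the cusp. -/
noncomputable def Z (q : ℝ) : ℝ := D.N q (D.z 1)

/-- Distribution function of the Gibbs measure on the cusp. -/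
noncomputable def cdf (q x : ℝ) : ℝ := D.N q x / D.Z q

theorem continuous_gibbs (q : ℝ) : Continuous fun u => Real.exp (-(q * D.f u)) :=
  (continuous_const.mul D.continuous_f).neg.rexp

theorem intervalIntegrable_gibbs (q x y : ℝ) :
    IntervalIntegrable (fun u => Real.exp (-(q * D.f u))) volume x y :=
  (D.continuous_gibbs q).intervalIntegrable _ _

theorem continuous_N : Continuous fun p : ℝ × ℝ => D.N p.1 p.2 := by
  unfold N
  refine intervalIntegral.continuous_parametric_primitive_of_continuous
    (f := fun q u => Real.exp (-(q * D.f u))) ?_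
  have := D.continuous_f
  unfold Function.uncurry
  fun_prop

theorem N_nonneg {q x : ℝ} (hx : D.z (-1) ≤ x) : 0 ≤ D.N q x :=
  intervalIntegral.integral_nonneg hx fun _ _ => (Real.exp_pos _).le

theorem N_le_Z {q x : ℝ} (hx : x ∈ Icc (D.z (-1)) (D.z 1)) : D.N q x ≤ D.Z q := by
  have := intervalIntegral.integral_add_adjacent_intervals
    (D.intervalIntegrable_gibbs q (D.z (-1)) x) (D.intervalIntegrable_gibbs q x (D.z 1))
  have h2 : 0 ≤ ∫ u in x..D.z 1, Real.exp (-(q * D.f u)) :=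
    intervalIntegral.integral_nonneg hx.2 fun _ _ => (Real.exp_pos _).le
  unfold Z; unfold N; linarith

theorem Z_pos (q : ℝ) : 0 < D.Z q :=
  intervalIntegral.intervalIntegral_pos_of_pos (D.intervalIntegrable_gibbs q _ _)
    (fun _ => Real.exp_pos _) D.zz

theorem cdf_mem {q x : ℝ} (hx : x ∈ Icc (D.z (-1)) (D.z 1)) : D.cdf q x ∈ Icc (0 : ℝ) 1 :=
  ⟨div_nonneg (D.N_nonneg hx.1) (D.Z_pos q).le, div_le_one_of_le₀ (D.N_le_Z hx) (D.Z_pos q).le⟩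

/-- On the cusp -d ≤ f ≤ 0, so passing from q to q' multiplies the integrand by a factor between 1
and e^{(q'-q)d}. -/
theorem N_mono {q q' x : ℝ} (h : q ≤ q') (hx : x ∈ Icc (D.z (-1)) (D.z 1)) :
    D.N q x ≤ D.N q' x ∧ D.N q' x ≤ Real.exp ((q' - q) * D.d) * D.N q x := by
  constructor
  · refine intervalIntegral.integral_mono_on hx.1 (D.intervalIntegrable_gibbs _ _ _)
      (D.intervalIntegrable_gibbs _ _ _) fun u hu => Real.exp_le_exp.2 ?_
    have := D.f_nonpos u ⟨hu.1, hu.2.trans hx.2⟩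
    nlinarith
  · unfold N
    rw [← intervalIntegral.integral_const_mul]
    refine intervalIntegral.integral_mono_on hx.1 (D.intervalIntegrable_gibbs _ _ _)
      ((D.intervalIntegrable_gibbs _ _ _).const_mul _) fun u hu => ?_
    rw [← Real.exp_add]
    refine Real.exp_le_exp.2 ?_
    have := D.le_f u ⟨hu.1, hu.2.trans hx.2⟩
    nlinarith

theorem Z_mono {q q' : ℝ} (h : q ≤ q') : D.Z q ≤ D.Z q' :=
  (D.N_mono h ⟨D.zz.le, le_rfl⟩).1

theorem continuous_Z : Continuous D.Z :=
  D.continuous_N.comp (continuous_id.prodMk continuous_const)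

theorem L_le_Z {q : ℝ} (hq : 0 ≤ q) : D.L ≤ D.Z q := by
  have h1 : D.L = ∫ _ in D.z (-1)..D.z 1, (1 : ℝ) := by simp [L]
  rw [h1]
  refine intervalIntegral.integral_mono_on D.zz.le (by simp) (D.intervalIntegrable_gibbs _ _ _)
    fun u hu => Real.one_le_exp ?_
  have := D.f_nonpos u hu
  nlinarith

/-- The inner interval alone, where f ≤ -η, gives this growth of `Z`. It makes the cost 1/Z of a
climb comparable to the probability e^{-qη} of succeeding. -/
theorem inner_le_Z {q : ℝ} (hq : 0 ≤ q) :
    (D.b 1 - D.b (-1)) * Real.exp (q * D.η) ≤ D.Z q := by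
  have h1 : (D.b 1 - D.b (-1)) * Real.exp (q * D.η)
      = ∫ _ in D.b (-1)..D.b 1, Real.exp (q * D.η) := by simp
  rw [h1]
  have h2 : (∫ _ in D.b (-1)..D.b 1, Real.exp (q * D.η)) ≤
      ∫ u in D.b (-1)..D.b 1, Real.exp (-(q * D.f u)) := by
    refine intervalIntegral.integral_mono_on D.lt_mid.le (by simp)
      (D.intervalIntegrable_gibbs _ _ _) fun u hu => Real.exp_le_exp.2 ?_
    have := D.f_le u hu
    nlinarith
  refine h2.trans ?_
  refine intervalIntegral.integral_mono_interval D.lt_left.le D.lt_mid.le D.lt_right.le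
    (Filter.Eventually.of_forall fun _ => (Real.exp_pos _).le) (D.intervalIntegrable_gibbs _ _ _)

/-- By `N_mono`, each of the two values is at least r⁻¹ times the other, where r = e^{(q'-q)d}. As
both lie in [0, 1], they differ by at most 1 - r⁻¹. -/
theorem abs_cdf_sub_le {q q' x : ℝ} (h : q ≤ q') (hx : x ∈ Icc (D.z (-1)) (D.z 1)) :
    |D.cdf q' x - D.cdf q x| ≤ D.d * (q' - q) := by
  have h1 := D.N_mono h hx
  have h2 := D.N_mono h (x := D.z 1) ⟨D.zz.le, le_rfl⟩
  change D.Z q ≤ D.Z q' ∧ D.Z q' ≤ _ * D.Z q at h2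
  have hZ := D.Z_pos q
  have hZ' := D.Z_pos q'
  have m := D.cdf_mem (q := q) hx
  have m' := D.cdf_mem (q := q') hx
  set r := Real.exp ((q' - q) * D.d) with hr
  have hr0 : 0 < r := Real.exp_pos _
  have hri : r⁻¹ = Real.exp (-((q' - q) * D.d)) := by rw [Real.exp_neg]
  have hrb : 1 - (q' - q) * D.d ≤ r⁻¹ := by
    rw [hri]; linarith [Real.add_one_le_exp (-((q' - q) * D.d))]
  have hr1 : r⁻¹ ≤ 1 := inv_le_one_of_one_le₀ (Real.one_le_exp
    (mul_nonneg (by linarith) D.d_pos.le))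
  have N0 := D.N_nonneg (q := q) hx.1
  have N0' := D.N_nonneg (q := q') hx.1
  have a1 : r⁻¹ * D.cdf q x ≤ D.cdf q' x := by
    unfold cdf
    rw [← div_eq_inv_mul, div_div, div_le_div_iff₀ (by positivity) hZ']
    nlinarith [mul_le_mul h1.1 h2.2 hZ'.le (N0.trans h1.1)]
  have a2 : r⁻¹ * D.cdf q' x ≤ D.cdf q x := by
    unfold cdf
    rw [← div_eq_inv_mul, div_div, div_le_div_iff₀ (by positivity) hZ]
    nlinarith [mul_le_mul h1.2 h2.1 hZ.le (mul_nonneg hr0.le N0)]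
  rw [abs_le]
  constructor <;> nlinarith [m.1, m.2, m'.1, m'.2]

variable (α β B : ℝ)

/-- The jump `F 1 - F (-1)` of the inner solution. -/
noncomputable def g (q x : ℝ) : ℝ := Real.exp (q * D.f x) * (α - β * D.cdf q x)

/-- The solution at constant inverse temperature `q`: it satisfies
`y F' = - β / (2 Z) + q (y f')₊ (F y - F (-y))`. -/
noncomputable def F (q : ℝ) (y : ℤˣ) (x : ℝ) : ℝ :=
  B + (sg y * D.g α β q x + ∫ u in D.b (-1)..x, q * |deriv D.f u| * D.g α β q u) / 2

theorem continuous_g : Continuous fun p : ℝ × ℝ => D.g α β p.1 p.2 := by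
  have h1 := D.continuous_N
  have h2 : Continuous fun p : ℝ × ℝ => D.Z p.1 := D.continuous_Z.comp continuous_fst
  have h3 : Continuous fun p : ℝ × ℝ => D.cdf p.1 p.2 :=
    h1.div h2 fun p => (D.Z_pos p.1).ne'
  have := D.continuous_f
  unfold g
  fun_prop

theorem continuous_F (y : ℤˣ) : Continuous fun p : ℝ × ℝ => D.F α β B p.1 y p.2 := by
  have h1 := D.continuous_g α β
  have h2 : Continuous fun p : ℝ × ℝ =>
      ∫ u in D.b (-1)..p.2, p.1 * |deriv D.f u| * D.g α β p.1 u := by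
    refine intervalIntegral.continuous_parametric_primitive_of_continuous
      (f := fun q u => q * |deriv D.f u| * D.g α β q u) ?_
    have := D.continuous_deriv
    unfold Function.uncurry
    fun_prop
  unfold F
  fun_prop

theorem hasDerivAt_g (q x : ℝ) :
    HasDerivAt (D.g α β q) (q * deriv D.f x * D.g α β q x - β / D.Z q) x := by
  have h1 : HasDerivAt (D.N q) (Real.exp (-(q * D.f x))) x :=
    intervalIntegral.integral_hasDerivAt_right (D.intervalIntegrable_gibbs _ _ _)
      ((D.continuous_gibbs q).stronglyMeasurableAtFilter _ _) (D.continuous_gibbs q).continuousAt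
  have h2 := ((D.hasDerivAt_f x).const_mul q).exp.mul
    (((h1.div_const (D.Z q)).const_mul β).const_sub α)
  refine h2.congr_deriv ?_
  have : Real.exp (q * D.f x) * Real.exp (-(q * D.f x)) = 1 := by
    rw [← Real.exp_add]; simp
  unfold g cdf
  linear_combination (-β / D.Z q) * this

/-- Differentiating the g-term of `F` gives y f', the integral term gives |f'|, and half their sum
is the positive part appearing in the jump rate. -/
theorem hasDerivAt_F (q : ℝ) (y : ℤˣ) (x : ℝ) :
    HasDerivAt (D.F α β B q y) (sg y * (-(β / (2 * D.Z q)) +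
      q * max (sg y * deriv D.f x) 0 * (sg y * D.g α β q x))) x := by
  have hc : Continuous fun u => q * |deriv D.f u| * D.g α β q u := by
    have h1 : Continuous fun u => D.g α β q u :=
      (D.continuous_g α β).comp (continuous_const.prodMk continuous_id)
    have := D.continuous_deriv
    fun_prop
  have h1 := intervalIntegral.integral_hasDerivAt_right (hc.intervalIntegrable (D.b (-1)) x)
      (hc.stronglyMeasurableAtFilter _ _) hc.continuousAt
  have h2 := ((((D.hasDerivAt_g α β q x).const_mul (sg y)).add h1).div_const 2).const_add B
  refine h2.congr_deriv ?_
  have h3 : max (sg y * deriv D.f x) 0 = (sg y * deriv D.f x + |deriv D.f x|) / 2 := by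
    have : |deriv D.f x| = |sg y * deriv D.f x| := by rw [abs_mul, abs_sg, one_mul]
    rw [this]
    rcases le_total 0 (sg y * deriv D.f x) with h | h
    · rw [max_eq_left h, abs_of_nonneg h]; ring
    · rw [max_eq_right h, abs_of_nonpos h]; ring
  rw [h3]
  have h4 := sg_mul_self y
  have hZ := (D.Z_pos q).ne'
  field_simp
  ring_nf
  have h5 : sg y ^ 2 = 1 := by rw [sq, h4]
  have h6 : sg y ^ 3 = sg y := by rw [pow_succ, h5, one_mul]
  rw [h5, h6]; ring

theorem F_sub_F (q : ℝ) (y : ℤˣ) (x : ℝ) :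
    D.F α β B q (-y) x - D.F α β B q y x = -(sg y * D.g α β q x) := by
  unfold F; rw [sg_neg]; ring

/-! ### Dependence on the temperature -/

/-- A decreasing function of the inverse temperature that controls all others. -/
noncomputable def c (q : ℝ) : ℝ := Real.exp (-(D.η / 2 * q))

theorem c_pos (q : ℝ) : 0 < D.c q := Real.exp_pos _

theorem c_anti {q q' : ℝ} (h : q ≤ q') : D.c q' ≤ D.c q :=
  Real.exp_le_exp.2 (by nlinarith [D.η_pos])

theorem c_le_one {q : ℝ} (h : 0 ≤ q) : D.c q ≤ 1 :=
  Real.exp_le_one_iff.2 (by nlinarith [D.η_pos])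

theorem mul_c_le (q : ℝ) : q * D.c q ≤ 2 / D.η := by
  have h1 := Real.add_one_le_exp (D.η / 2 * q)
  have h2 : D.c q * Real.exp (D.η / 2 * q) = 1 := by
    unfold c; rw [← Real.exp_add]; simp
  have h3 := D.c_pos q
  have h4 := D.η_pos
  rw [le_div_iff₀ h4]
  nlinarith

/-- Converts errors of size (q' - q)·c(q') into decrements of `c`, the only currency in which a
correction can be paid. -/
theorem mul_c_le_sub {q q' : ℝ} : D.η / 2 * (q' - q) * D.c q' ≤ D.c q - D.c q' := by
  have h1 := Real.add_one_le_exp (D.η / 2 * (q' - q))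
  have h2 : D.c q = D.c q' * Real.exp (D.η / 2 * (q' - q)) := by
    unfold c; rw [← Real.exp_add]; ring_nf
  rw [h2]
  nlinarith [D.c_pos q']

/-- The exponent of `c` is half of η so that a second factor `c` remains: one absorbs powers of q
through `mul_c_le`, the other measures the size. -/
theorem exp_mul_f_le {q x : ℝ} (hq : 0 ≤ q) (hx : x ∈ Icc (D.b (-1)) (D.b 1)) :
    Real.exp (q * D.f x) ≤ D.c q * D.c q := by
  unfold c; rw [← Real.exp_add]
  refine Real.exp_le_exp.2 ?_
  have := D.f_le x hx
  nlinarith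

/-- Comparison of derivatives in q: that of the exponential is at most d·c(q) in size, and the
constant 2d/η makes the derivative of the multiple of `c` equal to -d·c(q). -/
theorem abs_exp_sub_le {q q' x : ℝ} (hq : 0 ≤ q) (h : q ≤ q')
    (hx : x ∈ Icc (D.b (-1)) (D.b 1)) :
    |Real.exp (q * D.f x) - Real.exp (q' * D.f x)| ≤ 2 / D.η * D.d * (D.c q - D.c q') := by
  have hf := D.f_le x hx
  have hd := D.le_f x (D.inner_sub hx)
  have hη := D.η_pos
  have hle : Real.exp (q' * D.f x) ≤ Real.exp (q * D.f x) := Real.exp_le_exp.2 (by nlinarith)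
  rw [abs_of_nonneg (by linarith)]
  have anti : AntitoneOn (fun q => 2 / D.η * D.d * D.c q - Real.exp (q * D.f x)) (Ici 0) := by
    refine antitoneOn_of_hasDerivWithinAt_nonpos (convex_Ici 0) (by unfold c; fun_prop)
      (f' := fun q => 2 / D.η * D.d * (D.c q * (-(D.η / 2))) - Real.exp (q * D.f x) * D.f x)
      ?_ ?_
    · intro q _
      have e1 : HasDerivAt (fun q => 2 / D.η * D.d * D.c q)
          (2 / D.η * D.d * (D.c q * (-(D.η / 2)))) q := by
        have := (((hasDerivAt_id q).const_mul (D.η / 2)).neg.exp).const_mul (2 / D.η * D.d)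
        simpa [c] using this
      have e2 : HasDerivAt (fun q => Real.exp (q * D.f x)) (Real.exp (q * D.f x) * D.f x) q := by
        simpa using ((hasDerivAt_id q).mul_const (D.f x)).exp
      exact (e1.sub e2).hasDerivWithinAt
    · intro q hq
      rw [interior_Ici] at hq
      have h1 := D.exp_mul_f_le (le_of_lt hq) hx
      have h2 := D.c_le_one (le_of_lt hq)
      have h3 := D.c_pos q
      have e : 2 / D.η * D.d * (D.c q * (-(D.η / 2))) = -(D.d * D.c q) := by
        field_simp
      rw [e]
      have h4 := Real.exp_pos (q * D.f x)
      have h5 : Real.exp (q * D.f x) ≤ D.c q := h1.trans (by nlinarith)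
      nlinarith [D.d_pos]
  have := anti (a := q) (b := q') hq (hq.trans h) h
  simp only at this
  linarith

theorem abs_mul_exp_sub_le {q q' x : ℝ} (hq : 0 ≤ q) (h : q ≤ q')
    (hx : x ∈ Icc (D.b (-1)) (D.b 1)) :
    |q * Real.exp (q * D.f x) - q' * Real.exp (q' * D.f x)| ≤
      2 / D.η * (1 + 2 / D.η * D.d) * (D.c q - D.c q') := by
  have hf := D.f_le x hx
  have hd := D.le_f x (D.inner_sub hx)
  have hη := D.η_pos
  set K := 2 / D.η * (1 + 2 / D.η * D.d) with hK
  -- Since q·e^{qf} is not monotone in q, both signs are treated together by comparing derivatives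
  -- with that of `K * c`.
  have anti : ∀ s : ℝ, |s| = 1 →
      AntitoneOn (fun q => K * D.c q - s * (q * Real.exp (q * D.f x))) (Ici 0) := by
    intro s hs
    refine antitoneOn_of_hasDerivWithinAt_nonpos (convex_Ici 0) (by unfold c; fun_prop)
      (f' := fun q => K * (D.c q * (-(D.η / 2))) -
        s * (1 * Real.exp (q * D.f x) + q * (Real.exp (q * D.f x) * D.f x))) ?_ ?_
    · intro q _
      have e1 : HasDerivAt (fun q => K * D.c q) (K * (D.c q * (-(D.η / 2)))) q := by
        have := (((hasDerivAt_id q).const_mul (D.η / 2)).neg.exp).const_mul K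
        simpa [c] using this
      have e2 : HasDerivAt (fun q => Real.exp (q * D.f x)) (Real.exp (q * D.f x) * D.f x) q := by
        simpa using ((hasDerivAt_id q).mul_const (D.f x)).exp
      exact (e1.sub (((hasDerivAt_id q).mul e2).const_mul s)).hasDerivWithinAt
    · intro q hq
      rw [interior_Ici] at hq
      have hq' : 0 ≤ q := le_of_lt hq
      have h1 := D.exp_mul_f_le hq' hx
      have h2 := D.c_le_one hq'
      have h3 := D.c_pos q
      have h4 := Real.exp_pos (q * D.f x)
      have h5 := D.mul_c_le q
      have e : K * (D.c q * (-(D.η / 2))) = -((1 + 2 / D.η * D.d) * D.c q) := by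
        rw [hK]; field_simp
      rw [e]
      have h6 : |1 * Real.exp (q * D.f x) + q * (Real.exp (q * D.f x) * D.f x)| ≤
          (1 + 2 / D.η * D.d) * D.c q := by
        have e2 : 1 * Real.exp (q * D.f x) + q * (Real.exp (q * D.f x) * D.f x) =
          Real.exp (q * D.f x) * (1 + q * D.f x) := by ring
        rw [e2, abs_mul, abs_of_pos h4]
        have h7 : |1 + q * D.f x| ≤ 1 + q * D.d := by
          rw [abs_le]; constructor <;> nlinarith
        calc Real.exp (q * D.f x) * |1 + q * D.f x| ≤ (D.c q * D.c q) * (1 + q * D.d) :=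
              mul_le_mul h1 h7 (abs_nonneg _) (by positivity)
          _ = D.c q * (D.c q + (q * D.c q) * D.d) := by ring
          _ ≤ D.c q * (1 + 2 / D.η * D.d) := by
              refine mul_le_mul_of_nonneg_left ?_ h3.le
              have := mul_le_mul_of_nonneg_right h5 D.d_pos.le
              linarith
          _ = _ := by ring
      have h8 := neg_abs_le (s * (1 * Real.exp (q * D.f x) + q * (Real.exp (q * D.f x) * D.f x)))
      rw [abs_mul, hs, one_mul] at h8
      linarith
  have a1 := anti 1 (by simp) (a := q) (b := q') hq (hq.trans h) h
  have a2 := anti (-1) (by simp) (a := q) (b := q') hq (hq.trans h) h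
  simp only at a1 a2
  rw [abs_le]
  constructor <;> linarith

/-- A Lipschitz constant for the dependence of `g` on the inverse temperature. -/
noncomputable def lip : ℝ :=
  2 / D.η * (1 + 2 / D.η * D.d) + 2 / D.η * D.d + 2 * D.d * (2 / D.η) + 2 * D.d * (2 / D.η) ^ 2

theorem lip_nonneg : 0 ≤ D.lip := by
  have := D.η_pos; have := D.d_pos; unfold lip; positivity

variable {α β}

theorem abs_g_le {q x : ℝ} (hΓ : ∀ θ ∈ Icc (0 : ℝ) 1, |α - β * θ| ≤ 1) (hq : 0 ≤ q)
    (hx : x ∈ Icc (D.b (-1)) (D.b 1)) : |D.g α β q x| ≤ D.c q * D.c q := by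
  unfold g
  rw [abs_mul, abs_of_pos (Real.exp_pos _)]
  have h1 := hΓ _ (D.cdf_mem (q := q) (D.inner_sub hx))
  have h2 := D.exp_mul_f_le hq hx
  nlinarith [Real.exp_pos (q * D.f x), abs_nonneg (α - β * D.cdf q x)]

-- The exponential factor varies by a decrement of `c`. The distribution function is merely
-- Lipschitz in q, but it is multiplied by e^{q'f} ≤ c(q')², so `mul_c_le_sub` turns its variation
-- into a decrement of `c` as well. The extra factor q in the second bound costs another 2/η.
set_option maxHeartbeats 800000 in
theorem abs_g_sub_le {q q' x : ℝ} (hΓ : ∀ θ ∈ Icc (0 : ℝ) 1, |α - β * θ| ≤ 1)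
    (hβ : β ∈ Icc (0 : ℝ) 2) (hq : 0 ≤ q) (h : q ≤ q') (hx : x ∈ Icc (D.b (-1)) (D.b 1)) :
    |D.g α β q x - D.g α β q' x| ≤ D.lip * (D.c q - D.c q') ∧
    |q * D.g α β q x - q' * D.g α β q' x| ≤ D.lip * (D.c q - D.c q') := by
  have hη := D.η_pos
  have hd := D.d_pos
  have hx' := D.inner_sub hx
  have h1 := hΓ _ (D.cdf_mem (q := q) hx')
  have h2 := D.abs_cdf_sub_le h hx'
  have h3 := D.exp_mul_f_le (hq.trans h) hx
  have h4 := D.abs_exp_sub_le hq h hx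
  have h5 := D.abs_mul_exp_sub_le hq h hx
  have h6 := D.mul_c_le q'
  have h7 := D.mul_c_le_sub (q := q) (q' := q')
  have h8 := D.c_pos q'
  have h9 := D.c_le_one (hq.trans h)
  have hc := sub_nonneg.2 (D.c_anti h)
  have hE := Real.exp_pos (q' * D.f x)
  set k := 2 / D.η with hk
  have hk0 : 0 < k := by positivity
  set δ := D.c q - D.c q' with hδ
  have hΔ : (q' - q) * D.c q' ≤ k * δ := by
    have : (q' - q) * D.c q' = k * (D.η / 2 * (q' - q) * D.c q') := by rw [hk]; field_simp
    rw [this]; exact mul_le_mul_of_nonneg_left h7 hk0.le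
  have t0 : |β * (D.cdf q' x - D.cdf q x)| ≤ 2 * D.d * (q' - q) := by
    rw [abs_mul, abs_of_nonneg hβ.1, mul_assoc]
    exact mul_le_mul hβ.2 h2 (abs_nonneg _) zero_le_two
  have hqq : 0 ≤ q' - q := by linarith
  have t1 : Real.exp (q' * D.f x) * (q' - q) ≤ k * δ := by
    have : Real.exp (q' * D.f x) ≤ D.c q' := h3.trans (by nlinarith)
    have := mul_le_mul_of_nonneg_right this hqq
    linarith
  have t2 : q' * Real.exp (q' * D.f x) * (q' - q) ≤ k ^ 2 * δ := by
    have : q' * Real.exp (q' * D.f x) ≤ k * D.c q' := by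
      have := mul_le_mul_of_nonneg_left h3 (hq.trans h)
      nlinarith
    have := mul_le_mul_of_nonneg_right this hqq
    have := mul_le_mul_of_nonneg_left hΔ hk0.le
    linarith
  constructor
  · have e : D.g α β q x - D.g α β q' x =
        (Real.exp (q * D.f x) - Real.exp (q' * D.f x)) * (α - β * D.cdf q x) +
        Real.exp (q' * D.f x) * (β * (D.cdf q' x - D.cdf q x)) := by unfold g; ring
    rw [e]
    refine (abs_add_le _ _).trans ?_
    rw [abs_mul, abs_mul, abs_of_pos hE]
    have u1 : |Real.exp (q * D.f x) - Real.exp (q' * D.f x)| * |α - β * D.cdf q x| ≤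
        k * D.d * δ := (mul_le_of_le_one_right (abs_nonneg _) h1).trans h4
    have u2 : Real.exp (q' * D.f x) * |β * (D.cdf q' x - D.cdf q x)| ≤ 2 * D.d * (k * δ) := by
      have := mul_le_mul_of_nonneg_left t0 hE.le
      have := mul_le_mul_of_nonneg_left t1 (by positivity : 0 ≤ 2 * D.d)
      linarith
    have u3 : 0 ≤ (k * (1 + k * D.d) + 2 * D.d * k ^ 2) * δ := by positivity
    unfold lip
    rw [← hk]
    linarith
  · have e : q * D.g α β q x - q' * D.g α β q' x =
        (q * Real.exp (q * D.f x) - q' * Real.exp (q' * D.f x)) * (α - β * D.cdf q x) +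
        q' * Real.exp (q' * D.f x) * (β * (D.cdf q' x - D.cdf q x)) := by unfold g; ring
    rw [e]
    refine (abs_add_le _ _).trans ?_
    have hq'0 := hq.trans h
    rw [abs_mul, abs_mul, abs_of_nonneg (mul_nonneg hq'0 hE.le)]
    have u1 : |q * Real.exp (q * D.f x) - q' * Real.exp (q' * D.f x)| * |α - β * D.cdf q x| ≤
        k * (1 + k * D.d) * δ := (mul_le_of_le_one_right (abs_nonneg _) h1).trans h5
    have u2 : q' * Real.exp (q' * D.f x) * |β * (D.cdf q' x - D.cdf q x)| ≤
        2 * D.d * (k ^ 2 * δ) := by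
      have := mul_le_mul_of_nonneg_left t0 (mul_nonneg hq'0 hE.le)
      have := mul_le_mul_of_nonneg_left t2 (by positivity : 0 ≤ 2 * D.d)
      linarith
    have u3 : 0 ≤ (k * D.d + 2 * D.d * k) * δ := by positivity
    unfold lip
    rw [← hk]
    linarith

theorem integral_inner_le {φ : ℝ → ℝ} {x C : ℝ} (hx : x ∈ Icc (D.b (-1)) (D.b 1))
    (hC : 0 ≤ C) (h : ∀ u ∈ Icc (D.b (-1)) (D.b 1), |φ u| ≤ C) :
    |∫ u in D.b (-1)..x, |deriv D.f u| * φ u| ≤ D.L * D.M * C := by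
  have := intervalIntegral.norm_integral_le_of_norm_le_const (a := D.b (-1)) (b := x)
    (C := D.M * C) (f := fun u => |deriv D.f u| * φ u) ?_
  · rw [Real.norm_eq_abs] at this
    refine this.trans ?_
    have h1 : |x - D.b (-1)| ≤ D.L := by
      rw [abs_of_nonneg (by linarith [hx.1])]
      unfold L; linarith [hx.2, D.lt_left, D.lt_right]
    have := mul_le_mul_of_nonneg_left h1 (mul_nonneg D.M_nonneg hC)
    linarith
  · intro u hu
    rw [uIoc_of_le hx.1] at hu
    have hu' : u ∈ Icc (D.b (-1)) (D.b 1) := ⟨hu.1.le, hu.2.trans hx.2⟩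
    rw [Real.norm_eq_abs, abs_mul, abs_abs]
    exact mul_le_mul (D.deriv_le u (D.inner_sub hu')) (h u hu') (abs_nonneg _) D.M_nonneg

/-- `g` is of order c² and the prefactor q consumes one factor `c`. Thus at low temperature the
inner solution is nearly the constant `B`: the starting point inside is forgotten. -/
theorem abs_F_sub_le {q x : ℝ} (hΓ : ∀ θ ∈ Icc (0 : ℝ) 1, |α - β * θ| ≤ 1) (hq : 0 ≤ q)
    (y : ℤˣ) (hx : x ∈ Icc (D.b (-1)) (D.b 1)) :
    |D.F α β B q y x - B| ≤ (1 + 2 / D.η * (D.L * D.M)) * D.c q := by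
  have h1 := D.abs_g_le hΓ hq hx
  have h2 : |∫ u in D.b (-1)..x, |deriv D.f u| * D.g α β q u| ≤ D.L * D.M * (D.c q * D.c q) :=
    D.integral_inner_le hx (mul_self_nonneg _) fun u hu => D.abs_g_le hΓ hq hu
  have e : (∫ u in D.b (-1)..x, q * |deriv D.f u| * D.g α β q u) =
      q * ∫ u in D.b (-1)..x, |deriv D.f u| * D.g α β q u := by
    rw [← intervalIntegral.integral_const_mul]; simp only [mul_assoc]
  have e2 : D.F α β B q y x - B = (sg y * D.g α β q x +
      q * ∫ u in D.b (-1)..x, |deriv D.f u| * D.g α β q u) / 2 := by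
    unfold F; rw [e]; ring
  rw [e2, abs_div, abs_two]
  have h3 := abs_add_le (sg y * D.g α β q x) (q * ∫ u in D.b (-1)..x, |deriv D.f u| * D.g α β q u)
  rw [abs_mul, abs_sg, abs_mul, abs_of_nonneg hq, one_mul] at h3
  have h4 := D.mul_c_le q
  have h5 := D.c_pos q
  have h6 := D.c_le_one hq
  have h7 : 0 ≤ D.L * D.M := mul_nonneg D.L_pos.le D.M_nonneg
  have h8 := mul_le_mul_of_nonneg_left h2 hq
  have h9 : q * (D.L * D.M * (D.c q * D.c q)) ≤ 2 / D.η * (D.L * D.M) * D.c q := by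
    have := mul_le_mul_of_nonneg_right h4 (mul_nonneg h7 h5.le)
    nlinarith
  have h10 : 0 ≤ 2 / D.η * (D.L * D.M) * D.c q := by
    have := D.η_pos; positivity
  have h11 : D.c q * D.c q ≤ D.c q := by nlinarith
  rw [div_le_iff₀ (by norm_num)]
  nlinarith

/-- The coefficient of the correction that makes the inner solution monotone. -/
noncomputable def C₁ : ℝ := D.lip * (1 + D.L * D.M)

theorem C₁_nonneg : 0 ≤ D.C₁ :=
  mul_nonneg D.lip_nonneg (add_nonneg zero_le_one (mul_nonneg D.L_pos.le D.M_nonneg))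

/-- All variations of `g` and of q·g are bounded by decrements of `c`, hence a multiple of `c`
dominates them. This is why no bound on the speed of cooling is required: a change of temperature,
even a jump, can only lower the corrected solution. -/
theorem F_add_anti {q q' x : ℝ} (hΓ : ∀ θ ∈ Icc (0 : ℝ) 1, |α - β * θ| ≤ 1)
    (hβ : β ∈ Icc (0 : ℝ) 2) (hq : 0 ≤ q) (h : q ≤ q') (y : ℤˣ)
    (hx : x ∈ Icc (D.b (-1)) (D.b 1)) :
    D.F α β B q' y x + D.C₁ * D.c q' ≤ D.F α β B q y x + D.C₁ * D.c q := by
  have hδ : 0 ≤ D.lip * (D.c q - D.c q') := mul_nonneg D.lip_nonneg (sub_nonneg.2 (D.c_anti h))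
  have h1 := (D.abs_g_sub_le hΓ hβ hq h hx).1
  have hcont : ∀ q, Continuous fun u => |deriv D.f u| * (q * D.g α β q u) := by
    intro q
    have h1 : Continuous fun u => D.g α β q u :=
      (D.continuous_g α β).comp (continuous_const.prodMk continuous_id)
    have := D.continuous_deriv
    fun_prop
  have h2 : |∫ u in D.b (-1)..x, |deriv D.f u| * (q * D.g α β q u - q' * D.g α β q' u)| ≤
      D.L * D.M * (D.lip * (D.c q - D.c q')) :=
    D.integral_inner_le hx hδ fun u hu => (D.abs_g_sub_le hΓ hβ hq h hu).2
  have e : (∫ u in D.b (-1)..x, |deriv D.f u| * (q * D.g α β q u - q' * D.g α β q' u)) =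
      (∫ u in D.b (-1)..x, q * |deriv D.f u| * D.g α β q u) -
      ∫ u in D.b (-1)..x, q' * |deriv D.f u| * D.g α β q' u := by
    rw [← intervalIntegral.integral_sub]
    · congr 1; ext u; ring
    · exact ((hcont q).congr fun u => by ring).intervalIntegrable _ _
    · exact ((hcont q').congr fun u => by ring).intervalIntegrable _ _
  rw [e] at h2
  have h3 : |sg y * (D.g α β q x - D.g α β q' x)| ≤ D.lip * (D.c q - D.c q') := by
    rw [abs_mul, abs_sg, one_mul]; exact h1
  have h4 := (abs_le.1 h2).1
  have h5 := (abs_le.1 h3).1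
  have h6 : 0 ≤ D.L * D.M * (D.lip * (D.c q - D.c q')) :=
    mul_nonneg (mul_nonneg D.L_pos.le D.M_nonneg) hδ
  unfold F C₁
  nlinarith

end CuspData

end VelocityJump

/-! ### The supersolution at variable temperature and its size -/

namespace VelocityJump

theorem measurable_intervalIntegral_param {X : Type*} [MeasurableSpace X] {φ : X → ℝ → ℝ}
    (hφ : Measurable (Function.uncurry φ)) {u v : X → ℝ} (hu : Measurable u) (hv : Measurable v) :
    Measurable fun w => ∫ r in u w..v w, φ w r := by
  have key : ∀ {u v : X → ℝ}, Measurable u → Measurable v →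
      Measurable fun w => ∫ r in Ioc (u w) (v w), φ w r := by
    intro u v hu hv
    have hS : MeasurableSet {w : X × ℝ | w.2 ∈ Ioc (u w.1) (v w.1)} :=
      (measurableSet_lt (hu.comp measurable_fst) measurable_snd).inter
        (measurableSet_le measurable_snd (hv.comp measurable_fst))
    have h1 := (hφ.indicator hS).stronglyMeasurable
    have h2 := (StronglyMeasurable.integral_prod_right (ν := (volume : Measure ℝ))
      (f := fun w r => {w : X × ℝ | w.2 ∈ Ioc (u w.1) (v w.1)}.indicator
        (Function.uncurry φ) (w, r)) h1).measurable
    convert h2 using 2 with w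
    rw [← integral_indicator measurableSet_Ioc]
    rfl
  unfold intervalIntegral
  exact (key hu hv).sub (key hv hu)

/-- Position on the straight line through `(t, x)` with velocity `y`. -/
noncomputable def line (t x : ℝ) (y : ℤˣ) (s : ℝ) : ℝ := x + sg y * (s - t)

@[simp] theorem line_self (t x : ℝ) (y : ℤˣ) : line t x y t = x := by simp [line]

theorem continuous_line (t x : ℝ) (y : ℤˣ) : Continuous (line t x y) := by
  unfold line; fun_prop

theorem sg_mul_line_sub (t x : ℝ) (y : ℤˣ) (s a : ℝ) :
    sg y * (line t x y s - a) = (s - t) - sg y * (a - x) := by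
  have := sg_mul_self y
  unfold line
  linear_combination (s - t) * this

namespace CuspData

variable (D : CuspData)

/-- The jump rate at temperature one. -/
noncomputable def ρ (y : ℤˣ) (x : ℝ) : ℝ := max (sg y * deriv D.f x) 0

theorem ρ_nonneg (y : ℤˣ) (x : ℝ) : 0 ≤ D.ρ y x := le_max_right _ _

theorem continuous_ρ (y : ℤˣ) : Continuous (D.ρ y) := by
  have := D.continuous_deriv
  unfold ρ; fun_prop

theorem ρ_le {y : ℤˣ} {x : ℝ} (hx : x ∈ Icc (D.z (-1)) (D.z 1)) : D.ρ y x ≤ D.M := by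
  refine max_le ?_ D.M_nonneg
  refine (le_abs_self _).trans ?_
  rw [abs_mul, abs_sg, one_mul]; exact D.deriv_le x hx

theorem mem_cusp_iff (y : ℤˣ) {x : ℝ} : x ∈ Icc (D.z (-1)) (D.z 1) ↔
    0 ≤ sg y * (x - D.z (-y)) ∧ 0 ≤ sg y * (D.z y - x) := by
  rcases Int.units_eq_one_or y with rfl | rfl
  · simp [mem_Icc]
  · simp [mem_Icc, and_comm]

theorem mem_inner_iff (y : ℤˣ) {x : ℝ} : x ∈ Icc (D.b (-1)) (D.b 1) ↔
    0 ≤ sg y * (x - D.b (-y)) ∧ 0 ≤ sg y * (D.b y - x) := by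
  rcases Int.units_eq_one_or y with rfl | rfl
  · simp [mem_Icc]
  · simp [mem_Icc, and_comm]

theorem sg_b_sub_b (y : ℤˣ) : sg y * (D.b y - D.b (-y)) = D.b 1 - D.b (-1) := by
  rcases Int.units_eq_one_or y with rfl | rfl <;> simp

theorem sg_z_sub_z (y : ℤˣ) : sg y * (D.z y - D.z (-y)) = D.L := by
  unfold L
  rcases Int.units_eq_one_or y with rfl | rfl <;> simp

theorem sg_z_sub_b_pos (y : ℤˣ) : 0 < sg y * (D.z y - D.b y) := by
  rcases Int.units_eq_one_or y with rfl | rfl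
  · simp [D.lt_right]
  · simp [D.lt_left]

theorem ρ_eq_zero {y : ℤˣ} {x : ℝ} (h1 : sg y * (x - D.b (-y)) ≤ 0)
    (h2 : 0 ≤ sg y * (x - D.z (-y))) : D.ρ y x = 0 := by
  have := D.uphill (-y) x (by rw [sg_neg]; linarith) (by rw [sg_neg]; linarith)
  rw [sg_neg] at this
  exact max_eq_right (by linarith)

theorem deriv_eq_ρ {y : ℤˣ} {x : ℝ} (h1 : 0 ≤ sg y * (x - D.b y))
    (h2 : 0 ≤ sg y * (D.z y - x)) : D.ρ y x = sg y * deriv D.f x :=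
  max_eq_left (D.uphill y x h1 h2)

/-- The size of all corrections in units of `c (p t)`. -/
noncomputable def K : ℝ :=
  (D.C₁ + D.M / D.η * D.L) + (1 + 2 / D.η * (D.L * D.M))

theorem K_nonneg : 0 ≤ D.K := by
  have := D.η_pos; have := D.L_pos; have := D.M_nonneg; have := D.C₁_nonneg
  unfold K; positivity

theorem sg_sub_le_L {y : ℤˣ} {a x : ℝ} (ha : a ∈ Icc (D.z (-1)) (D.z 1))
    (hx : x ∈ Icc (D.z (-1)) (D.z 1)) : sg y * (a - x) ≤ D.L := by
  have h1 := ((D.mem_cusp_iff y).1 ha).2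
  have h2 := ((D.mem_cusp_iff y).1 hx).1
  have h3 := D.sg_z_sub_z y
  nlinarith

end CuspData

/-- The parameters of a supersolution for the process at inverse temperature `p t`. -/
structure Barrier (D : CuspData) where
  p : ℝ → ℝ
  α : ℝ
  β : ℝ
  B : ℝ
  κ : ℤˣ → ℝ
  s : ℝ → ℝ
  p_mono : Monotone p
  p_pos : ∀ t, 0 < p t
  abs_le_one : ∀ θ ∈ Icc (0 : ℝ) 1, |α - β * θ| ≤ 1
  β_mem : β ∈ Icc (0 : ℝ) 2
  s_mem : ∀ x, s x ∈ Icc 0 D.L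
  -- The process moves at unit speed, so Lipschitz constant one is what keeps t + s(x)
  -- non-decreasing along every flight.
  s_lip : ∀ x x', |s x - s x'| ≤ |x - x'|
  -- Says that the climbing expression at `b y` does not exceed the inner one, since F(-y) - F(y) =
  -- -y·g and β/Z = 2l: the supersolution may only drop on entering a climb.
  entry : ∀ y t, β / D.Z (p (t + s (D.b y))) * (sg y * (D.z y - D.b y)) -
      sg y * D.g α β (p (t + s (D.b y))) (D.b y) ≤
    κ y * Real.exp (-∫ r in (0 : ℝ)..sg y * (D.z y - D.b y),
      D.ρ y (D.b y + sg y * r) * p (t + r))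

namespace Barrier

variable {D : CuspData} (A : Barrier D)

/-- The inverse temperature looked up at position `x` and time `t`. -/
noncomputable def q (t x : ℝ) : ℝ := A.p (t + A.s x)

/-- The running cost. -/
noncomputable def l (q : ℝ) : ℝ := A.β / (2 * D.Z q)

/-- The probability of reaching the end of the cusp without a jump. -/
noncomputable def G (y : ℤˣ) (t x : ℝ) : ℝ :=
  Real.exp (-∫ r in (0 : ℝ)..sg y * (D.z y - x), D.ρ y (x + sg y * r) * A.p (t + r))

/-- The correction paying for the use of `q t x` instead of `p t`. -/
noncomputable def H (t : ℝ) : ℝ := ∫ r in t..t + D.L, Real.exp (-(D.η * A.p r))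

/-- The supersolution in the outer region that is left downhill. -/
noncomputable def Vdown (t x : ℝ) (y : ℤˣ) : ℝ :=
  D.F A.α A.β A.B (A.q t x) y (D.b (-y)) + A.l (A.q t x) * (sg y * (D.b (-y) - x))

/-- The supersolution in the outer region that is climbed. -/
noncomputable def Vup (t x : ℝ) (y : ℤˣ) : ℝ :=
  D.F A.α A.β A.B (A.q t x) (-y) (D.b y) +
    A.l (A.q t x) * (2 * (sg y * (D.z y - D.b y)) - sg y * (x - D.b y)) - A.κ y * A.G y t x

/-- The correction terms of the supersolution. -/
noncomputable def corr (t x : ℝ) : ℝ := D.C₁ * D.c (A.q t x) + D.M / D.η * A.H t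

/-- The supersolution. -/
noncomputable def V (t x : ℝ) (y : ℤˣ) : ℝ :=
  -- The points `b (±1)` belong to the inner region. At `b (-y)` the descending expression agrees
  -- with the inner one; at `b y` only the inequality of `entry` is available.
  A.corr t x + if 0 < sg y * (x - D.b y) then A.Vup t x y
    else if sg y * (x - D.b (-y)) < 0 then A.Vdown t x y
    else D.F A.α A.β A.B (A.q t x) y x

theorem continuous_s : Continuous A.s :=
  (LipschitzWith.of_dist_le_mul (K := 1) fun x y => by
    simpa [Real.dist_eq] using A.s_lip x y).continuous

theorem measurable_p : Measurable A.p := A.p_mono.measurable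

theorem measurable_q : Measurable fun w : ℝ × ℝ => A.q w.1 w.2 := by
  have := A.continuous_s.measurable
  have := A.measurable_p
  unfold q; fun_prop

theorem continuous_l : Continuous A.l :=
  continuous_const.div (continuous_const.mul D.continuous_Z)
    fun q => (mul_pos two_pos (D.Z_pos q)).ne'

theorem measurable_V (y : ℤˣ) : Measurable fun w : ℝ × ℝ => A.V w.1 w.2 y := by
  have hq := A.measurable_q
  have hl := A.continuous_l.measurable.comp hq
  have hF : ∀ y b, Measurable fun w : ℝ × ℝ => D.F A.α A.β A.B (A.q w.1 w.2) y b := fun y b =>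
    (D.continuous_F A.α A.β A.B y).measurable.comp (hq.prodMk measurable_const)
  have hF' : Measurable fun w : ℝ × ℝ => D.F A.α A.β A.B (A.q w.1 w.2) y w.2 :=
    (D.continuous_F A.α A.β A.B y).measurable.comp (hq.prodMk measurable_snd)
  have hG : Measurable fun w : ℝ × ℝ => A.G y w.1 w.2 := by
    unfold G
    refine (measurable_intervalIntegral_param
      (φ := fun w : ℝ × ℝ => fun r => D.ρ y (w.2 + sg y * r) * A.p (w.1 + r)) ?_
      measurable_const (by fun_prop)).neg.exp
    have := (D.continuous_ρ y).measurable
    have := A.measurable_p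
    unfold Function.uncurry
    fun_prop
  have hH : Measurable fun w : ℝ × ℝ => A.H w.1 := by
    unfold H
    refine measurable_intervalIntegral_param
      (φ := fun _ : ℝ × ℝ => fun r => Real.exp (-(D.η * A.p r))) ?_ (by fun_prop) (by fun_prop)
    have := A.measurable_p
    unfold Function.uncurry
    fun_prop
  have hc : Measurable fun w : ℝ × ℝ => D.c (A.q w.1 w.2) := by unfold CuspData.c; fun_prop
  refine ((measurable_const.mul hc).add (measurable_const.mul hH)).add ?_
  refine Measurable.ite (measurableSet_lt measurable_const (by fun_prop)) ?_
    (Measurable.ite (measurableSet_lt (by fun_prop) measurable_const) ?_ hF')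
  · exact ((hF (-y) (D.b y)).add (hl.mul (by fun_prop))).sub (measurable_const.mul hG)
  · exact (hF y (D.b (-y))).add (hl.mul (by fun_prop))

theorem p_le_q (t x : ℝ) : A.p t ≤ A.q t x := A.p_mono (by linarith [(A.s_mem x).1])

theorem q_pos (t x : ℝ) : 0 < A.q t x := A.p_pos _

theorem q_le (t x : ℝ) : A.q t x ≤ A.p (t + D.L) := A.p_mono (by linarith [(A.s_mem x).2])

theorem l_nonneg (q : ℝ) : 0 ≤ A.l q := div_nonneg A.β_mem.1 (mul_pos two_pos (D.Z_pos q)).le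

theorem l_anti {q q' : ℝ} (h : q ≤ q') : A.l q' ≤ A.l q :=
  div_le_div_of_nonneg_left A.β_mem.1 (mul_pos two_pos (D.Z_pos q))
    (mul_le_mul_of_nonneg_left (D.Z_mono h) two_pos.le)

theorem G_pos (y : ℤˣ) (t x : ℝ) : 0 < A.G y t x := Real.exp_pos _

theorem G_le_one {y : ℤˣ} {t x : ℝ} (hx : x ∈ Icc (D.z (-1)) (D.z 1)) : A.G y t x ≤ 1 := by
  refine Real.exp_le_one_iff.2 (neg_nonpos.2 ?_)
  exact intervalIntegral.integral_nonneg ((D.mem_cusp_iff y).1 hx).2 fun r _ =>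
    mul_nonneg (D.ρ_nonneg _ _) (A.p_pos _).le

theorem intervalIntegrable_expp (u v : ℝ) :
    IntervalIntegrable (fun r => Real.exp (-(D.η * A.p r))) volume u v := by
  refine Antitone.intervalIntegrable fun r r' h => Real.exp_le_exp.2 ?_
  have := A.p_mono h
  nlinarith [D.η_pos]

theorem H_nonneg (t : ℝ) : 0 ≤ A.H t :=
  intervalIntegral.integral_nonneg (by linarith [D.L_pos]) fun _ _ => (Real.exp_pos _).le

theorem H_le (t : ℝ) : A.H t ≤ D.L * D.c (A.p t) := by
  have h : A.H t ≤ ∫ _ in t..t + D.L, D.c (A.p t) := by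
    refine intervalIntegral.integral_mono_on (by linarith [D.L_pos])
      (A.intervalIntegrable_expp _ _) (by simp) fun r hr => Real.exp_le_exp.2 ?_
    have := A.p_mono hr.1
    nlinarith [D.η_pos, A.p_pos r]
  simpa using h

/-- `H` is a sliding window of length L. Its decrease is stated in integrated form because p may
jump, and it covers the lookup time s(x), which is at most L. -/
theorem H_sub (t₁ t₂ : ℝ) : A.H t₂ - A.H t₁ =
    ∫ r in t₁..t₂, (Real.exp (-(D.η * A.p (r + D.L))) - Real.exp (-(D.η * A.p r))) := by
  have i := A.intervalIntegrable_expp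
  rw [intervalIntegral.integral_sub _ (i _ _),
    intervalIntegral.integral_comp_add_right (fun r => Real.exp (-(D.η * A.p r)))]
  · unfold H
    have h1 := intervalIntegral.integral_add_adjacent_intervals (i t₁ t₂) (i t₂ (t₂ + D.L))
    have h2 := intervalIntegral.integral_add_adjacent_intervals (i t₁ (t₁ + D.L))
      (i (t₁ + D.L) (t₂ + D.L))
    linarith
  · refine Antitone.intervalIntegrable fun r r' h => Real.exp_le_exp.2 ?_
    have := A.p_mono (add_le_add_left h D.L)
    nlinarith [D.η_pos]

theorem H_anti {t₁ t₂ : ℝ} (h : t₁ ≤ t₂) : A.H t₂ ≤ A.H t₁ := by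
  have h1 := A.H_sub t₁ t₂
  have h2 : ∫ r in t₁..t₂, (Real.exp (-(D.η * A.p (r + D.L))) - Real.exp (-(D.η * A.p r))) ≤
      ∫ _ in t₁..t₂, (0 : ℝ) := by
    refine intervalIntegral.integral_mono_on h ?_ (by simp) fun r _ => ?_
    · refine IntervalIntegrable.sub ?_ (A.intervalIntegrable_expp _ _)
      refine Antitone.intervalIntegrable fun r r' h => Real.exp_le_exp.2 ?_
      have := A.p_mono (add_le_add_left h D.L)
      nlinarith [D.η_pos]
    · refine sub_nonpos.2 (Real.exp_le_exp.2 ?_)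
      have := A.p_mono (show r ≤ r + D.L by linarith [D.L_pos])
      nlinarith [D.η_pos]
  simp only [intervalIntegral.integral_zero] at h2
  linarith

theorem corr_nonneg (t x : ℝ) : 0 ≤ A.corr t x :=
  add_nonneg (mul_nonneg D.C₁_nonneg (D.c_pos _).le)
    (mul_nonneg (div_nonneg D.M_nonneg D.η_pos.le) (A.H_nonneg t))

theorem corr_le (t x : ℝ) : A.corr t x ≤ (D.C₁ + D.M / D.η * D.L) * D.c (A.p t) := by
  have h1 := mul_le_mul_of_nonneg_left (D.c_anti (A.p_le_q t x)) D.C₁_nonneg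
  have h2 := mul_le_mul_of_nonneg_left (A.H_le t) (div_nonneg D.M_nonneg D.η_pos.le)
  unfold corr; linarith

theorem abs_F_sub_le' (t x : ℝ) (y : ℤˣ) {x' : ℝ} (hx' : x' ∈ Icc (D.b (-1)) (D.b 1)) :
    |D.F A.α A.β A.B (A.q t x) y x' - A.B| ≤
      (1 + 2 / D.η * (D.L * D.M)) * D.c (A.p t) := by
  refine (D.abs_F_sub_le A.B A.abs_le_one (A.q_pos t x).le y hx').trans ?_
  refine mul_le_mul_of_nonneg_left (D.c_anti (A.p_le_q t x)) ?_
  have := D.η_pos; have := D.L_pos; have := D.M_nonneg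
  positivity

/-- With `V_le` below: apart from the climbing term κG, the supersolution equals `B` up to K·c(p t)
and a nonnegative cost term. That cost is at most β/2 per crossing of the cusp because Z ≥ L. -/
theorem le_V {t x : ℝ} {y : ℤˣ} (hx : x ∈ Icc (D.z (-1)) (D.z 1)) :
    A.B - D.K * D.c (A.p t) - (if 0 < sg y * (x - D.b y) then A.κ y * A.G y t x else 0) ≤
      A.V t x y := by
  have h0 := A.corr_nonneg t x
  have hK : (1 + 2 / D.η * (D.L * D.M)) * D.c (A.p t) ≤ D.K * D.c (A.p t) := by
    refine mul_le_mul_of_nonneg_right ?_ (D.c_pos _).le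
    have := mul_nonneg (div_nonneg D.M_nonneg D.η_pos.le) D.L_pos.le
    unfold CuspData.K; linarith [D.C₁_nonneg]
  have hl := A.l_nonneg (A.q t x)
  unfold V
  split_ifs with h1 h2
  · have h3 := (abs_le.1 (A.abs_F_sub_le' t x (-y) (D.b_mem y))).1
    have h4 := ((D.mem_cusp_iff y).1 hx).2
    have h5 := D.sg_z_sub_b_pos y
    have h6 : 0 ≤ 2 * (sg y * (D.z y - D.b y)) - sg y * (x - D.b y) := by nlinarith
    have := mul_nonneg hl h6
    unfold Vup; linarith
  · have h3 := (abs_le.1 (A.abs_F_sub_le' t x y (D.b_mem (-y)))).1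
    have h6 : 0 ≤ sg y * (D.b (-y) - x) := by linarith
    have := mul_nonneg hl h6
    unfold Vdown; linarith
  · have h4 : x ∈ Icc (D.b (-1)) (D.b 1) := (D.mem_inner_iff y).2 ⟨by linarith, by linarith⟩
    have h3 := (abs_le.1 (A.abs_F_sub_le' t x y h4)).1
    linarith

theorem V_le {t x : ℝ} {y : ℤˣ} (hx : x ∈ Icc (D.z (-1)) (D.z 1)) :
    A.V t x y ≤ A.B + D.K * D.c (A.p t) + A.β / 2 +
      (if 0 < sg y * (x - D.b y) then A.β / 2 - A.κ y * A.G y t x else 0) := by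
  have h0 := A.corr_le t x
  have hl := A.l_nonneg (A.q t x)
  have hL : A.l (A.q t x) * D.L ≤ A.β / 2 := by
    have h1 := D.L_le_Z (A.q_pos t x).le
    have h2 := D.Z_pos (A.q t x)
    unfold l
    rw [div_mul_eq_mul_div, div_le_div_iff₀ (by positivity) (by norm_num)]
    nlinarith [mul_le_mul_of_nonneg_left h1 A.β_mem.1]
  have hβ := A.β_mem.1
  unfold V CuspData.K
  split_ifs with h1 h2
  · have h3 := (abs_le.1 (A.abs_F_sub_le' t x (-y) (D.b_mem y))).2
    have h6 : 2 * (sg y * (D.z y - D.b y)) - sg y * (x - D.b y) ≤ 2 * D.L := by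
      have := D.sg_sub_le_L (y := y) (a := D.z y) (x := D.b y)
        ((D.mem_cusp_iff y).2 ⟨by rw [D.sg_z_sub_z]; exact D.L_pos.le, by simp⟩)
        (D.inner_sub (D.b_mem y))
      linarith
    have := mul_le_mul_of_nonneg_left h6 hl
    unfold Vup; linarith
  · have h3 := (abs_le.1 (A.abs_F_sub_le' t x y (D.b_mem (-y)))).2
    have h6 := mul_le_mul_of_nonneg_left
      (D.sg_sub_le_L (y := y) (D.inner_sub (D.b_mem (-y))) hx) hl
    unfold Vdown; linarith
  · have h4 : x ∈ Icc (D.b (-1)) (D.b 1) := (D.mem_inner_iff y).2 ⟨by linarith, by linarith⟩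
    have h3 := (abs_le.1 (A.abs_F_sub_le' t x y h4)).2
    linarith

theorem abs_V_le {t x : ℝ} {y : ℤˣ} (hx : x ∈ Icc (D.z (-1)) (D.z 1)) :
    |A.V t x y| ≤ |A.B| + D.K + 2 + |A.κ 1| + |A.κ (-1)| := by
  have h1 := A.le_V (t := t) (y := y) hx
  have h2 := A.V_le (t := t) (y := y) hx
  have h3 : D.K * D.c (A.p t) ≤ D.K := by
    have := D.c_le_one (A.p_pos t).le
    nlinarith [D.K_nonneg]
  have h4 : |A.κ y * A.G y t x| ≤ |A.κ 1| + |A.κ (-1)| := by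
    rw [abs_mul, abs_of_pos (A.G_pos _ _ _)]
    have h5 : |A.κ y| ≤ |A.κ 1| + |A.κ (-1)| := by
      rcases Int.units_eq_one_or y with rfl | rfl
      · linarith [abs_nonneg (A.κ (-1))]
      · linarith [abs_nonneg (A.κ 1)]
    have := A.G_le_one (y := y) (t := t) hx
    nlinarith [abs_nonneg (A.κ y)]
  have h6 := abs_le.1 h4
  have h7 := A.β_mem
  have h8 := neg_abs_le A.B
  have h9 := le_abs_self A.B
  rw [abs_le]
  split_ifs at h1 h2 <;> constructor <;> linarith [h7.1, h7.2, abs_nonneg (A.κ 1), abs_nonneg (A.κ (-1))]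

end Barrier

end VelocityJump

/-! ### The supersolution inequality along straight lines -/

namespace VelocityJump

namespace Barrier

variable {D : CuspData} (A : Barrier D)

/-- The jump rate along the line through `(t, x)` with velocity `y`. -/
noncomputable def rate (t x : ℝ) (y : ℤˣ) (s : ℝ) : ℝ := D.ρ y (line t x y s) * A.p s

/-- The rate at which the supersolution has to decrease along a line. -/
noncomputable def loss (t x : ℝ) (y : ℤˣ) (s : ℝ) : ℝ :=
  A.l (A.q s (line t x y s)) +
    A.rate t x y s * (A.V s (line t x y s) (-y) - A.V s (line t x y s) y)

variable {t x : ℝ} {y : ℤˣ}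

theorem q_line_mono : Monotone fun s => A.q s (line t x y s) := by
  intro s s' h
  refine A.p_mono ?_
  have h1 := neg_abs_le (A.s (line t x y s') - A.s (line t x y s))
  have h2 := A.s_lip (line t x y s') (line t x y s)
  have h3 : |line t x y s' - line t x y s| = s' - s := by
    have : line t x y s' - line t x y s = sg y * (s' - s) := by unfold line; ring
    rw [this, abs_mul, abs_sg, one_mul, abs_of_nonneg (by linarith)]
  linarith

theorem measurable_rate : Measurable (A.rate t x y) :=
  ((D.continuous_ρ y).comp (continuous_line t x y)).measurable.mul A.measurable_p

theorem rate_nonneg (s : ℝ) : 0 ≤ A.rate t x y s := mul_nonneg (D.ρ_nonneg _ _) (A.p_pos _).le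

theorem rate_le {s s₂ : ℝ} (hs : s ≤ s₂) (hx : line t x y s ∈ Icc (D.z (-1)) (D.z 1)) :
    |A.rate t x y s| ≤ D.M * A.p s₂ := by
  rw [abs_of_nonneg (A.rate_nonneg s)]
  exact mul_le_mul (D.ρ_le hx) (A.p_mono hs) (A.p_pos _).le D.M_nonneg

theorem measurable_V_line (y' : ℤˣ) : Measurable fun s => A.V s (line t x y s) y' :=
  (A.measurable_V y').comp (measurable_id.prodMk (continuous_line t x y).measurable)

theorem line_mem {s₁ s₂ s : ℝ} (h1 : line t x y s₁ ∈ Icc (D.z (-1)) (D.z 1))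
    (h2 : line t x y s₂ ∈ Icc (D.z (-1)) (D.z 1)) (hs : s ∈ Icc s₁ s₂) :
    line t x y s ∈ Icc (D.z (-1)) (D.z 1) := by
  rw [D.mem_cusp_iff y] at *
  have e : ∀ s, sg y * (D.z y - line t x y s) = -(sg y * (line t x y s - D.z y)) :=
    fun s => by ring
  simp only [e, sg_mul_line_sub] at *
  exact ⟨by linarith [hs.1], by linarith [hs.2]⟩

theorem intervalIntegrable_l {s₁ s₂ : ℝ} :
    IntervalIntegrable (fun s => A.l (A.q s (line t x y s))) volume s₁ s₂ :=
  Antitone.intervalIntegrable fun _ _ h => A.l_anti (A.q_line_mono h)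

theorem intervalIntegrable_loss {s₁ s₂ : ℝ} (h12 : s₁ ≤ s₂)
    (h1 : line t x y s₁ ∈ Icc (D.z (-1)) (D.z 1))
    (h2 : line t x y s₂ ∈ Icc (D.z (-1)) (D.z 1)) :
    IntervalIntegrable (A.loss t x y) volume s₁ s₂ := by
  refine A.intervalIntegrable_l.add (intervalIntegrable_of_bounded
    (M := D.M * A.p s₂ * (2 * (|A.B| + D.K + 2 + |A.κ 1| + |A.κ (-1)|)))
    (A.measurable_rate.mul ((A.measurable_V_line _).sub (A.measurable_V_line _))) h12
    fun s hs => ?_)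
  have hm := line_mem h1 h2 hs
  rw [abs_mul]
  refine mul_le_mul (A.rate_le hs.2 hm) ?_ (abs_nonneg _)
    (mul_nonneg D.M_nonneg (A.p_pos _).le)
  have a1 := abs_le.1 (A.abs_V_le (t := s) (y := -y) hm)
  have a2 := abs_le.1 (A.abs_V_le (t := s) (y := y) hm)
  rw [abs_le]
  constructor <;> linarith

/-- The supersolution decreases enough on `[s₁, s₂]`. -/
def Decreases (t x : ℝ) (y : ℤˣ) (s₁ s₂ : ℝ) : Prop :=
  A.V s₂ (line t x y s₂) y ≤ A.V s₁ (line t x y s₁) y - ∫ r in s₁..s₂, A.loss t x y r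

theorem Decreases.refl (s : ℝ) : A.Decreases t x y s s := by simp [Decreases]

variable {A} in
theorem Decreases.trans {s₁ s₂ s₃ : ℝ} (h12 : s₁ ≤ s₂) (h23 : s₂ ≤ s₃)
    (m1 : line t x y s₁ ∈ Icc (D.z (-1)) (D.z 1)) (m3 : line t x y s₃ ∈ Icc (D.z (-1)) (D.z 1))
    (h : A.Decreases t x y s₁ s₂) (h' : A.Decreases t x y s₂ s₃) : A.Decreases t x y s₁ s₃ := by
  have m2 := line_mem m1 m3 ⟨h12, h23⟩
  have := intervalIntegral.integral_add_adjacent_intervals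
    (A.intervalIntegrable_loss h12 m1 m2) (A.intervalIntegrable_loss h23 m2 m3)
  unfold Decreases at *
  linarith

theorem integral_l_le {s₁ s₂ : ℝ} (h : s₁ ≤ s₂) :
    ∫ s in s₁..s₂, A.l (A.q s (line t x y s)) ≤ A.l (A.q s₁ (line t x y s₁)) * (s₂ - s₁) := by
  have h1 : ∫ s in s₁..s₂, A.l (A.q s (line t x y s)) ≤
      ∫ _ in s₁..s₂, A.l (A.q s₁ (line t x y s₁)) :=
    intervalIntegral.integral_mono_on h A.intervalIntegrable_l (by simp) fun s hs =>
      A.l_anti (A.q_line_mono hs.1)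
  simpa [mul_comm] using h1

theorem V_eq_Vdown (h : sg y * (x - D.b (-y)) ≤ 0) : A.V t x y = A.corr t x + A.Vdown t x y := by
  have hb := D.sg_b_sub_b y
  have h1 : ¬ 0 < sg y * (x - D.b y) := by
    have := D.lt_mid; rw [not_lt]; nlinarith
  unfold V
  rw [if_neg h1]
  rcases h.lt_or_eq with h2 | h2
  · rw [if_pos h2]
  · rw [if_neg h2.not_lt]
    have h3 : x = D.b (-y) := by
      have := sg_mul_sg_mul y (x - D.b (-y)); rw [h2] at this; linarith
    subst h3
    simp [Vdown]

theorem V_eq_F (h : x ∈ Icc (D.b (-1)) (D.b 1)) :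
    A.V t x y = A.corr t x + D.F A.α A.β A.B (A.q t x) y x := by
  obtain ⟨h1, h2⟩ := (D.mem_inner_iff y).1 h
  unfold V
  rw [if_neg (by linarith), if_neg (by linarith)]

theorem V_eq_Vup (h : 0 < sg y * (x - D.b y)) : A.V t x y = A.corr t x + A.Vup t x y := by
  unfold V; rw [if_pos h]

/-- On a descent the jump rate vanishes and the remaining distance shrinks at unit speed, so l times
that distance pays the running cost. The growth of q along the line only lowers `l` and the
corrected `F`. -/
theorem decreases_down {s₁ s₂ : ℝ} (h12 : s₁ ≤ s₂)
    (m1 : line t x y s₁ ∈ Icc (D.z (-1)) (D.z 1))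
    (h2 : sg y * (line t x y s₂ - D.b (-y)) ≤ 0) : A.Decreases t x y s₁ s₂ := by
  have hpos : ∀ s ∈ Icc s₁ s₂, sg y * (line t x y s - D.b (-y)) ≤ 0 := by
    intro s hs; rw [sg_mul_line_sub] at *; linarith [hs.2]
  have hloss : ∀ s ∈ Icc s₁ s₂, A.loss t x y s = A.l (A.q s (line t x y s)) := by
    intro s hs
    have h3 := ((D.mem_cusp_iff y).1 m1).1
    have h4 : 0 ≤ sg y * (line t x y s - D.z (-y)) := by
      rw [sg_mul_line_sub] at *; linarith [hs.1]
    unfold loss rate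
    rw [D.ρ_eq_zero (hpos s hs) h4]; ring
  unfold Decreases
  rw [A.V_eq_Vdown h2, A.V_eq_Vdown (hpos s₁ ⟨le_rfl, h12⟩),
    intervalIntegral.integral_congr (g := fun s => A.l (A.q s (line t x y s)))
      (fun s hs => hloss s (by rwa [uIcc_of_le h12] at hs))]
  have hq := A.q_line_mono (t := t) (x := x) (y := y) h12
  have e1 := A.integral_l_le (t := t) (x := x) (y := y) h12
  have e2 := D.F_add_anti A.B A.abs_le_one A.β_mem (A.q_pos _ _).le hq y (D.b_mem (-y))
  have e3 := mul_le_mul_of_nonneg_left (A.H_anti h12) (div_nonneg D.M_nonneg D.η_pos.le)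
  have e4 := A.l_anti hq
  have e5 : sg y * (D.b (-y) - line t x y s₁) = sg y * (D.b (-y) - line t x y s₂) + (s₂ - s₁) := by
    have a1 := sg_mul_line_sub t x y s₁ (D.b (-y))
    have a2 := sg_mul_line_sub t x y s₂ (D.b (-y))
    linarith
  have e6 : 0 ≤ sg y * (D.b (-y) - line t x y s₂) := by linarith
  have e7 := mul_le_mul_of_nonneg_right e4 e6
  simp only at e2 e4 e7
  unfold corr Vdown
  rw [e5]
  linarith

theorem integral_F_line (q : ℝ) (y : ℤˣ) (t x s₁ s₂ : ℝ) :
    D.F A.α A.β A.B q y (line t x y s₂) - D.F A.α A.β A.B q y (line t x y s₁) =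
      ∫ s in s₁..s₂, (-A.l q + q * D.ρ y (line t x y s) *
        (sg y * D.g A.α A.β q (line t x y s))) := by
  refine (intervalIntegral.integral_eq_sub_of_hasDerivAt
    (f := fun s => D.F A.α A.β A.B q y (line t x y s)) (fun s _ => ?_) ?_).symm
  · have h1 : HasDerivAt (line t x y) (sg y) s := by
      have := (((hasDerivAt_id s).sub_const t).const_mul (sg y)).const_add x
      rw [mul_one] at this
      exact this
    have h2 := (D.hasDerivAt_F A.α A.β A.B q y (line t x y s)).comp s h1
    refine h2.congr_deriv ?_
    rw [mul_right_comm, sg_mul_self, one_mul]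
    rfl
  · refine Continuous.intervalIntegrable ?_ _ _
    have h1 : Continuous fun s => D.g A.α A.β q (line t x y s) :=
      (D.continuous_g A.α A.β).comp (continuous_const.prodMk (continuous_line t x y))
    have h2 := (D.continuous_ρ y).comp (continuous_line t x y)
    exact continuous_const.add ((continuous_const.mul h2).mul (continuous_const.mul h1))

/-- Two temperature errors occur. Freezing q at its value at s₁ costs a decrement of `c`, which
becomes of second order after integration. Using q in place of the true p(s) in the jump rate costs
(q - p)·e^{-ηq}, which the decrease of `H` repays. -/
theorem inner_pointwise {s₁ s : ℝ} (h : s₁ ≤ s)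
    (hm : line t x y s ∈ Icc (D.b (-1)) (D.b 1)) :
    -A.l (A.q s₁ (line t x y s₁)) + A.q s₁ (line t x y s₁) * D.ρ y (line t x y s) *
        (sg y * D.g A.α A.β (A.q s₁ (line t x y s₁)) (line t x y s)) +
      D.M / D.η * (Real.exp (-(D.η * A.p (s + D.L))) - Real.exp (-(D.η * A.p s))) ≤
    -A.loss t x y s + D.M * D.lip * (D.c (A.q s₁ (line t x y s₁)) - D.c (A.q s (line t x y s))) := by
  have hq := A.q_line_mono (t := t) (x := x) (y := y) h
  simp only at hq
  have hV : A.V s (line t x y s) (-y) - A.V s (line t x y s) y =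
      -(sg y * D.g A.α A.β (A.q s (line t x y s)) (line t x y s)) := by
    rw [A.V_eq_F hm, A.V_eq_F hm, ← D.F_sub_F A.α A.β A.B]; ring
  unfold loss rate
  rw [hV]
  set q₁ := A.q s₁ (line t x y s₁) with hq₁
  set q := A.q s (line t x y s) with hqd
  set X := line t x y s with hX
  have hq0 : 0 < q₁ := A.q_pos _ _
  have hρ0 := D.ρ_nonneg y X
  have hρM := D.ρ_le (y := y) (D.inner_sub hm)
  have e1 := A.l_anti hq
  have e2 := (D.abs_g_sub_le A.abs_le_one A.β_mem hq0.le hq hm).2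
  have e3 := D.abs_g_le A.abs_le_one (hq0.le.trans hq) hm
  have hc0 : 0 ≤ D.lip * (D.c q₁ - D.c q) := mul_nonneg D.lip_nonneg (sub_nonneg.2 (D.c_anti hq))
  have key : ∀ {W C : ℝ}, |W| ≤ C → D.ρ y X * (sg y * W) ≤ D.M * C := by
    intro W C hW
    have h1 : sg y * W ≤ C := by
      refine (le_abs_self _).trans ?_
      rw [abs_mul, abs_sg, one_mul]; exact hW
    have h2 := mul_le_mul_of_nonneg_left h1 hρ0
    have h3 := mul_le_mul_of_nonneg_right hρM ((abs_nonneg W).trans hW)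
    linarith
  have e4 := key e2
  have hpq : A.p s ≤ q := A.p_le_q _ _
  have e5 := key (W := (q - A.p s) * D.g A.α A.β q X) (C := (q - A.p s) * (D.c q * D.c q)) (by
    rw [abs_mul, abs_of_nonneg (sub_nonneg.2 hpq)]
    exact mul_le_mul_of_nonneg_left e3 (sub_nonneg.2 hpq))
  have hcc : D.c q * D.c q = Real.exp (-(D.η * q)) := by
    unfold CuspData.c; rw [← Real.exp_add]; ring_nf
  -- Uses 1 + a ≤ e^a with a = η(q - p s), and then q ≤ p(s + L).
  have e6 : D.η * ((q - A.p s) * (D.c q * D.c q)) ≤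
      Real.exp (-(D.η * A.p s)) - Real.exp (-(D.η * A.p (s + D.L))) := by
    have h1 : Real.exp (-(D.η * A.p s)) =
        Real.exp (-(D.η * q)) * Real.exp (D.η * (q - A.p s)) := by
      rw [← Real.exp_add]; ring_nf
    have h2 := mul_le_mul_of_nonneg_left (Real.add_one_le_exp (D.η * (q - A.p s)))
      (Real.exp_pos (-(D.η * q))).le
    have h3 : Real.exp (-(D.η * A.p (s + D.L))) ≤ Real.exp (-(D.η * q)) :=
      Real.exp_le_exp.2 (by have := A.q_le s X; nlinarith [D.η_pos])
    rw [hcc, h1]; linarith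
  have e7 := mul_le_mul_of_nonneg_left e6 (div_nonneg D.M_nonneg D.η_pos.le)
  have e8 : D.M / D.η * (D.η * ((q - A.p s) * (D.c q * D.c q))) =
      D.M * ((q - A.p s) * (D.c q * D.c q)) := by
    have := D.η_pos; field_simp
  rw [e8] at e7
  linarith

/-- The temperature may jump, so V is not differentiable along the line. On a short interval the
change of q is discarded by `F_add_anti` and the equation is integrated at the frozen initial q. The
error is the length of the interval times the increment of the monotone function -c(q), as
`le_of_increment_le` requires. -/
theorem decreases_inner {s₁ s₂ : ℝ} (h12 : s₁ ≤ s₂)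
    (m1 : line t x y s₁ ∈ Icc (D.b (-1)) (D.b 1))
    (m2 : line t x y s₂ ∈ Icc (D.b (-1)) (D.b 1)) : A.Decreases t x y s₁ s₂ := by
  have hm : ∀ s ∈ Icc s₁ s₂, line t x y s ∈ Icc (D.b (-1)) (D.b 1) := by
    intro s hs
    rw [D.mem_inner_iff y] at *
    have e : ∀ s, sg y * (D.b y - line t x y s) = -(sg y * (line t x y s - D.b y)) :=
      fun s => by ring
    simp only [e, sg_mul_line_sub] at *
    exact ⟨by linarith [hs.1], by linarith [hs.2]⟩
  have key := le_of_increment_le (K := D.M * D.lip)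
    (D := fun s => A.V s (line t x y s) y + ∫ r in s₁..s, A.loss t x y r)
    (Q := fun s => -D.c (A.q s (line t x y s))) h12 ?_
  · simp only [intervalIntegral.integral_same, add_zero] at key
    unfold Decreases; linarith
  · intro s u hs1 hsu hu2
    have ms := hm s ⟨hs1, hsu.trans hu2⟩
    have mu := hm u ⟨hs1.trans hsu, hu2⟩
    have hi1 := A.intervalIntegrable_loss hs1 (D.inner_sub m1) (D.inner_sub ms)
    have hi2 := A.intervalIntegrable_loss hsu (D.inner_sub ms) (D.inner_sub mu)
    have a1 := intervalIntegral.integral_add_adjacent_intervals hi1 hi2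
    have hq := A.q_line_mono (t := t) (x := x) (y := y) hsu
    have a2 := D.F_add_anti A.B A.abs_le_one A.β_mem (A.q_pos _ _).le hq y mu
    have a3 := A.integral_F_line (A.q s (line t x y s)) y t x s u
    have a4 := A.H_sub s u
    simp only at a2 hq
    have cont : Continuous fun r => -A.l (A.q s (line t x y s)) +
        A.q s (line t x y s) * D.ρ y (line t x y r) *
        (sg y * D.g A.α A.β (A.q s (line t x y s)) (line t x y r)) := by
      have h1 : Continuous fun r => D.g A.α A.β (A.q s (line t x y s)) (line t x y r) :=
        (D.continuous_g A.α A.β).comp (continuous_const.prodMk (continuous_line t x y))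
      have h2 := (D.continuous_ρ y).comp (continuous_line t x y)
      exact continuous_const.add ((continuous_const.mul h2).mul (continuous_const.mul h1))
    have ie : IntervalIntegrable (fun r => D.M / D.η *
        (Real.exp (-(D.η * A.p (r + D.L))) - Real.exp (-(D.η * A.p r)))) volume s u := by
      refine (IntervalIntegrable.sub ?_ (A.intervalIntegrable_expp _ _)).const_mul _
      refine Antitone.intervalIntegrable fun r r' h => Real.exp_le_exp.2 ?_
      have := A.p_mono (add_le_add_left h D.L)
      nlinarith [D.η_pos]
    have a5 := intervalIntegral.integral_mono_on hsu ((cont.intervalIntegrable s u).add ie)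
      (hi2.neg.add (intervalIntegrable_const (c := D.M * D.lip *
        (D.c (A.q s (line t x y s)) - D.c (A.q u (line t x y u)))))) (fun r hr => by
        have h1 := A.inner_pointwise hr.1 (hm r ⟨hs1.trans hr.1, hr.2.trans hu2⟩)
        have h2 := D.c_anti (A.q_line_mono (t := t) (x := x) (y := y) hr.2)
        have h3 := mul_le_mul_of_nonneg_left h2 (mul_nonneg D.M_nonneg D.lip_nonneg)
        simp only [Pi.neg_apply] at h3 ⊢
        linarith)
    rw [intervalIntegral.integral_add (cont.intervalIntegrable s u) ie, ← a3,
      intervalIntegral.integral_const_mul, ← a4,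
      intervalIntegral.integral_add hi2.neg intervalIntegrable_const,
      intervalIntegral.integral_const, smul_eq_mul] at a5
    have a6 : (∫ r in s..u, (-A.loss t x y) r) = -∫ r in s..u, A.loss t x y r :=
      intervalIntegral.integral_neg
    rw [a6] at a5
    rw [A.V_eq_F ms, A.V_eq_F mu, ← a1]
    unfold corr
    linarith

theorem G_line (s : ℝ) : A.G y s (line t x y s) =
    Real.exp (-∫ r in s..t + sg y * (D.z y - x), A.rate t x y r) := by
  unfold G rate
  congr 2
  have h1 : sg y * (D.z y - line t x y s) = t + sg y * (D.z y - x) - s := by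
    have := sg_mul_line_sub t x y s (D.z y); linarith
  have h2 := intervalIntegral.integral_comp_add_left (a := 0)
    (b := t + sg y * (D.z y - x) - s) (fun r => D.ρ y (line t x y r) * A.p r) s
  rw [add_zero, add_sub_cancel] at h2
  rw [h1, ← h2]
  congr 1
  ext r
  unfold line
  ring_nf

/-- The backward equation G' = rate·G along the line, in integrated form. It involves the actual p
at later times, so the variation of the temperature during a climb produces no error. -/
theorem integral_rate_mul_G {s₁ s₂ : ℝ} (h12 : s₁ ≤ s₂)
    (m1 : line t x y s₁ ∈ Icc (D.z (-1)) (D.z 1))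
    (m2 : line t x y s₂ ∈ Icc (D.z (-1)) (D.z 1)) :
    IntervalIntegrable (fun s => A.rate t x y s * A.G y s (line t x y s)) volume s₁ s₂ ∧
    ∫ s in s₁..s₂, A.rate t x y s * A.G y s (line t x y s) =
      A.G y s₂ (line t x y s₂) - A.G y s₁ (line t x y s₁) := by
  set e := t + sg y * (D.z y - x) with he
  have hs2e : s₂ ≤ e := by
    have h1 := ((D.mem_cusp_iff y).1 m2).2
    have := sg_mul_line_sub t x y s₂ (D.z y); linarith
  have me : line t x y e ∈ Icc (D.z (-1)) (D.z 1) := by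
    have h1 := ((D.mem_cusp_iff y).1 m2).1
    have h2 := sg_mul_line_sub t x y e (D.z y)
    have h3 := sg_mul_line_sub t x y e (D.z (-y))
    have h4 := sg_mul_line_sub t x y s₂ (D.z (-y))
    rw [D.mem_cusp_iff y]
    constructor <;> linarith
  have hb : ∀ s ∈ Icc s₁ e, |A.rate t x y s| ≤ D.M * A.p e := fun s hs =>
    A.rate_le hs.2 (line_mem m1 me hs)
  have ir : ∀ {u v}, u ∈ Icc s₁ e → v ∈ Icc s₁ e → u ≤ v →
      IntervalIntegrable (A.rate t x y) volume u v := fun hu hv huv =>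
    intervalIntegrable_of_bounded A.measurable_rate huv
      fun s hs => hb s ⟨hu.1.trans hs.1, hs.2.trans hv.2⟩
  have hcG : ContinuousOn (fun s => A.G y s (line t x y s)) (uIcc s₁ e) := by
    simp_rw [A.G_line]
    have h1 := (ir ⟨le_rfl, h12.trans hs2e⟩ ⟨h12.trans hs2e, le_rfl⟩
      (h12.trans hs2e)).absolutelyContinuousOnInterval_intervalIntegral
      (c := e) right_mem_uIcc
    refine (h1.continuousOn).rexp.congr fun s _ => ?_
    simp only [← he]
    rw [intervalIntegral.integral_symm, neg_neg]
  have ig : ∀ {u v}, u ∈ Icc s₁ e → v ∈ Icc s₁ e → u ≤ v → IntervalIntegrable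
      (fun s => A.rate t x y s * A.G y s (line t x y s)) volume u v := fun hu hv huv =>
    (ir hu hv huv).mul_continuousOn (hcG.mono (by
      rw [uIcc_of_le huv, uIcc_of_le (h12.trans hs2e)]
      exact Icc_subset_Icc hu.1 hv.2))
  have key : ∀ s ∈ Icc s₁ e, A.G y s (line t x y s) =
      1 - ∫ r in s..e, A.rate t x y r * A.G y r (line t x y r) := by
    intro s hs
    -- `G` is a survival probability from s up to the end e of the climb, hence `survival_eq` is
    -- applied after reversing time.
    have h1 := survival_eq (a := fun r => A.rate t x y (-r)) (s₀ := -e) (s₁ := -s)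
      (M := D.M * A.p e) (A.measurable_rate.comp measurable_neg) (by linarith [hs.2])
      (fun r hr => hb _ ⟨by linarith [hr.2, hs.1], by linarith [hr.1]⟩)
      (fun r _ => A.rate_nonneg _)
    simp_rw [intervalIntegral.integral_comp_neg (A.rate t x y), neg_neg] at h1
    rw [A.G_line, h1]
    congr 1
    have h2 := intervalIntegral.integral_comp_neg (a := -e) (b := -s)
      (fun r => A.rate t x y r * Real.exp (-∫ u in r..e, A.rate t x y u))
    rw [neg_neg, neg_neg] at h2
    rw [h2]
    simp_rw [A.G_line, ← he]
  have k1 := key s₁ ⟨le_rfl, h12.trans hs2e⟩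
  have k2 := key s₂ ⟨h12, hs2e⟩
  have i12 := ig (u := s₁) (v := s₂) ⟨le_rfl, h12.trans hs2e⟩ ⟨h12, hs2e⟩ h12
  have i2e := ig (u := s₂) (v := e) ⟨h12, hs2e⟩ ⟨h12.trans hs2e, le_rfl⟩ hs2e
  have := intervalIntegral.integral_add_adjacent_intervals i12 i2e
  exact ⟨i12, by linarith⟩

/-- Inside the climbing region this is an equality. At the junction `b y`, where V takes its inner
value, it is the `entry` condition. -/
theorem Vup_le_V (h : 0 ≤ sg y * (x - D.b y)) : A.corr t x + A.Vup t x y ≤ A.V t x y := by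
  rcases h.lt_or_eq with h1 | h1
  · rw [A.V_eq_Vup h1]
  · have h3 : x = D.b y := by
      have := sg_mul_sg_mul y (x - D.b y); rw [← h1] at this; linarith
    subst h3
    rw [A.V_eq_F (D.b_mem y)]
    have h2 := A.entry y t
    have h3 := D.F_sub_F A.α A.β A.B (A.q t (D.b y)) y (D.b y)
    have h4 : A.β / D.Z (A.q t (D.b y)) = 2 * A.l (A.q t (D.b y)) := by
      have := D.Z_pos (A.q t (D.b y)); unfold l; field_simp
    change A.β / D.Z (A.q t (D.b y)) * _ - sg y * D.g A.α A.β (A.q t (D.b y)) (D.b y) ≤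
      A.κ y * A.G y t (D.b y) at h2
    rw [h4] at h2
    unfold Vup
    rw [sub_self, mul_zero, sub_zero]
    linarith

/-- A jump during the climb leads to the descent with velocity -y, which starts with the same inner
value F(-y). The distance term in `Vup`, twice the length of the end piece minus the distance
already climbed, covers climbing on and returning, so the jump raises V by at most κG. The jump term
is thus at most κ·rate·G, which G' = rate·G cancels exactly. -/
theorem decreases_up {s₁ s₂ : ℝ} (h12 : s₁ ≤ s₂)
    (h1 : 0 ≤ sg y * (line t x y s₁ - D.b y))
    (m2 : line t x y s₂ ∈ Icc (D.z (-1)) (D.z 1)) : A.Decreases t x y s₁ s₂ := by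
  rcases h12.eq_or_lt with rfl | hlt
  · exact Decreases.refl A _
  have hpos : ∀ s, s₁ < s → 0 < sg y * (line t x y s - D.b y) := by
    intro s hs; rw [sg_mul_line_sub] at *; linarith
  have m1 : line t x y s₁ ∈ Icc (D.z (-1)) (D.z 1) := by
    have a1 := ((D.mem_cusp_iff y).1 m2).2
    have a2 := ((D.mem_inner_iff y).1 (D.b_mem y)).1
    have a3 := ((D.mem_cusp_iff y).1 (D.inner_sub (D.b_mem (-y)))).1
    have a4 := sg_mul_line_sub t x y s₁ (D.z y)
    have a5 := sg_mul_line_sub t x y s₂ (D.z y)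
    rw [D.mem_cusp_iff y]
    constructor <;> linarith
  obtain ⟨iG, hG⟩ := A.integral_rate_mul_G h12 m1 m2
  -- The left end is left out because there V may still have its inner value.
  have hloss : ∀ s ∈ Ioo s₁ s₂, A.loss t x y s ≤ A.l (A.q s (line t x y s)) +
      A.κ y * (A.rate t x y s * A.G y s (line t x y s)) := by
    intro s hs
    have a1 := hpos s hs.1
    have a2 : sg (-y) * (line t x y s - D.b (- -y)) ≤ 0 := by
      rw [neg_neg, sg_neg]; linarith
    have a3 := ((D.mem_cusp_iff y).1 (line_mem m1 m2 (Ioo_subset_Icc_self hs))).2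
    have a4 := mul_nonneg (A.rate_nonneg (t := t) (x := x) (y := y) s)
      (mul_nonneg (A.l_nonneg (A.q s (line t x y s))) a3)
    unfold loss
    rw [A.V_eq_Vup a1, A.V_eq_Vdown a2]
    unfold Vup Vdown
    rw [neg_neg, sg_neg]
    linarith
  have b1 := intervalIntegral.integral_mono_on_of_le_Ioo h12
    (A.intervalIntegrable_loss h12 m1 m2) (A.intervalIntegrable_l.add (iG.const_mul (A.κ y))) hloss
  rw [intervalIntegral.integral_add A.intervalIntegrable_l (iG.const_mul (A.κ y)),
    intervalIntegral.integral_const_mul, hG] at b1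
  have hq := A.q_line_mono (t := t) (x := x) (y := y) h12
  have e1 := A.integral_l_le (t := t) (x := x) (y := y) h12
  have e2 := D.F_add_anti A.B A.abs_le_one A.β_mem (A.q_pos _ _).le hq (-y) (D.b_mem y)
  have e3 := mul_le_mul_of_nonneg_left (A.H_anti h12) (div_nonneg D.M_nonneg D.η_pos.le)
  have e4 := A.l_anti hq
  have e5 : sg y * (line t x y s₁ - D.b y) = sg y * (line t x y s₂ - D.b y) - (s₂ - s₁) := by
    rw [sg_mul_line_sub, sg_mul_line_sub]; ring
  have e6 : 0 ≤ 2 * (sg y * (D.z y - D.b y)) - sg y * (line t x y s₂ - D.b y) := by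
    have a1 := ((D.mem_cusp_iff y).1 m2).2
    have a2 := D.sg_z_sub_b_pos y
    linarith
  have e7 := mul_le_mul_of_nonneg_right e4 e6
  have e8 := A.Vup_le_V (t := s₁) h1
  simp only at e2 e4 e7
  unfold Decreases
  rw [A.V_eq_Vup (hpos s₂ hlt)]
  unfold corr Vup at *
  rw [e5] at e8
  linarith

/-- The supersolution decreases enough along every line inside the cusp. -/
theorem decreases {s : ℝ} (hs : t ≤ s) (m1 : x ∈ Icc (D.z (-1)) (D.z 1))
    (m2 : line t x y s ∈ Icc (D.z (-1)) (D.z 1)) : A.Decreases t x y t s := by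
  have m1' : line t x y t ∈ Icc (D.z (-1)) (D.z 1) := by simpa using m1
  set sA := t + sg y * (D.b (-y) - x) with hA
  set sB := t + sg y * (D.b y - x) with hB
  have hAB : sA < sB := by
    have := D.sg_b_sub_b y; have := D.lt_mid; rw [hA, hB]; linarith
  have lA : ∀ u, sg y * (line t x y u - D.b (-y)) = u - sA := fun u => by
    rw [sg_mul_line_sub, hA]; ring
  have lB : ∀ u, sg y * (line t x y u - D.b y) = u - sB := fun u => by
    rw [sg_mul_line_sub, hB]; ring
  -- The times sA and sB at which the line meets `b (-y)` and `b y` are clamped to [t, s], so that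
  -- absent regions become empty intervals.
  set u₁ := max t (min s sA) with hu1
  set u₂ := max t (min s sB) with hu2
  have h1 : t ≤ u₁ := le_max_left _ _
  have h2 : u₁ ≤ u₂ := max_le_max le_rfl (min_le_min le_rfl hAB.le)
  have h3 : u₂ ≤ s := max_le hs (min_le_left _ _)
  have mm : ∀ {u}, t ≤ u → u ≤ s → line t x y u ∈ Icc (D.z (-1)) (D.z 1) := fun a b =>
    line_mem m1' m2 ⟨a, b⟩
  have p1 : A.Decreases t x y t u₁ := by
    rcases h1.eq_or_lt with h | h
    · rw [← h]; exact Decreases.refl A _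
    · refine A.decreases_down h1 m1' ?_
      have : u₁ ≤ sA := by
        rcases max_choice t (min s sA) with h' | h'
        · rw [hu1, h'] at h; exact absurd h (lt_irrefl _)
        · rw [hu1, h']; exact min_le_right _ _
      rw [lA]; linarith
  have p2 : A.Decreases t x y u₁ u₂ := by
    rcases h2.eq_or_lt with h | h
    · rw [← h]; exact Decreases.refl A _
    · have a1 : u₂ ≤ sB := by
        rcases max_choice t (min s sB) with h' | h'
        · rw [hu2, h'] at h; exact absurd h1 (not_le.2 h)
        · rw [hu2, h']; exact min_le_right _ _
      have a2 : sA ≤ u₁ := by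
        by_contra hc
        have : s ≤ u₁ := by
          by_contra hc2
          push Not at hc hc2
          have : min s sA ≤ u₁ := le_max_right _ _
          rcases min_choice s sA with h' | h' <;> rw [h'] at this <;> linarith
        linarith
      refine A.decreases_inner h2 ?_ ?_ <;> rw [D.mem_inner_iff y]
      · exact ⟨by rw [lA]; linarith, by have := lB u₁; linarith⟩
      · exact ⟨by rw [lA]; linarith, by have := lB u₂; linarith⟩
  have p3 : A.Decreases t x y u₂ s := by
    rcases h3.eq_or_lt with h | h
    · rw [← h]; exact Decreases.refl A _
    · have a2 : sB ≤ u₂ := by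
        by_contra hc
        push Not at hc
        have : min s sB ≤ u₂ := le_max_right _ _
        rcases min_choice s sB with h' | h' <;> rw [h'] at this <;> linarith
      exact A.decreases_up h3 (by rw [lB]; linarith) m2
  exact (p1.trans h1 h2 m1' (mm (h1.trans h2) h3) p2).trans (h1.trans h2) h3 m1' m2 p3

end Barrier

end VelocityJump

/-! ### Trajectories driven by deterministic thresholds -/

namespace VelocityJump

/-- A potential with continuous derivative and a cooling schedule on the whole line. -/
structure Dyn where
  U : ℝ → ℝ
  ε : ℝ → ℝ
  cont : Continuous (deriv U)
  pos : ∀ t, 0 < ε t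
  anti : Antitone ε

namespace Dyn

variable (S : Dyn)

/-- The jump rate along the line through `(t, x)` with velocity `y`. -/
noncomputable def rate (t x : ℝ) (y : ℤˣ) (s : ℝ) : ℝ := jumpRate S.U S.ε s (line t x y s) y

/-- The integrated jump rate. -/
noncomputable def Lam (t x : ℝ) (y : ℤˣ) (s : ℝ) : ℝ := ∫ r in t..s, S.rate t x y r

/-- The first jump time after `t`, started from `(x, y)` with threshold `e`. -/
noncomputable def nextT (t x : ℝ) (y : ℤˣ) (e : ℝ) : EReal :=
  nextJumpTime S.U S.ε e ⟨(t : EReal), x, y⟩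

/-- The chain of jumps. -/
noncomputable def chain (t x : ℝ) (y : ℤˣ) (e : ℕ → ℝ) (i : ℕ) : JumpState :=
  jumpChain S.U S.ε t x y e i

variable {S}

theorem rate_nonneg (t x : ℝ) (y : ℤˣ) (s : ℝ) : 0 ≤ S.rate t x y s :=
  div_nonneg (le_max_right _ _) (S.pos _).le

theorem rate_eq (t x : ℝ) (y : ℤˣ) (s : ℝ) :
    S.rate t x y s = max (sg y * deriv S.U (line t x y s)) 0 * (S.ε s)⁻¹ := rfl

theorem inv_mono : Monotone fun t => (S.ε t)⁻¹ := fun _ _ h =>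
  inv_anti₀ (S.pos _) (S.anti h)

theorem measurable_rate (y : ℤˣ) :
    Measurable fun w : (ℝ × ℝ) × ℝ => S.rate w.1.1 w.1.2 y w.2 := by
  have h1 := S.cont.measurable
  have h2 : Measurable fun w : (ℝ × ℝ) × ℝ => (S.ε w.2)⁻¹ :=
    (inv_mono (S := S)).measurable.comp measurable_snd
  simp_rw [rate_eq]
  unfold line
  exact Measurable.mul (by fun_prop) h2

theorem exists_rate_bound (t x : ℝ) (y : ℤˣ) (s₁ s₂ : ℝ) :
    ∃ M, ∀ s ∈ Icc s₁ s₂, |S.rate t x y s| ≤ M := by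
  obtain ⟨C, hC⟩ := (isCompact_Icc (a := s₁) (b := s₂)).exists_bound_of_continuousOn
    (f := fun s => deriv S.U (line t x y s)) (S.cont.comp (continuous_line t x y)).continuousOn
  refine ⟨C * (S.ε s₂)⁻¹, fun s hs => ?_⟩
  rw [abs_of_nonneg (rate_nonneg t x y s), rate_eq]
  have h1 := hC s hs
  rw [Real.norm_eq_abs] at h1
  refine mul_le_mul (max_le ?_ ((abs_nonneg _).trans h1)) (inv_mono hs.2)
    (inv_pos.2 (S.pos _)).le ((abs_nonneg _).trans h1)
  refine (le_abs_self _).trans ?_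
  rw [abs_mul, abs_sg, one_mul]; exact h1

theorem measurable_rate' (t x : ℝ) (y : ℤˣ) : Measurable (S.rate t x y) :=
  (measurable_rate (S := S) y).comp
    ((measurable_const (a := (t, x))).prodMk measurable_id)

theorem intervalIntegrable_rate (t x : ℝ) (y : ℤˣ) (s₁ s₂ : ℝ) :
    IntervalIntegrable (S.rate t x y) volume s₁ s₂ := by
  rcases le_total s₁ s₂ with h | h
  · obtain ⟨M, hM⟩ := exists_rate_bound (S := S) t x y s₁ s₂
    exact intervalIntegrable_of_bounded (measurable_rate' t x y) h hM
  · obtain ⟨M, hM⟩ := exists_rate_bound (S := S) t x y s₂ s₁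
    exact (intervalIntegrable_of_bounded (measurable_rate' t x y) h hM).symm

theorem continuous_Lam (t x : ℝ) (y : ℤˣ) : Continuous (S.Lam t x y) :=
  intervalIntegral.continuous_primitive (fun a b => intervalIntegrable_rate t x y a b) t

theorem Lam_mono (t x : ℝ) (y : ℤˣ) : Monotone (S.Lam t x y) := by
  intro s s' h
  have h1 := intervalIntegral.integral_add_adjacent_intervals
    (intervalIntegrable_rate (S := S) t x y t s) (intervalIntegrable_rate t x y s s')
  have h2 : 0 ≤ ∫ r in s..s', S.rate t x y r :=
    intervalIntegral.integral_nonneg h fun r _ => rate_nonneg t x y r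
  unfold Lam; linarith

@[simp] theorem Lam_self (t x : ℝ) (y : ℤˣ) : S.Lam t x y t = 0 := by simp [Lam]

theorem measurable_Lam (y : ℤˣ) (s : ℝ) : Measurable fun w : ℝ × ℝ => S.Lam w.1 w.2 y s :=
  measurable_intervalIntegral_param (φ := fun w : ℝ × ℝ => fun r => S.rate w.1 w.2 y r)
    (measurable_rate y) measurable_fst measurable_const

theorem nextT_eq (t x : ℝ) (y : ℤˣ) (e : ℝ) : S.nextT t x y e =
    sInf ((fun s : ℝ => (s : EReal)) '' {s : ℝ | t < s ∧ e ≤ S.Lam t x y s}) := by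
  unfold nextT nextJumpTime Lam rate line sg
  simp only [EReal.toReal_coe, EReal.coe_lt_coe_iff]

theorem time_le_nextJumpTime (U ε : ℝ → ℝ) (e : ℝ) (T : JumpState) :
    T.time ≤ nextJumpTime U ε e T := by
  refine le_sInf ?_
  rintro _ ⟨s, hs, rfl⟩
  exact hs.1.le

theorem le_nextT (t x : ℝ) (y : ℤˣ) (e : ℝ) : (t : EReal) ≤ S.nextT t x y e :=
  time_le_nextJumpTime S.U S.ε e ⟨(t : EReal), x, y⟩

theorem nextT_lt_iff {t x : ℝ} {y : ℤˣ} {e : ℝ} {a : EReal} :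
    S.nextT t x y e < a ↔ ∃ s : ℝ, t < s ∧ e ≤ S.Lam t x y s ∧ (s : EReal) < a := by
  rw [nextT_eq, sInf_lt_iff]
  constructor
  · rintro ⟨_, ⟨s, hs, rfl⟩, h⟩; exact ⟨s, hs.1, hs.2, h⟩
  · rintro ⟨s, h1, h2, h3⟩; exact ⟨_, ⟨s, ⟨h1, h2⟩, rfl⟩, h3⟩

theorem nextT_le_iff {t x : ℝ} {y : ℤˣ} {e s : ℝ} (hs : t < s) :
    S.nextT t x y e ≤ s ↔ e ≤ S.Lam t x y s := by
  constructor
  · intro h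
    by_contra hc
    push Not at hc
    have hcont := (continuous_Lam (S := S) t x y).continuousAt (x := s)
    obtain ⟨u, hu, hs'⟩ : ∃ u, s < u ∧ S.Lam t x y u < e := by
      have h1 := hcont.eventually (gt_mem_nhds hc)
      obtain ⟨δ, hδ, hball⟩ := Metric.eventually_nhds_iff.1 h1
      exact ⟨s + δ / 2, by linarith, hball (by
        rw [Real.dist_eq, add_sub_cancel_left, abs_of_pos (half_pos hδ)]; linarith)⟩
    have h2 : S.nextT t x y e < (u : EReal) := h.trans_lt (EReal.coe_lt_coe_iff.2 hu)
    obtain ⟨r, hr1, hr2, hr3⟩ := nextT_lt_iff.1 h2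
    have := Lam_mono (S := S) t x y (EReal.coe_lt_coe_iff.1 hr3).le
    linarith
  · intro h
    rw [nextT_eq]
    exact sInf_le ⟨s, ⟨hs, h⟩, rfl⟩

theorem lt_nextT {t : ℝ} (x : ℝ) (y : ℤˣ) {e : ℝ} (he : 0 < e) : (t : EReal) < S.nextT t x y e := by
  have hcont := (continuous_Lam (S := S) t x y).continuousAt (x := t)
  have h0 : S.Lam t x y t < e := by simpa using he
  obtain ⟨δ, hδ, hball⟩ := Metric.eventually_nhds_iff.1 (hcont.eventually (gt_mem_nhds h0))
  have h1 : S.Lam t x y (t + δ / 2) < e := hball (by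
        rw [Real.dist_eq, add_sub_cancel_left, abs_of_pos (half_pos hδ)]; linarith)
  have h2 : ¬ S.nextT t x y e ≤ ((t + δ / 2 : ℝ) : EReal) := by
    rw [nextT_le_iff (by linarith)]; linarith
  refine lt_trans ?_ (not_le.1 h2)
  exact EReal.coe_lt_coe_iff.2 (by linarith)

theorem nextT_ne_bot (t x : ℝ) (y : ℤˣ) (e : ℝ) : S.nextT t x y e ≠ ⊥ :=
  ((EReal.bot_lt_coe t).trans_le (le_nextT t x y e)).ne'

theorem measurable_nextT (y : ℤˣ) :
    Measurable fun w : (ℝ × ℝ) × ℝ => S.nextT w.1.1 w.1.2 y w.2 := by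
  refine measurable_of_Iio fun a => ?_
  have : (fun w : (ℝ × ℝ) × ℝ => S.nextT w.1.1 w.1.2 y w.2) ⁻¹' Iio a =
      ⋃ r : ℚ, {w | w.1.1 < (r : ℝ) ∧ w.2 ≤ S.Lam w.1.1 w.1.2 y r ∧ ((r : ℝ) : EReal) < a} := by
    ext w
    simp only [mem_preimage, mem_Iio, mem_iUnion, mem_ofPred_eq]
    rw [nextT_lt_iff]
    constructor
    · rintro ⟨s, h1, h2, h3⟩
      obtain ⟨u, hu1, hu2⟩ := EReal.lt_iff_exists_real_btwn.1 h3
      obtain ⟨r, hr1, hr2⟩ := exists_rat_btwn (EReal.coe_lt_coe_iff.1 hu1)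
      exact ⟨r, h1.trans hr1, h2.trans (Lam_mono _ _ _ hr1.le),
        (EReal.coe_lt_coe_iff.2 hr2).trans hu2⟩
    · rintro ⟨r, h1, h2, h3⟩; exact ⟨r, h1, h2, h3⟩
  rw [this]
  refine MeasurableSet.iUnion fun r => ?_
  refine (measurableSet_lt (measurable_fst.comp measurable_fst) measurable_const).inter
    ((measurableSet_le measurable_snd ((measurable_Lam y r).comp measurable_fst)).inter ?_)
  exact MeasurableSet.const _

/-! ### The chain seen from its first jump -/

theorem chain_time_mono (t x : ℝ) (y : ℤˣ) (e : ℕ → ℝ) :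
    Monotone fun i => (S.chain t x y e i).time :=
  monotone_nat_of_le_succ fun _ => time_le_nextJumpTime _ _ _ _

/-- Renewal at the first jump, on which the inductions over the number of jumps rest. -/
theorem chain_succ {t x : ℝ} {y : ℤˣ} {e : ℕ → ℝ} {τ : ℝ} (h : S.nextT t x y (e 0) = τ) (i : ℕ) :
    S.chain t x y e (i + 1) = S.chain τ (line t x y τ) (-y) (fun k => e (k + 1)) i := by
  induction i with
  | zero =>
    change JumpState.mk (S.nextT t x y (e 0)) _ _ = JumpState.mk _ _ _
    have h' : nextJumpTime S.U S.ε (e 0) (jumpChain S.U S.ε t x y e 0) = τ := h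
    rw [h, h', EReal.toReal_coe]
    rfl
  | succ i ih =>
    unfold chain at ih ⊢
    rw [jumpChain, ih]
    rfl

theorem chain_one_time (t x : ℝ) (y : ℤˣ) (e : ℕ → ℝ) :
    (S.chain t x y e 1).time = S.nextT t x y (e 0) := rfl

/-- Thresholds for which no explosion occurs. -/
def Good (e : ℕ → ℝ) : Prop := (∀ i, 0 < e i) ∧ ∀ n, ∃ i ≥ n, 1 ≤ e i

theorem Good.tail {e : ℕ → ℝ} (h : Good e) : Good fun k => e (k + 1) := by
  refine ⟨fun i => h.1 _, fun n => ?_⟩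
  obtain ⟨i, hi, h1⟩ := h.2 (n + 1)
  exact ⟨i - 1, by omega, by simpa only [Nat.sub_add_cancel (show 1 ≤ i by omega)] using h1⟩

/-- If all jump times stayed below a, the path would remain in a compact interval, where the rate is
bounded. Each threshold would then be at most a constant times the gap between consecutive jumps.
The gaps tend to zero, whereas infinitely many thresholds are at least 1. -/
theorem exists_time_gt {e : ℕ → ℝ} (he : Good e) (t x : ℝ) (y : ℤˣ) (a : ℝ) :
    ∃ n, (a : EReal) < (S.chain t x y e n).time := by
  by_contra hc
  push Not at hc
  have hreal : ∀ i, ∃ s : ℝ, (S.chain t x y e i).time = s := by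
    intro i
    have h1 : (t : EReal) ≤ (S.chain t x y e i).time := chain_time_mono t x y e (Nat.zero_le i)
    have h2 := hc i
    refine ⟨(S.chain t x y e i).time.toReal, (EReal.coe_toReal ?_ ?_).symm⟩
    · exact (h2.trans_lt (EReal.coe_lt_top a)).ne
    · exact ((EReal.bot_lt_coe t).trans_le h1).ne'
  choose τ hτ using hreal
  have hτ0 : τ 0 = t := by
    have h1 : (S.chain t x y e 0).time = (t : EReal) := rfl
    rw [hτ 0] at h1; exact EReal.coe_eq_coe_iff.1 h1
  have hmono : Monotone τ := fun i j h => by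
    have := chain_time_mono (S := S) t x y e h
    simp only [hτ] at this
    exact EReal.coe_le_coe_iff.1 this
  have hle : ∀ i, τ i ≤ a := fun i => by
    have := hc i; rw [hτ] at this; exact EReal.coe_le_coe_iff.1 this
  have hst : ∀ i, S.chain t x y e i =
      ⟨(τ i : EReal), (S.chain t x y e i).pos, (S.chain t x y e i).vel⟩ := fun i => by rw [← hτ]
  have hnext : ∀ i, S.nextT (τ i) (S.chain t x y e i).pos (S.chain t x y e i).vel (e i)
      = τ (i + 1) := by
    intro i
    rw [← hτ (i + 1)]
    unfold nextT
    rw [← hst i]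
    rfl
  have hpos : ∀ i, |(S.chain t x y e i).pos - x| ≤ τ i - t := by
    intro i
    induction i with
    | zero => rw [hτ0]; simp [chain, jumpChain]
    | succ i ih =>
      have h1 : (S.chain t x y e (i + 1)).pos = (S.chain t x y e i).pos +
          sg (S.chain t x y e i).vel * ((S.chain t x y e (i + 1)).time.toReal -
            (S.chain t x y e i).time.toReal) := rfl
      rw [h1, hτ, hτ, EReal.toReal_coe, EReal.toReal_coe]
      have h2 : |sg (S.chain t x y e i).vel * (τ (i + 1) - τ i)| = τ (i + 1) - τ i := by
        rw [abs_mul, abs_sg, one_mul, abs_of_nonneg (by linarith [hmono (Nat.le_succ i)])]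
      have h3 := abs_add_le ((S.chain t x y e i).pos - x)
        (sg (S.chain t x y e i).vel * (τ (i + 1) - τ i))
      rw [show (S.chain t x y e i).pos + sg (S.chain t x y e i).vel * (τ (i + 1) - τ i) - x =
        ((S.chain t x y e i).pos - x) + sg (S.chain t x y e i).vel * (τ (i + 1) - τ i) by ring]
      linarith
  obtain ⟨C, hC⟩ := (isCompact_Icc (a := x - (a - t)) (b := x + (a - t))).exists_bound_of_continuousOn
    (f := deriv S.U) S.cont.continuousOn
  have hstep : ∀ i, e i ≤ (|C| + 1) * (S.ε a)⁻¹ * (τ (i + 1) - τ i) := by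
    intro i
    have hlt : τ i < τ (i + 1) := by
      have := lt_nextT (S := S) (t := τ i) (S.chain t x y e i).pos (S.chain t x y e i).vel (he.1 i)
      rw [hnext i] at this; exact EReal.coe_lt_coe_iff.1 this
    have h1 := (nextT_le_iff hlt).1 (hnext i).le
    refine h1.trans ?_
    have h2 := intervalIntegral.integral_mono_on hlt.le
      (intervalIntegrable_rate (S := S) (τ i) (S.chain t x y e i).pos (S.chain t x y e i).vel _ _)
      (intervalIntegrable_const (c := (|C| + 1) * (S.ε a)⁻¹)) ?_
    · rw [intervalIntegral.integral_const, smul_eq_mul, mul_comm (τ (i + 1) - τ i)] at h2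
      exact h2
    · intro s hs
      rw [rate_eq]
      refine mul_le_mul (max_le ?_ (by positivity)) (inv_mono (hs.2.trans (hle _)))
        (inv_pos.2 (S.pos _)).le (by positivity)
      refine (le_abs_self _).trans ?_
      rw [abs_mul, abs_sg, one_mul, ← Real.norm_eq_abs]
      refine (hC _ ?_).trans (by linarith [le_abs_self C])
      have h3 := abs_le.1 (hpos i)
      have h4 : |line (τ i) (S.chain t x y e i).pos (S.chain t x y e i).vel s -
          (S.chain t x y e i).pos| ≤ s - τ i := by
        unfold line
        rw [add_sub_cancel_left, abs_mul, abs_sg, one_mul, abs_of_nonneg (by linarith [hs.1])]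
      have h5 := abs_le.1 h4
      have h6 := hle (i + 1)
      constructor <;> linarith [hs.2]
  have hK : 0 < (|C| + 1) * (S.ε a)⁻¹ := mul_pos (by positivity) (inv_pos.2 (S.pos a))
  have hconv := tendsto_atTop_ciSup hmono ⟨a, by rintro _ ⟨i, rfl⟩; exact hle i⟩
  have hdiff : Filter.Tendsto (fun i => (|C| + 1) * (S.ε a)⁻¹ * (τ (i + 1) - τ i))
      Filter.atTop (nhds 0) := by
    have := ((hconv.comp (Filter.tendsto_add_atTop_nat 1)).sub hconv).const_mul
      ((|C| + 1) * (S.ε a)⁻¹)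
    simpa using this
  obtain ⟨N, hN⟩ := Filter.eventually_atTop.1 (hdiff.eventually (gt_mem_nhds one_pos))
  obtain ⟨i, hi, h1⟩ := he.2 N
  linarith [hN i hi, hstep i]

/-- The trajectory. -/
noncomputable def traj (S : Dyn) (t x : ℝ) (y : ℤˣ) (e : ℕ → ℝ) (s : ℝ) : ℝ × ℤˣ :=
  path S.U S.ε t x y e s

theorem traj_of_lt {t x : ℝ} {y : ℤˣ} {e : ℕ → ℝ} {s : ℝ} (h : t ≤ s)
    (h1 : (s : EReal) < S.nextT t x y (e 0)) : S.traj t x y e s = (line t x y s, y) := by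
  have hset : {i : ℕ | (jumpChain S.U S.ε t x y e i).time ≤ (s : EReal)} = {0} := by
    ext i
    simp only [mem_ofPred_eq, mem_singleton_iff]
    constructor
    · intro hi
      by_contra h0
      have := chain_time_mono (S := S) t x y e (Nat.one_le_iff_ne_zero.2 h0)
      simp only [chain_one_time] at this
      exact absurd (this.trans hi) (not_le.2 h1)
    · rintro rfl; exact EReal.coe_le_coe_iff.2 h
  unfold traj path jumpCount
  rw [hset, csSup_singleton]
  simp [jumpChain, line, sg]

theorem traj_of_le {t x : ℝ} {y : ℤˣ} {e : ℕ → ℝ} (he : Good e) {s τ : ℝ}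
    (h1 : S.nextT t x y (e 0) = τ) (h2 : τ ≤ s) :
    S.traj t x y e s = S.traj τ (line t x y τ) (-y) (fun k => e (k + 1)) s := by
  set σ := fun i => S.chain τ (line t x y τ) (-y) (fun k => e (k + 1)) i with hσ
  have hch : ∀ i, jumpChain S.U S.ε t x y e (i + 1) = σ i := fun i => chain_succ h1 i
  obtain ⟨n, hn⟩ := exists_time_gt (S := S) he.tail τ (line t x y τ) (-y) s
  -- Non-explosion is needed here: on ℕ the supremum of an unbounded set is 0 by convention, and
  -- `jumpCount` would lose its meaning.
  have hbdd : BddAbove {i : ℕ | (σ i).time ≤ (s : EReal)} := ⟨n, fun i hi => by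
    by_contra hc
    push Not at hc
    have := chain_time_mono (S := S) τ (line t x y τ) (-y) (fun k => e (k + 1)) hc.le
    exact absurd (hn.trans_le this) (not_lt.2 hi)⟩
  have hne : {i : ℕ | (σ i).time ≤ (s : EReal)}.Nonempty := ⟨0, EReal.coe_le_coe_iff.2 h2⟩
  have hcount : jumpCount S.U S.ε t x y e s =
      jumpCount S.U S.ε τ (line t x y τ) (-y) (fun k => e (k + 1)) s + 1 := by
    change sSup {i : ℕ | (jumpChain S.U S.ε t x y e i).time ≤ (s : EReal)} =
      sSup {i : ℕ | (σ i).time ≤ (s : EReal)} + 1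
    have hset : {i : ℕ | (jumpChain S.U S.ε t x y e i).time ≤ (s : EReal)} =
        insert 0 (Nat.succ '' {i : ℕ | (σ i).time ≤ (s : EReal)}) := by
      ext i
      cases i with
      | zero =>
        simp only [mem_ofPred_eq, mem_insert_iff, true_or, iff_true]
        have := le_nextT (S := S) t x y (e 0)
        rw [h1] at this
        exact this.trans (EReal.coe_le_coe_iff.2 h2)
      | succ i => simp [hch]
    rw [hset]
    have hm := Nat.sSup_mem hne hbdd
    refine IsGreatest.csSup_eq ⟨mem_insert_of_mem _ ⟨_, hm, rfl⟩, ?_⟩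
    rintro _ (rfl | ⟨i, hi, rfl⟩)
    · exact Nat.zero_le _
    · exact Nat.succ_le_succ (le_csSup hbdd hi)
  unfold traj path
  rw [hcount, hch]
  rfl

theorem traj_start {x : ℝ} {y : ℤˣ} {e : ℕ → ℝ} (he : Good e) (t : ℝ) :
    S.traj t x y e t = (x, y) := by
  rw [traj_of_lt le_rfl (lt_nextT x y (he.1 0))]; simp

/-- Restarting at a time before the first jump. -/
theorem Lam_add (t x : ℝ) (y : ℤˣ) (u s : ℝ) :
    S.Lam t x y s = S.Lam t x y u + S.Lam u (line t x y u) y s := by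
  have h1 := intervalIntegral.integral_add_adjacent_intervals
    (intervalIntegrable_rate (S := S) t x y t u) (intervalIntegrable_rate t x y u s)
  have h2 : S.rate u (line t x y u) y = S.rate t x y := by
    funext r
    unfold rate
    congr 1
    unfold line; ring
  unfold Lam
  rw [h2]; exact h1.symm

/-- Pathwise form of the absence of memory: restarting at u subtracts from the threshold the rate
already accumulated. -/
theorem nextT_restart {t x : ℝ} {y : ℤˣ} {e u : ℝ} (htu : t ≤ u) (he : S.Lam t x y u < e) :
    S.nextT u (line t x y u) y (e - S.Lam t x y u) = S.nextT t x y e := by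
  rw [nextT_eq, nextT_eq]
  congr 2
  ext s
  simp only [mem_ofPred_eq, sub_le_iff_le_add', ← Lam_add t x y u s]
  constructor
  · rintro ⟨h1, h2⟩; exact ⟨htu.trans_lt h1, h2⟩
  · rintro ⟨h1, h2⟩
    refine ⟨?_, h2⟩
    by_contra hc
    have := Lam_mono (S := S) t x y (not_lt.1 hc)
    linarith

theorem line_line (t x : ℝ) (y : ℤˣ) (u s : ℝ) : line u (line t x y u) y s = line t x y s := by
  unfold line; ring

theorem traj_restart {t x : ℝ} {y : ℤˣ} {e e' : ℕ → ℝ} (he : Good e) (he' : Good e')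
    {u : ℝ} (htu : t ≤ u) (h0 : S.Lam t x y u < e 0) (h0' : e' 0 = e 0 - S.Lam t x y u)
    (htail : ∀ k, e' (k + 1) = e (k + 1)) {s : ℝ} (hs : u ≤ s) :
    S.traj t x y e s = S.traj u (line t x y u) y e' s := by
  have hn : S.nextT u (line t x y u) y (e' 0) = S.nextT t x y (e 0) := by
    rw [h0']; exact nextT_restart htu h0
  rcases lt_or_ge (s : EReal) (S.nextT t x y (e 0)) with h | h
  · rw [traj_of_lt (htu.trans hs) h, traj_of_lt hs (by rwa [hn]), line_line]
  · obtain ⟨τ, hτ⟩ : ∃ τ : ℝ, S.nextT t x y (e 0) = τ :=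
      ⟨(S.nextT t x y (e 0)).toReal, (EReal.coe_toReal (h.trans_lt (EReal.coe_lt_top s)).ne
        (nextT_ne_bot _ _ _ _)).symm⟩
    rw [hτ] at h
    have h' := EReal.coe_le_coe_iff.1 h
    rw [traj_of_le he hτ h', traj_of_le he' (hn.trans hτ) h', line_line]
    simp_rw [htail]

end Dyn

end VelocityJump

/-! ### Exit from the cusp and its cost, flight by flight -/

namespace VelocityJump

theorem CuspData.mem_Ioo_iff (D : CuspData) (y : ℤˣ) {x : ℝ} : x ∈ Ioo (D.z (-1)) (D.z 1) ↔
    0 < sg y * (x - D.z (-y)) ∧ 0 < sg y * (D.z y - x) := by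
  rcases Int.units_eq_one_or y with rfl | rfl
  · simp [mem_Ioo]
  · simp [mem_Ioo, and_comm]

/-- The distance to the end of the cusp in direction `y`. -/
noncomputable def CuspData.ell (D : CuspData) (y : ℤˣ) (x : ℝ) : ℝ := sg y * (D.z y - x)

namespace Dyn

variable (S : Dyn) (D : CuspData)

/-- The exit time after the initial time. -/
noncomputable def tau (t x : ℝ) (y : ℤˣ) (e : ℕ → ℝ) : EReal :=
  exitTime (D.z (-1)) (D.z 1) t fun s => (S.traj t x y e s).1

/-- The cost `∫ w` accumulated in the first `n` flights before the exit, plus the terminal cost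
`c y` upon exit with velocity `y`. -/
noncomputable def J (w : ℝ → ℝ≥0∞) (c : ℤˣ → ℝ≥0∞) :
    ℕ → ℝ → ℝ → ℤˣ → (ℕ → ℝ) → ℝ≥0∞
  | 0, _, _, _, _ => 0
  | n + 1, t, x, y, e =>
    (∫⁻ s in {s : ℝ | t < s ∧ s ≤ t + D.ell y x ∧ (s : EReal) ≤ S.nextT t x y (e 0)}, w s) +
      if S.nextT t x y (e 0) < ((t + D.ell y x : ℝ) : EReal) then
        J w c n (S.nextT t x y (e 0)).toReal (line t x y (S.nextT t x y (e 0)).toReal) (-y)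
          fun k => e (k + 1)
      else c y

variable {S D}

theorem line_mem_Ioo {t x : ℝ} {y : ℤˣ} (hx : x ∈ Ioo (D.z (-1)) (D.z 1)) {s : ℝ} (h1 : t ≤ s)
    (h2 : s < t + D.ell y x) : line t x y s ∈ Ioo (D.z (-1)) (D.z 1) := by
  have h3 := ((D.mem_Ioo_iff y).1 hx).1
  have a1 := sg_mul_line_sub t x y s (D.z (-y))
  have a2 := sg_mul_line_sub t x y s (D.z y)
  unfold CuspData.ell at h2
  rw [D.mem_Ioo_iff y]
  constructor <;> linarith

theorem line_end (t x : ℝ) (y : ℤˣ) : line t x y (t + D.ell y x) = D.z y := by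
  have := sg_mul_sg_mul y (D.z y - x)
  unfold line CuspData.ell
  rw [add_sub_cancel_left, this]; ring

/-- A jump exactly at the end point still counts as an exit there, since the position at that time
is `z y` in either case. -/
theorem exit_of_ge {t x : ℝ} {y : ℤˣ} {e : ℕ → ℝ} (he : Good e)
    (hx : x ∈ Ioo (D.z (-1)) (D.z 1))
    (h : ((t + D.ell y x : ℝ) : EReal) ≤ S.nextT t x y (e 0)) :
    S.tau D t x y e = ((t + D.ell y x : ℝ) : EReal) ∧
      (S.traj t x y e (t + D.ell y x)).1 = D.z y := by
  have hl : 0 < D.ell y x := ((D.mem_Ioo_iff y).1 hx).2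
  have hend : (S.traj t x y e (t + D.ell y x)).1 = D.z y := by
    rcases h.lt_or_eq with h1 | h1
    · rw [traj_of_lt (by linarith) h1, line_end]
    · rw [traj_of_le he h1.symm le_rfl, traj_start he.tail, line_end]
  refine ⟨le_antisymm ?_ ?_, hend⟩
  · refine sInf_le ⟨t + D.ell y x, ⟨by linarith, ?_⟩, rfl⟩
    simp only [hend]
    rcases Int.units_eq_one_or y with rfl | rfl <;> simp
  · refine le_sInf ?_
    rintro _ ⟨s, ⟨hs1, hs2⟩, rfl⟩
    refine EReal.coe_le_coe_iff.2 ?_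
    by_contra hc
    push Not at hc
    refine hs2 ?_
    simp only [traj_of_lt hs1.le ((EReal.coe_lt_coe_iff.2 hc).trans_le h)]
    exact line_mem_Ioo hx hs1.le hc

theorem exit_of_lt {t x : ℝ} {y : ℤˣ} {e : ℕ → ℝ} (he : Good e)
    (hx : x ∈ Ioo (D.z (-1)) (D.z 1)) {τ : ℝ} (hτ : S.nextT t x y (e 0) = τ)
    (h : τ < t + D.ell y x) :
    line t x y τ ∈ Ioo (D.z (-1)) (D.z 1) ∧ t < τ ∧
    S.tau D t x y e = S.tau D τ (line t x y τ) (-y) fun k => e (k + 1) := by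
  have ht : t < τ := by
    have := lt_nextT (S := S) (t := t) x y (he.1 0)
    rw [hτ] at this; exact EReal.coe_lt_coe_iff.1 this
  refine ⟨line_mem_Ioo hx ht.le h, ht, ?_⟩
  unfold tau exitTime
  congr 2
  ext s
  simp only [mem_ofPred_eq]
  constructor
  · rintro ⟨h1, h2⟩
    rcases lt_or_ge s τ with h3 | h3
    · rw [traj_of_lt h1.le (by rw [hτ]; exact EReal.coe_lt_coe_iff.2 h3)] at h2
      exact absurd (line_mem_Ioo hx h1.le (h3.trans h)) h2
    · rcases h3.eq_or_lt with rfl | h4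
      · rw [traj_of_le he hτ le_rfl, traj_start he.tail] at h2
        exact absurd (line_mem_Ioo hx h1.le h) h2
      · rw [traj_of_le he hτ h3] at h2; exact ⟨h4, h2⟩
  · rintro ⟨h1, h2⟩
    refine ⟨ht.trans h1, ?_⟩
    rwa [traj_of_le he hτ h1.le]

theorem exists_real_of_lt {t x : ℝ} {y : ℤˣ} {e b : ℝ} (h : S.nextT t x y e < (b : EReal)) :
    ∃ τ : ℝ, S.nextT t x y e = τ ∧ τ < b := by
  have h1 := EReal.coe_toReal (h.trans (EReal.coe_lt_top b)).ne (nextT_ne_bot t x y e)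
  refine ⟨_, h1.symm, ?_⟩
  rw [← h1] at h; exact EReal.coe_lt_coe_iff.1 h

theorem le_tau (t x : ℝ) (y : ℤˣ) (e : ℕ → ℝ) : (t : EReal) ≤ S.tau D t x y e := by
  refine le_sInf ?_
  rintro _ ⟨s, hs, rfl⟩
  exact EReal.coe_le_coe_iff.2 hs.1.le

theorem J_succ_of_lt (w : ℝ → ℝ≥0∞) (c : ℤˣ → ℝ≥0∞) (n : ℕ) {t x : ℝ} {y : ℤˣ} {e : ℕ → ℝ}
    {τ : ℝ} (hτ : S.nextT t x y (e 0) = τ) (h : τ < t + D.ell y x) :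
    S.J D w c (n + 1) t x y e = (∫⁻ s in Ioc t τ, w s) +
      S.J D w c n τ (line t x y τ) (-y) fun k => e (k + 1) := by
  have hset : {s : ℝ | t < s ∧ s ≤ t + D.ell y x ∧ (s : EReal) ≤ S.nextT t x y (e 0)} =
      Ioc t τ := by
    ext s
    simp only [mem_ofPred_eq, hτ, EReal.coe_le_coe_iff, mem_Ioc]
    exact ⟨fun ⟨a, _, b⟩ => ⟨a, b⟩, fun ⟨a, b⟩ => ⟨a, b.trans h.le, b⟩⟩
  rw [J, hset, hτ, if_pos (EReal.coe_lt_coe_iff.2 h), EReal.toReal_coe]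

theorem J_succ_of_ge (w : ℝ → ℝ≥0∞) (c : ℤˣ → ℝ≥0∞) (n : ℕ) {t x : ℝ} {y : ℤˣ} {e : ℕ → ℝ}
    (h : ((t + D.ell y x : ℝ) : EReal) ≤ S.nextT t x y (e 0)) :
    S.J D w c (n + 1) t x y e = (∫⁻ s in Ioc t (t + D.ell y x), w s) + c y := by
  have hset : {s : ℝ | t < s ∧ s ≤ t + D.ell y x ∧ (s : EReal) ≤ S.nextT t x y (e 0)} =
      Ioc t (t + D.ell y x) := by
    ext s
    simp only [mem_ofPred_eq, mem_Ioc]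
    exact ⟨fun ⟨a, b, _⟩ => ⟨a, b⟩, fun ⟨a, b⟩ => ⟨a, b, (EReal.coe_le_coe_iff.2 b).trans h⟩⟩
  rw [J, hset, if_neg (not_lt.2 h)]

/-- Induction on flights: the interval up to r splits at the first jump if that jump precedes the
end of the cusp. Otherwise the exit happens in the first flight, and its cost already covers
everything. -/
theorem integral_le_J (w : ℝ → ℝ≥0∞) (c : ℤˣ → ℝ≥0∞) (n : ℕ) {t x : ℝ} {y : ℤˣ} {e : ℕ → ℝ}
    (he : Good e) (hx : x ∈ Ioo (D.z (-1)) (D.z 1)) {r : ℝ}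
    (hr : (r : EReal) ≤ S.tau D t x y e) (hn : (r : EReal) < (S.chain t x y e n).time) :
    ∫⁻ s in Ioc t r, w s ≤ S.J D w c n t x y e := by
  induction n generalizing t x y e with
  | zero =>
    have h1 : r < t := EReal.coe_lt_coe_iff.1 hn
    rw [Ioc_eq_empty (not_lt.2 h1.le)]; simp
  | succ n ih =>
    rcases lt_or_ge (S.nextT t x y (e 0)) ((t + D.ell y x : ℝ) : EReal) with h | h
    · obtain ⟨τ, hτ, hlt⟩ := exists_real_of_lt h
      obtain ⟨hx', ht, htau⟩ := exit_of_lt he hx hτ hlt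
      rw [J_succ_of_lt w c n hτ hlt]
      rw [chain_succ hτ] at hn
      rw [htau] at hr
      have h2 := ih he.tail hx' hr hn
      have h3 : Ioc t r ⊆ Ioc t τ ∪ Ioc τ r := fun s hs => by
        rcases le_or_gt s τ with h4 | h4
        · exact Or.inl ⟨hs.1, h4⟩
        · exact Or.inr ⟨h4, hs.2⟩
      exact (lintegral_mono_set h3).trans ((lintegral_union_le _ _ _).trans (by gcongr))
    · rw [J_succ_of_ge w c n h]
      rw [(exit_of_ge he hx h).1] at hr
      exact (lintegral_mono_set (Ioc_subset_Ioc_right (EReal.coe_le_coe_iff.1 hr))).trans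
        le_self_add

/-- The end y' is chosen before `w` and `c`, so a terminal cost that is the indicator of one end
detects exits at that end. -/
theorem exit_position (n : ℕ) {t x : ℝ} {y : ℤˣ} {e : ℕ → ℝ} (he : Good e)
    (hx : x ∈ Ioo (D.z (-1)) (D.z 1)) (hn : S.tau D t x y e < (S.chain t x y e n).time) :
    ∃ y', (S.traj t x y e (S.tau D t x y e).toReal).1 = D.z y' ∧
      ∀ w c, c y' ≤ S.J D w c n t x y e := by
  induction n generalizing t x y e with
  | zero => exact absurd hn (not_lt.2 (le_tau t x y e))
  | succ n ih =>
    rcases lt_or_ge (S.nextT t x y (e 0)) ((t + D.ell y x : ℝ) : EReal) with h | h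
    · obtain ⟨τ, hτ, hlt⟩ := exists_real_of_lt h
      obtain ⟨hx', ht, htau⟩ := exit_of_lt he hx hτ hlt
      rw [chain_succ hτ, htau] at hn
      obtain ⟨y', h1, h2⟩ := ih he.tail hx' hn
      refine ⟨y', ?_, fun w c => ?_⟩
      · rw [htau, traj_of_le he hτ ?_]
        · exact h1
        · have h3 := le_tau (S := S) (D := D) τ (line t x y τ) (-y) fun k => e (k + 1)
          have h4 : S.tau D τ (line t x y τ) (-y) (fun k => e (k + 1)) ≠ ⊤ := hn.ne_top
          have h5 := EReal.coe_toReal h4 ((EReal.bot_lt_coe τ).trans_le h3).ne'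
          rw [← h5] at h3
          exact EReal.coe_le_coe_iff.1 h3
      · rw [J_succ_of_lt w c n hτ hlt]
        exact (h2 w c).trans le_add_self
    · obtain ⟨h1, h2⟩ := exit_of_ge he hx h
      refine ⟨y, by rw [h1, EReal.toReal_coe, h2], fun w c => ?_⟩
      rw [J_succ_of_ge w c n h]
      exact le_add_self

theorem cost_le_iSup_J (w : ℝ → ℝ≥0∞) (c : ℤˣ → ℝ≥0∞) {t x : ℝ} {y : ℤˣ} {e : ℕ → ℝ}
    (he : Good e) (hx : x ∈ Ioo (D.z (-1)) (D.z 1)) :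
    ∫⁻ s in {s : ℝ | t < s ∧ (s : EReal) < S.tau D t x y e}, w s ≤ ⨆ n, S.J D w c n t x y e := by
  have key : ∀ r : ℝ, (r : EReal) ≤ S.tau D t x y e →
      ∫⁻ s in Ioc t r, w s ≤ ⨆ n, S.J D w c n t x y e := by
    intro r hr
    obtain ⟨n, hn⟩ := exists_time_gt (S := S) he t x y r
    exact (integral_le_J w c n he hx hr hn).trans (le_iSup (fun n => S.J D w c n t x y e) n)
  by_cases htop : S.tau D t x y e = ⊤
  · have hU : {s : ℝ | t < s ∧ (s : EReal) < S.tau D t x y e} ⊆ ⋃ k : ℕ, Ioc t (t + k) := by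
      intro s hs
      obtain ⟨k, hk⟩ := exists_nat_ge (s - t)
      exact mem_iUnion.2 ⟨k, hs.1, by linarith⟩
    refine (lintegral_mono_set hU).trans ?_
    rw [setLIntegral_iUnion_of_directed]
    · exact iSup_le fun k => key _ (by rw [htop]; exact le_top)
    · refine Monotone.directed_le fun i j h => Ioc_subset_Ioc_right ?_
      have : (i : ℝ) ≤ j := by exact_mod_cast h
      linarith
  · have h1 := EReal.coe_toReal htop ((EReal.bot_lt_coe t).trans_le (le_tau t x y e)).ne'
    refine le_trans (lintegral_mono_set ?_) (key _ h1.le)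
    rintro s ⟨h2, h3⟩
    rw [← h1] at h3
    exact ⟨h2, (EReal.coe_lt_coe_iff.1 h3).le⟩

theorem measurable_ell (y : ℤˣ) : Measurable (D.ell y) := by unfold CuspData.ell; fun_prop

theorem measurable_J {w : ℝ → ℝ≥0∞} (hw : Measurable w) (c : ℤˣ → ℝ≥0∞) (n : ℕ) (y : ℤˣ) :
    Measurable fun v : (ℝ × ℝ) × (ℕ → ℝ) => S.J D w c n v.1.1 v.1.2 y v.2 := by
  induction n generalizing y with
  | zero => simp only [J]; exact measurable_const
  | succ n ih =>
    have hT : Measurable fun v : (ℝ × ℝ) × (ℕ → ℝ) => S.nextT v.1.1 v.1.2 y (v.2 0) :=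
      (measurable_nextT (S := S) y).comp (measurable_fst.prodMk
        ((measurable_pi_apply 0).comp measurable_snd))
    have hell : Measurable fun v : (ℝ × ℝ) × (ℕ → ℝ) => v.1.1 + D.ell y v.1.2 := by
      have := measurable_ell (D := D) y; fun_prop
    simp only [J]
    refine Measurable.add ?_ (Measurable.ite
      (measurableSet_lt hT (measurable_coe_real_ereal.comp hell)) ?_ measurable_const)
    · have hset : MeasurableSet {p : ((ℝ × ℝ) × (ℕ → ℝ)) × ℝ | p.1.1.1 < p.2 ∧
          p.2 ≤ p.1.1.1 + D.ell y p.1.1.2 ∧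
          (p.2 : EReal) ≤ S.nextT p.1.1.1 p.1.1.2 y (p.1.2 0)} :=
        (measurableSet_lt (by fun_prop) measurable_snd).inter
          ((measurableSet_le measurable_snd (hell.comp measurable_fst)).inter
            (measurableSet_le (measurable_coe_real_ereal.comp measurable_snd)
              (hT.comp measurable_fst)))
      have h1 := ((hw.comp measurable_snd).indicator hset).lintegral_prod_right'
        (ν := (volume : Measure ℝ))
      convert h1 using 2 with v
      rw [← lintegral_indicator]
      · rfl
      · exact measurable_prodMk_left (x := v) hset
    · have hτ : Measurable fun v : (ℝ × ℝ) × (ℕ → ℝ) =>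
          (S.nextT v.1.1 v.1.2 y (v.2 0)).toReal := hT.ereal_toReal
      have hline : Measurable fun v : (ℝ × ℝ) × (ℕ → ℝ) =>
          line v.1.1 v.1.2 y (S.nextT v.1.1 v.1.2 y (v.2 0)).toReal := by
        unfold line; fun_prop
      have htail : Measurable fun v : (ℝ × ℝ) × (ℕ → ℝ) => fun k => v.2 (k + 1) :=
        measurable_pi_lambda _ fun k => (measurable_pi_apply (k + 1)).comp measurable_snd
      exact (ih (-y)).comp ((hτ.prodMk hline).prodMk htail)

theorem J_mono (w : ℝ → ℝ≥0∞) (c : ℤˣ → ℝ≥0∞) (t x : ℝ) (y : ℤˣ) (e : ℕ → ℝ) :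
    Monotone fun n => S.J D w c n t x y e := by
  refine monotone_nat_of_le_succ fun n => ?_
  induction n generalizing t x y e with
  | zero => simp [J]
  | succ n ih =>
    rw [J, J]
    gcongr
    split_ifs
    · exact ih _ _ _ _
    · exact le_rfl

end Dyn

end VelocityJump

namespace VelocityJump

/-! ### The exponential law and sequences of exponential variables -/

instance : IsProbabilityMeasure (expMeasure 1) := isProbabilityMeasure_expMeasure one_pos

instance : NullSingletonClass (expMeasure 1) := by
  unfold expMeasure gammaMeasure; infer_instance

theorem expMeasure_Iic {c : ℝ} (hc : 0 ≤ c) :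
    expMeasure 1 (Iic c) = ENNReal.ofReal (1 - Real.exp (-c)) := by
  rw [← ofReal_cdf, cdf_expMeasure_eq one_pos, if_pos hc, one_mul]

theorem expMeasure_Ioi {c : ℝ} (hc : 0 ≤ c) :
    expMeasure 1 (Ioi c) = ENNReal.ofReal (Real.exp (-c)) := by
  rw [← compl_Iic, prob_compl_eq_one_sub measurableSet_Iic, expMeasure_Iic hc,
    ← ENNReal.ofReal_one, ← ENNReal.ofReal_sub _ (by
      have : Real.exp (-c) ≤ 1 := Real.exp_le_one_iff.2 (by linarith)
      linarith)]
  congr 1; ring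

theorem expMeasure_Ici {c : ℝ} (hc : 0 ≤ c) :
    expMeasure 1 (Ici c) = ENNReal.ofReal (Real.exp (-c)) := by
  rw [← expMeasure_Ioi hc]
  exact (measure_congr Ioi_ae_eq_Ici).symm

theorem ae_exp_pos : ∀ᵐ e ∂(expMeasure 1), 0 < e := by
  rw [ae_iff]
  have : {a : ℝ | ¬ 0 < a} = Iic 0 := by ext; simp
  rw [this, expMeasure_Iic le_rfl]; simp

/-- The exponential law has no memory. -/
theorem lintegral_exp_shift {φ : ℝ → ℝ≥0∞} (hφ : Measurable φ) {c : ℝ} (hc : 0 ≤ c) :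
    ∫⁻ e in Ioi c, φ (e - c) ∂(expMeasure 1) =
      ENNReal.ofReal (Real.exp (-c)) * ∫⁻ e, φ e ∂(expMeasure 1) := by
  have hmap : ((expMeasure 1).restrict (Ioi c)).map (fun e => e - c) =
      ENNReal.ofReal (Real.exp (-c)) • expMeasure 1 := by
    have : IsFiniteMeasure (ENNReal.ofReal (Real.exp (-c)) • expMeasure 1) :=
      Measure.smul_finite _ ENNReal.ofReal_ne_top
    refine Measure.ext_of_Ici _ _ fun a => ?_
    rw [Measure.map_apply (by fun_prop) measurableSet_Ici,
      Measure.restrict_apply ((by fun_prop : Measurable fun e : ℝ => e - c) measurableSet_Ici),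
      Measure.smul_apply, smul_eq_mul]
    have h1 : (fun e : ℝ => e - c) ⁻¹' Ici a ∩ Ioi c = Ici (a + c) ∩ Ioi c := by
      ext e; simp
    rw [h1]
    rcases le_or_gt a 0 with ha | ha
    · have h2 : Ici (a + c) ∩ Ioi c = Ioi c :=
        inter_eq_right.2 fun e he => by
          have : c < e := he
          change a + c ≤ e; linarith
      have h3 : expMeasure 1 (Ici a) = 1 := by
        refine le_antisymm prob_le_one ?_
        calc (1 : ℝ≥0∞) = expMeasure 1 (Ici 0) := by rw [expMeasure_Ici le_rfl]; simp
          _ ≤ _ := measure_mono (Ici_subset_Ici.2 ha)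
      rw [h2, h3, expMeasure_Ioi hc, mul_one]
    · have h2 : Ici (a + c) ∩ Ioi c = Ici (a + c) :=
        inter_eq_left.2 fun e he => by
          have : a + c ≤ e := he
          change c < e; linarith
      rw [h2, expMeasure_Ici (by linarith), expMeasure_Ici ha.le,
        ← ENNReal.ofReal_mul (Real.exp_pos _).le, ← Real.exp_add]
      congr 2; ring
  rw [← lintegral_map (μ := (expMeasure 1).restrict (Ioi c)) hφ (by fun_prop), hmap,
    lintegral_smul_measure, smul_eq_mul]

/-- The law of a sequence of independent exponential variables. -/
noncomputable def expSeq : Measure (ℕ → ℝ) := Measure.infinitePi fun _ => expMeasure 1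

instance : IsProbabilityMeasure expSeq := by unfold expSeq; infer_instance

/-- Prepending a term to a sequence. -/
def consSeq (v : ℝ × (ℕ → ℝ)) (k : ℕ) : ℝ := Nat.casesOn k v.1 v.2

theorem measurable_consSeq : Measurable consSeq := by
  refine measurable_pi_lambda _ fun k => ?_
  cases k with
  | zero => exact measurable_fst
  | succ k => exact (measurable_pi_apply k).comp measurable_snd

theorem map_consSeq : ((expMeasure 1).prod expSeq).map consSeq = expSeq := by
  refine Measure.eq_infinitePi _ fun s B hB => ?_
  classical
  set s' : Finset ℕ := s.preimage Nat.succ (Nat.succ_injective.injOn) with hs'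
  have hmeas : MeasurableSet ((s : Set ℕ).pi B) :=
    MeasurableSet.pi s.countable_toSet fun i _ => hB i
  rw [Measure.map_apply measurable_consSeq hmeas]
  have hsucc : ∀ k, k + 1 ∈ s ↔ k ∈ s' := fun k => by simp [hs']
  have hpre : consSeq ⁻¹' ((s : Set ℕ).pi B) =
      (if 0 ∈ s then B 0 else univ) ×ˢ ((s' : Set ℕ).pi fun k => B (k + 1)) := by
    ext ⟨a, v⟩
    simp only [mem_preimage, mem_pi, mem_prod, Finset.mem_coe]
    constructor
    · intro h
      refine ⟨?_, fun k hk => h (k + 1) ((hsucc k).2 hk)⟩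
      split_ifs with h0
      · exact h 0 h0
      · trivial
    · rintro ⟨h1, h2⟩ k hk
      cases k with
      | zero => rw [if_pos hk] at h1; exact h1
      | succ k => exact h2 k ((hsucc k).1 hk)
  rw [hpre, Measure.prod_prod, expSeq, Measure.infinitePi_pi _ fun i _ => hB (i + 1)]
  have hprod : ∏ i ∈ s.erase 0, expMeasure 1 (B i) = ∏ i ∈ s', expMeasure 1 (B (i + 1)) := by
    symm
    refine Finset.prod_bij (fun k _ => k + 1) ?_ ?_ ?_ ?_
    · intro k hk; simp [(hsucc k).2 hk]
    · intro a _ b _ h; omega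
    · intro b hb
      rw [Finset.mem_erase] at hb
      obtain ⟨k, rfl⟩ := Nat.exists_eq_succ_of_ne_zero hb.1
      exact ⟨k, (hsucc k).1 hb.2, rfl⟩
    · intro k _; rfl
  rw [← hprod]
  split_ifs with h0
  · exact Finset.mul_prod_erase s (fun i => expMeasure 1 (B i)) h0
  · rw [measure_univ, one_mul, Finset.erase_eq_of_notMem h0]

theorem lintegral_expSeq {φ : (ℕ → ℝ) → ℝ≥0∞} (hφ : Measurable φ) :
    ∫⁻ e, φ e ∂expSeq = ∫⁻ a, ∫⁻ v, φ (consSeq (a, v)) ∂expSeq ∂(expMeasure 1) := by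
  conv_lhs => rw [← map_consSeq]
  rw [lintegral_map hφ measurable_consSeq]
  exact lintegral_prod (fun a => φ (consSeq a)) (hφ.comp measurable_consSeq).aemeasurable

theorem map_eval_expSeq (k : ℕ) : expSeq.map (fun e => e k) = expMeasure 1 :=
  Measure.infinitePi_map_eval (μ := fun _ : ℕ => expMeasure 1) k

theorem iIndepFun_expSeq : iIndepFun (fun (k : ℕ) (e : ℕ → ℝ) => e k) expSeq := by
  rw [iIndepFun_iff_map_fun_eq_infinitePi_map fun k => measurable_pi_apply k]
  simp_rw [map_eval_expSeq]
  exact Measure.map_id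

/-- Positivity holds for each threshold almost surely. The events {1 ≤ e i} are independent with
common probability e^{-1}, so the second Borel–Cantelli lemma makes infinitely many of them occur.
-/
theorem ae_good : ∀ᵐ e ∂expSeq, Dyn.Good e := by
  have h1 : ∀ᵐ e ∂expSeq, ∀ i, 0 < e i := by
    refine ae_all_iff.2 fun i => ?_
    have := ae_exp_pos
    rw [← map_eval_expSeq i] at this
    exact ae_of_ae_map (measurable_pi_apply i).aemeasurable this
  have hpre : ∀ i, expSeq ((fun e : ℕ → ℝ => e i) ⁻¹' Ici 1) =
      ENNReal.ofReal (Real.exp (-1)) := by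
    intro i
    rw [← Measure.map_apply (measurable_pi_apply i) measurableSet_Ici, map_eval_expSeq,
      expMeasure_Ici zero_le_one]
  have h2 := measure_limsup_eq_one (μ := expSeq) (s := fun i => (fun e : ℕ → ℝ => e i) ⁻¹' Ici 1)
    (fun i => measurable_pi_apply i measurableSet_Ici)
    (by
      rw [iIndepSet_iff_meas_biInter fun i => measurable_pi_apply i measurableSet_Ici]
      intro s
      exact (iIndepFun_iff_measure_inter_preimage_eq_mul.1 iIndepFun_expSeq) s
        (sets := fun _ => Ici 1) fun i _ => measurableSet_Ici)
    (by
      simp_rw [hpre]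
      exact ENNReal.tsum_const_eq_top_of_ne_zero (by
        simp [Real.exp_pos]))
  have h3 : ∀ᵐ e ∂expSeq, e ∈ Filter.limsup (fun i => (fun e : ℕ → ℝ => e i) ⁻¹' Ici 1)
      Filter.atTop := by
    rw [← mem_ae_iff_prob_eq_one
      (MeasurableSet.measurableSet_limsup fun i => measurable_pi_apply i measurableSet_Ici)] at h2
    exact h2
  filter_upwards [h1, h3] with e he1 he3
  refine ⟨he1, fun n => ?_⟩
  rw [Filter.mem_limsup_iff_frequently_mem, Filter.frequently_atTop] at he3
  obtain ⟨i, hi, h⟩ := he3 n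
  exact ⟨i, hi, h⟩

end VelocityJump

/-! ### The law of one flight and the comparison with the supersolution -/

namespace VelocityJump

namespace Dyn

variable {S : Dyn} {t x : ℝ} {y : ℤˣ}

theorem Lam_nonneg {s : ℝ} (hs : t ≤ s) : 0 ≤ S.Lam t x y s := by
  have := Lam_mono (S := S) t x y hs; simpa using this

theorem Lam_le_of_le_nextT {s e : ℝ} (hs : t ≤ s) (he : 0 ≤ e)
    (h : (s : EReal) ≤ S.nextT t x y e) : S.Lam t x y s ≤ e := by
  rcases hs.eq_or_lt with rfl | hs
  · simpa using he
  by_contra hc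
  push Not at hc
  obtain ⟨δ, hδ, hball⟩ := Metric.eventually_nhds_iff.1
    ((continuous_Lam (S := S) t x y).continuousAt.eventually (lt_mem_nhds hc))
  set u := max (s - δ / 2) ((t + s) / 2) with hu
  have h1 : u < s := max_lt (by linarith) (by linarith)
  have h2 : t < u := lt_of_lt_of_le (by linarith) (le_max_right _ _)
  have h3 : s - δ / 2 ≤ u := le_max_left _ _
  have h4 : e < S.Lam t x y u := hball (by
    rw [Real.dist_eq, abs_sub_comm, abs_of_nonneg (by linarith)]; linarith)
  have h5 : S.nextT t x y e < s := nextT_lt_iff.2 ⟨u, h2, h4.le, EReal.coe_lt_coe_iff.2 h1⟩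
  exact absurd h (not_le.2 h5)

theorem measurable_nextT' : Measurable (S.nextT t x y) :=
  (measurable_nextT (S := S) y).comp ((measurable_const (a := (t, x))).prodMk measurable_id)

theorem measure_le_nextT {s : ℝ} (hs : t ≤ s) :
    expMeasure 1 {e | (s : EReal) ≤ S.nextT t x y e} ≤
      ENNReal.ofReal (Real.exp (-S.Lam t x y s)) := by
  rw [← expMeasure_Ici (Lam_nonneg hs)]
  refine measure_mono_ae ?_
  filter_upwards [ae_exp_pos] with e he h
  exact Lam_le_of_le_nextT hs he.le h

theorem survival_lintegral {s : ℝ} (hs : t ≤ s) :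
    ∫⁻ r in Ioc t s, ENNReal.ofReal (S.rate t x y r * Real.exp (-S.Lam t x y r)) =
      ENNReal.ofReal (1 - Real.exp (-S.Lam t x y s)) := by
  obtain ⟨M, hM⟩ := exists_rate_bound (S := S) t x y t s
  have h1 := survival_eq (measurable_rate' (S := S) t x y) hs hM fun r _ => rate_nonneg t x y r
  have h2 : 1 - Real.exp (-S.Lam t x y s) =
      ∫ r in t..s, S.rate t x y r * Real.exp (-S.Lam t x y r) := by
    unfold Lam; rw [h1]; ring
  have hi : IntervalIntegrable (fun r => S.rate t x y r * Real.exp (-S.Lam t x y r)) volume t s :=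
    (intervalIntegrable_rate t x y t s).mul_continuousOn
      (continuous_Lam t x y).neg.rexp.continuousOn
  rw [h2, intervalIntegral.integral_of_le hs, ofReal_integral_eq_lintegral_ofReal
    ((intervalIntegrable_iff_integrableOn_Ioc_of_le hs).1 hi)]
  exact Filter.Eventually.of_forall fun r => mul_nonneg (rate_nonneg t x y r) (Real.exp_pos _).le

/-- The law of the next jump time, stopped at `b`. -/
theorem lintegral_nextT_le {φ : ℝ → ℝ≥0∞} (hφ : Measurable φ) {b : ℝ} :
    ∫⁻ e, (if S.nextT t x y e < (b : EReal) then φ (S.nextT t x y e).toReal else 0)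
        ∂(expMeasure 1) ≤
      ∫⁻ s in Ioc t b, φ s * ENNReal.ofReal (S.rate t x y s * Real.exp (-S.Lam t x y s)) := by
  have hT := measurable_nextT' (S := S) (t := t) (x := x) (y := y)
  set E : Set ℝ := {e | 0 < e ∧ S.nextT t x y e ≤ (b : EReal)} with hE
  have hEm : MeasurableSet E :=
    measurableSet_Ioi.inter (measurableSet_le hT measurable_const)
  set m₁ : Measure ℝ := ((expMeasure 1).restrict E).map fun e => (S.nextT t x y e).toReal with hm₁
  have hdens : Measurable fun s =>
      ENNReal.ofReal (S.rate t x y s * Real.exp (-S.Lam t x y s)) :=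
    ((measurable_rate' t x y).mul (continuous_Lam t x y).neg.rexp.measurable).ennreal_ofReal
  set m₂ : Measure ℝ := (volume.restrict (Ioc t b)).withDensity fun s =>
    ENNReal.ofReal (S.rate t x y s * Real.exp (-S.Lam t x y s)) with hm₂
  have hreal : ∀ e, S.nextT t x y e ≤ (b : EReal) →
      ((S.nextT t x y e).toReal : EReal) = S.nextT t x y e := fun e he =>
    EReal.coe_toReal (he.trans_lt (EReal.coe_lt_top b)).ne (nextT_ne_bot t x y e)
  -- It suffices to compare on half-lines, where both measures give 1 - e^{-Λ} with Λ the rate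
  -- integrated up to min b a, or 0 if that time is not after t.
  have hEq : m₁ = m₂ := by
    refine Measure.ext_of_Iic _ _ fun a => ?_
    rw [hm₁, Measure.map_apply hT.ereal_toReal measurableSet_Iic,
      Measure.restrict_apply (hT.ereal_toReal measurableSet_Iic), hm₂,
      withDensity_apply _ measurableSet_Iic, Measure.restrict_restrict measurableSet_Iic]
    have hI : Iic a ∩ Ioc t b = Ioc t (min b a) := by
      ext r; simp only [mem_inter_iff, mem_Iic, mem_Ioc, le_min_iff]; tauto
    rw [hI]
    rcases le_or_gt (min b a) t with h | h
    · rw [Ioc_eq_empty (not_lt.2 h)]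
      simp only [Measure.restrict_empty, lintegral_zero_measure]
      refine measure_mono_null ?_ measure_empty
      rintro e ⟨h1, h2, h3⟩
      have h4 := lt_nextT (S := S) (t := t) x y h2
      have h1' : (S.nextT t x y e).toReal ≤ a := h1
      have hr := hreal e h3
      rw [← hr] at h3 h4
      have h5 := EReal.coe_le_coe_iff.1 h3
      have h6 := EReal.coe_lt_coe_iff.1 h4
      have := le_min h5 h1'
      exact absurd (h6.trans_le this) (not_lt.2 h)
    · rw [survival_lintegral h.le, ← expMeasure_Iic (Lam_nonneg h.le)]
      refine measure_congr ?_
      filter_upwards [ae_exp_pos] with e he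
      refine propext ?_
      change ((S.nextT t x y e).toReal ≤ a ∧ 0 < e ∧ S.nextT t x y e ≤ (b : EReal)) ↔
        e ≤ S.Lam t x y (min b a)
      rw [← nextT_le_iff h]
      constructor
      · rintro ⟨h1, _, h3⟩
        have hr := hreal e h3
        rw [← hr] at h3 ⊢
        exact EReal.coe_le_coe_iff.2 (le_min (EReal.coe_le_coe_iff.1 h3) h1)
      · intro h1
        have h3 : S.nextT t x y e ≤ (b : EReal) :=
          h1.trans (EReal.coe_le_coe_iff.2 (min_le_left _ _))
        refine ⟨?_, he, h3⟩
        rw [← hreal e h3] at h1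
        exact (EReal.coe_le_coe_iff.1 h1).trans (min_le_right _ _)
  have h1 : ∫⁻ e, (if S.nextT t x y e < (b : EReal) then φ (S.nextT t x y e).toReal else 0)
      ∂(expMeasure 1) ≤ ∫⁻ e in E, φ (S.nextT t x y e).toReal ∂(expMeasure 1) := by
    rw [← lintegral_indicator hEm]
    refine lintegral_mono_ae ?_
    filter_upwards [ae_exp_pos] with e he
    split_ifs with h
    · rw [indicator_of_mem (show e ∈ E from ⟨he, h.le⟩)]
    · exact zero_le
  refine h1.trans ?_
  rw [← lintegral_map hφ hT.ereal_toReal]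
  change ∫⁻ s, φ s ∂m₁ ≤ _
  rw [hEq, hm₂, lintegral_withDensity_eq_lintegral_mul _ hdens hφ]
  refine le_of_eq (lintegral_congr fun s => ?_)
  simp only [Pi.mul_apply, mul_comm]

end Dyn

/-- A supersolution for the process `S` in the cusp `D`, with running cost `w` and terminal
cost `c`, valid after time `t₀`. -/
structure IsBarrierFor {D : CuspData} (A : Barrier D) (S : Dyn) (t₀ : ℝ) (w : ℝ → ℝ≥0∞)
    (c : ℤˣ → ℝ) : Prop where
  deriv_eq : deriv D.f = deriv S.U
  p_eq : A.p = fun t => (S.ε t)⁻¹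
  measurable_w : Measurable w
  w_le : ∀ s x, w s ≤ ENNReal.ofReal (A.l (A.q s x))
  V_nonneg : ∀ t x y, t₀ ≤ t → x ∈ Icc (D.z (-1)) (D.z 1) → 0 ≤ A.V t x y
  c_le : ∀ t y, t₀ ≤ t → c y ≤ A.V t (D.z y) y

namespace IsBarrierFor

variable {D : CuspData} {A : Barrier D} {S : Dyn} {t₀ : ℝ} {w : ℝ → ℝ≥0∞} {c : ℤˣ → ℝ}

theorem rate_eq (h : IsBarrierFor A S t₀ w c) (t x : ℝ) (y : ℤˣ) : S.rate t x y = A.rate t x y := by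
  funext s
  rw [Dyn.rate_eq, Barrier.rate, h.p_eq, ← h.deriv_eq]
  rfl

/-- One flight decreases the supersolution. -/
theorem one_step (h : IsBarrierFor A S t₀ w c) {t x : ℝ} (y : ℤˣ) (ht : t₀ ≤ t)
    (hx : x ∈ Icc (D.z (-1)) (D.z 1)) :
    ∫⁻ e, ((∫⁻ s in {s : ℝ | t < s ∧ s ≤ t + D.ell y x ∧ (s : EReal) ≤ S.nextT t x y e}, w s) +
      if S.nextT t x y e < ((t + D.ell y x : ℝ) : EReal) then
        ENNReal.ofReal (A.V (S.nextT t x y e).toReal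
          (line t x y (S.nextT t x y e).toReal) (-y))
      else ENNReal.ofReal (c y)) ∂(expMeasure 1) ≤ ENNReal.ofReal (A.V t x y) := by
  have hl : 0 ≤ D.ell y x := ((D.mem_cusp_iff y).1 hx).2
  set b := t + D.ell y x with hb
  have htb : t ≤ b := by linarith
  have hT := Dyn.measurable_nextT' (S := S) (t := t) (x := x) (y := y)
  have mb : line t x y b ∈ Icc (D.z (-1)) (D.z 1) := by
    rw [hb, Dyn.line_end]
    rcases Int.units_eq_one_or y with rfl | rfl
    · exact ⟨D.zz.le, le_rfl⟩
    · exact ⟨le_rfl, D.zz.le⟩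
  have mt : line t x y t ∈ Icc (D.z (-1)) (D.z 1) := by simpa using hx
  have ms : ∀ s ∈ Icc t b, line t x y s ∈ Icc (D.z (-1)) (D.z 1) := fun s hs =>
    Barrier.line_mem mt mb hs
  set sv : ℝ → ℝ := fun s => Real.exp (-S.Lam t x y s) with hsv
  have hsvm : Measurable sv := (Dyn.continuous_Lam t x y).neg.rexp.measurable
  have hLam : ∀ s, S.Lam t x y s = ∫ r in t..s, A.rate t x y r := fun s => by
    rw [← h.rate_eq]; rfl
  set lq : ℝ → ℝ := fun s => A.l (A.q s (line t x y s)) with hlq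
  set φ : ℝ → ℝ := fun s => A.V s (line t x y s) (-y) with hφ
  have hφm : Measurable φ := A.measurable_V_line (-y)
  -- the three parts of the cost
  have term1 : ∫⁻ e, (∫⁻ s in {s : ℝ | t < s ∧ s ≤ b ∧ (s : EReal) ≤ S.nextT t x y e}, w s)
      ∂(expMeasure 1) ≤ ∫⁻ s in Ioc t b, ENNReal.ofReal (sv s * lq s) := by
    have hset : MeasurableSet {p : ℝ × ℝ | (p.2 : EReal) ≤ S.nextT t x y p.1} :=
      measurableSet_le (measurable_coe_real_ereal.comp measurable_snd) (hT.comp measurable_fst)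
    have e1 : ∀ e, (∫⁻ s in {s : ℝ | t < s ∧ s ≤ b ∧ (s : EReal) ≤ S.nextT t x y e}, w s) =
        ∫⁻ s in Ioc t b, {p : ℝ × ℝ | (p.2 : EReal) ≤ S.nextT t x y p.1}.indicator
          (fun p => w p.2) (e, s) := by
      intro e
      have hs : MeasurableSet {s : ℝ | (s : EReal) ≤ S.nextT t x y e} :=
        measurableSet_le measurable_coe_real_ereal measurable_const
      have : {s : ℝ | t < s ∧ s ≤ b ∧ (s : EReal) ≤ S.nextT t x y e} =
          {s : ℝ | (s : EReal) ≤ S.nextT t x y e} ∩ Ioc t b := by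
        ext s; simp only [mem_ofPred_eq, mem_inter_iff, mem_Ioc]; tauto
      rw [this, ← Measure.restrict_restrict hs, ← lintegral_indicator hs]
      rfl
    simp_rw [e1]
    rw [lintegral_lintegral_swap]
    · refine setLIntegral_mono' measurableSet_Ioc fun s hs => ?_
      have e2 : ∀ e, {p : ℝ × ℝ | (p.2 : EReal) ≤ S.nextT t x y p.1}.indicator
          (fun p => w p.2) (e, s) = {e | (s : EReal) ≤ S.nextT t x y e}.indicator
            (fun _ => w s) e := fun e => rfl
      simp_rw [e2]
      rw [lintegral_indicator (measurableSet_le measurable_const hT), setLIntegral_const,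
        ENNReal.ofReal_mul (Real.exp_pos _).le, mul_comm]
      exact mul_le_mul' (Dyn.measure_le_nextT hs.1.le) (h.w_le s _)
    · exact ((h.measurable_w.comp measurable_snd).indicator hset).aemeasurable
  have term2 : ∫⁻ e, (if S.nextT t x y e < (b : EReal) then
        ENNReal.ofReal (φ (S.nextT t x y e).toReal) else 0) ∂(expMeasure 1) ≤
      ∫⁻ s in Ioc t b, ENNReal.ofReal (sv s * (A.rate t x y s * φ s)) := by
    refine (Dyn.lintegral_nextT_le hφm.ennreal_ofReal).trans ?_
    refine setLIntegral_mono' measurableSet_Ioc fun s hs => ?_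
    have h0 : 0 ≤ φ s := h.V_nonneg s _ _ (ht.trans hs.1.le) (ms s (Ioc_subset_Icc_self hs))
    rw [← ENNReal.ofReal_mul h0, h.rate_eq]
    refine ENNReal.ofReal_le_ofReal (le_of_eq ?_)
    simp only [hsv]; ring
  have term3 : ∫⁻ e, (if S.nextT t x y e < (b : EReal) then 0 else ENNReal.ofReal (c y))
      ∂(expMeasure 1) ≤ ENNReal.ofReal (sv b * A.V b (line t x y b) y) := by
    have e1 : (fun e => if S.nextT t x y e < (b : EReal) then 0 else ENNReal.ofReal (c y)) =
        {e | (b : EReal) ≤ S.nextT t x y e}.indicator fun _ => ENNReal.ofReal (c y) := by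
      funext e
      by_cases h1 : S.nextT t x y e < (b : EReal)
      · rw [if_pos h1, indicator_of_notMem]; exact not_le.2 h1
      · rw [if_neg h1, indicator_of_mem]; exact not_lt.1 h1
    rw [e1, lintegral_indicator (measurableSet_le measurable_const hT), setLIntegral_const,
      ENNReal.ofReal_mul (Real.exp_pos _).le, mul_comm]
    refine mul_le_mul' (Dyn.measure_le_nextT htb) (ENNReal.ofReal_le_ofReal ?_)
    rw [hb, Dyn.line_end]
    exact h.c_le _ y (ht.trans htb)
  -- the supersolution inequality
  have hM : ∀ s ∈ Icc t b, |A.rate t x y s| ≤ D.M * A.p b := fun s hs =>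
    A.rate_le hs.2 (ms s hs)
  have hvb : ∀ y', ∀ s ∈ Icc t b, |A.V s (line t x y s) y'| ≤
      |A.B| + D.K + 2 + |A.κ 1| + |A.κ (-1)| := fun y' s hs => A.abs_V_le (ms s hs)
  have key := survival_supersolution (v := fun s => A.V s (line t x y s) y) (φ := φ) (l := lq)
    A.measurable_rate htb hM (fun s _ => A.rate_nonneg s)
    (intervalIntegrable_of_bounded (A.measurable_V_line y) htb (hvb y))
    (A.intervalIntegrable_loss htb mt mb)
    (fun s hs => by
      have := A.decreases (y := y) hs.1 hx (ms s hs)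
      exact this)
  simp only [← hLam, line_self] at key
  have i1 : IntegrableOn (fun s => sv s * lq s) (Ioc t b) := by
    rw [← intervalIntegrable_iff_integrableOn_Ioc_of_le htb]
    exact A.intervalIntegrable_l.continuousOn_mul
      (Dyn.continuous_Lam t x y).neg.rexp.continuousOn
  have i2 : IntegrableOn (fun s => sv s * (A.rate t x y s * φ s)) (Ioc t b) := by
    rw [← intervalIntegrable_iff_integrableOn_Ioc_of_le htb]
    refine IntervalIntegrable.continuousOn_mul ?_
      (Dyn.continuous_Lam t x y).neg.rexp.continuousOn
    refine intervalIntegrable_of_bounded (A.measurable_rate.mul hφm) htb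
      (M := D.M * A.p b * (|A.B| + D.K + 2 + |A.κ 1| + |A.κ (-1)|)) fun s hs => ?_
    rw [abs_mul]
    exact mul_le_mul (hM s hs) (hvb _ s hs) (abs_nonneg _) ((abs_nonneg _).trans (hM s hs))
  have p1 : 0 ≤ᵐ[volume.restrict (Ioc t b)] fun s => sv s * lq s :=
    Filter.Eventually.of_forall fun s => mul_nonneg (Real.exp_pos _).le (A.l_nonneg _)
  have p2 : 0 ≤ᵐ[volume.restrict (Ioc t b)] fun s => sv s * (A.rate t x y s * φ s) := by
    filter_upwards [ae_restrict_mem measurableSet_Ioc] with s hs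
    exact mul_nonneg (Real.exp_pos _).le (mul_nonneg (A.rate_nonneg s)
      (h.V_nonneg s _ _ (ht.trans hs.1.le) (ms s (Ioc_subset_Icc_self hs))))
  have q1 := setIntegral_nonneg_of_ae_restrict p1
  have q2 := setIntegral_nonneg_of_ae_restrict p2
  have q3 : 0 ≤ sv b * A.V b (line t x y b) y :=
    mul_nonneg (Real.exp_pos _).le (h.V_nonneg _ _ _ (ht.trans htb) mb)
  rw [← ofReal_integral_eq_lintegral_ofReal i1 p1] at term1
  rw [← ofReal_integral_eq_lintegral_ofReal i2 p2] at term2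
  have hsplit : ∀ e, (if S.nextT t x y e < (b : EReal) then
        ENNReal.ofReal (φ (S.nextT t x y e).toReal) else ENNReal.ofReal (c y)) =
      (if S.nextT t x y e < (b : EReal) then
        ENNReal.ofReal (φ (S.nextT t x y e).toReal) else 0) +
      (if S.nextT t x y e < (b : EReal) then 0 else ENNReal.ofReal (c y)) := by
    intro e; split_ifs <;> simp
  have m2 : Measurable fun e => (if S.nextT t x y e < (b : EReal) then
        ENNReal.ofReal (φ (S.nextT t x y e).toReal) else 0) :=
    Measurable.ite (measurableSet_lt hT measurable_const)
      (hφm.comp hT.ereal_toReal).ennreal_ofReal measurable_const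
  have m3 : Measurable fun e => (if S.nextT t x y e < (b : EReal) then 0
      else ENNReal.ofReal (c y)) :=
    Measurable.ite (measurableSet_lt hT measurable_const) measurable_const measurable_const
  have hsplit' : ∀ e, (if S.nextT t x y e < (b : EReal) then
        ENNReal.ofReal (A.V (S.nextT t x y e).toReal
          (line t x y (S.nextT t x y e).toReal) (-y)) else ENNReal.ofReal (c y)) = _ := hsplit
  have hadd : ∀ f₁ f₂ f₃ : ℝ → ℝ≥0∞, Measurable f₂ → Measurable f₃ →
      ∫⁻ e, (f₁ e + (f₂ e + f₃ e)) ∂(expMeasure 1) = (∫⁻ e, f₁ e ∂(expMeasure 1)) +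
        ((∫⁻ e, f₂ e ∂(expMeasure 1)) + ∫⁻ e, f₃ e ∂(expMeasure 1)) :=
    fun f₁ f₂ f₃ h₂ h₃ => by
      rw [← lintegral_add_right _ h₃]; exact lintegral_add_right _ (h₂.add h₃)
  simp_rw [hsplit']
  rw [hadd _ _ _ m2 m3]
  refine (add_le_add term1 (add_le_add term2 term3)).trans ?_
  rw [← ENNReal.ofReal_add q2 q3, ← ENNReal.ofReal_add q1 (add_nonneg q2 q3)]
  refine ENNReal.ofReal_le_ofReal ?_
  have e5 : ∫ s in t..b, Real.exp (-S.Lam t x y s) * (lq s + A.rate t x y s * φ s) =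
      (∫ s in Ioc t b, sv s * lq s) + ∫ s in Ioc t b, sv s * (A.rate t x y s * φ s) := by
    rw [intervalIntegral.integral_of_le htb, ← integral_add i1 i2]
    simp only [hsv, mul_add]
  rw [e5] at key
  linarith

/-- Conditionally on the first threshold the remaining ones form a fresh sequence of the same law.
The induction hypothesis replaces the cost after the first jump by V at that jump, and `one_step`
closes the recursion. -/
theorem lintegral_J_le (h : IsBarrierFor A S t₀ w c) (n : ℕ) {t x : ℝ} (y : ℤˣ) (ht : t₀ ≤ t)
    (hx : x ∈ Icc (D.z (-1)) (D.z 1)) :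
    ∫⁻ e, S.J D w (fun y => ENNReal.ofReal (c y)) n t x y e ∂expSeq ≤
      ENNReal.ofReal (A.V t x y) := by
  induction n generalizing t x y with
  | zero => simp [Dyn.J]
  | succ n ih =>
    have hm : Measurable fun e => S.J D w (fun y => ENNReal.ofReal (c y)) (n + 1) t x y e :=
      (Dyn.measurable_J h.measurable_w _ (n + 1) y).comp
        ((measurable_const (a := (t, x))).prodMk measurable_id)
    rw [lintegral_expSeq hm]
    refine le_trans (lintegral_mono fun a => ?_) (h.one_step y ht hx)
    simp only [Dyn.J]
    change ∫⁻ v, ((∫⁻ s in {s : ℝ | t < s ∧ s ≤ t + D.ell y x ∧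
      (s : EReal) ≤ S.nextT t x y a}, w s) +
      if S.nextT t x y a < ((t + D.ell y x : ℝ) : EReal) then
        S.J D w (fun y => ENNReal.ofReal (c y)) n (S.nextT t x y a).toReal
          (line t x y (S.nextT t x y a).toReal) (-y) v
      else ENNReal.ofReal (c y)) ∂expSeq ≤ _
    rw [lintegral_add_left measurable_const, lintegral_const, measure_univ, mul_one]
    gcongr
    split_ifs with hlt
    · obtain ⟨τ, hτ, hlt'⟩ := Dyn.exists_real_of_lt hlt
      have htτ : t ≤ τ := by
        have := Dyn.le_nextT (S := S) t x y a
        rw [hτ] at this; exact EReal.coe_le_coe_iff.1 this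
      rw [hτ, EReal.toReal_coe]
      refine ih (-y) (ht.trans htτ) ?_
      refine Barrier.line_mem (t := t) (x := x) (y := y) (s₁ := t) (s₂ := t + D.ell y x)
        (by simpa using hx) ?_ ⟨htτ, hlt'.le⟩
      rw [Dyn.line_end]
      rcases Int.units_eq_one_or y with rfl | rfl
      · exact ⟨D.zz.le, le_rfl⟩
      · exact ⟨le_rfl, D.zz.le⟩
    · simp

end IsBarrierFor

end VelocityJump

/-! ### The Markov property at a fixed time -/

namespace VelocityJump

namespace Dyn

variable {S : Dyn} {t₀ : ℝ}

theorem lt_nextT_iff {s x : ℝ} {y : ℤˣ} {a : ℝ} (hs : s ≤ t₀) (ha : 0 < a) :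
    (t₀ : EReal) < S.nextT s x y a ↔ S.Lam s x y t₀ < a := by
  rcases hs.eq_or_lt with rfl | hs
  · simp only [Lam_self, ha, iff_true]; exact lt_nextT x y ha
  · rw [← not_le, nextT_le_iff hs, not_le]

/-- The functional `F` of the state at time `t₀` and of the remaining thresholds, on the event that
there are fewer than `n` jumps before. -/
noncomputable def restart (S : Dyn) (t₀ : ℝ) (F : ℝ → ℤˣ → (ℕ → ℝ) → ℝ≥0∞) :
    ℕ → ℝ → ℝ → ℤˣ → (ℕ → ℝ) → ℝ≥0∞
  | 0, _, _, _, _ => 0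
  | n + 1, s, x, y, e =>
    if (t₀ : EReal) < S.nextT s x y (e 0) then
      F (line s x y t₀) y (consSeq (e 0 - S.Lam s x y t₀, fun k => e (k + 1)))
    else restart S t₀ F n (S.nextT s x y (e 0)).toReal
      (line s x y (S.nextT s x y (e 0)).toReal) (-y) fun k => e (k + 1)

variable {F F' : ℝ → ℤˣ → (ℕ → ℝ) → ℝ≥0∞}

theorem measurable_restart (hF : ∀ y, Measurable fun v : ℝ × (ℕ → ℝ) => F v.1 y v.2) (n : ℕ)
    (y : ℤˣ) :
    Measurable fun v : (ℝ × ℝ) × (ℕ → ℝ) => S.restart t₀ F n v.1.1 v.1.2 y v.2 := by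
  induction n generalizing y with
  | zero => simp only [restart]; exact measurable_const
  | succ n ih =>
    have hT : Measurable fun v : (ℝ × ℝ) × (ℕ → ℝ) => S.nextT v.1.1 v.1.2 y (v.2 0) :=
      (measurable_nextT (S := S) y).comp (measurable_fst.prodMk
        ((measurable_pi_apply 0).comp measurable_snd))
    have htail : Measurable fun v : (ℝ × ℝ) × (ℕ → ℝ) => fun k => v.2 (k + 1) :=
      measurable_pi_lambda _ fun k => (measurable_pi_apply (k + 1)).comp measurable_snd
    have hτ : Measurable fun v : (ℝ × ℝ) × (ℕ → ℝ) =>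
        (S.nextT v.1.1 v.1.2 y (v.2 0)).toReal := hT.ereal_toReal
    simp only [restart]
    refine Measurable.ite (measurableSet_lt measurable_const hT) ?_ ?_
    · refine (hF y).comp (Measurable.prodMk (by fun_prop) ?_)
      refine measurable_consSeq.comp (Measurable.prodMk ?_ htail)
      exact ((measurable_pi_apply 0).comp measurable_snd).sub
        ((measurable_Lam y t₀).comp measurable_fst)
    · exact (ih (-y)).comp ((hτ.prodMk (by fun_prop)).prodMk htail)

theorem restart_mono (F : ℝ → ℤˣ → (ℕ → ℝ) → ℝ≥0∞) (s x : ℝ) (y : ℤˣ) (e : ℕ → ℝ) :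
    Monotone fun n => S.restart t₀ F n s x y e := by
  refine monotone_nat_of_le_succ fun n => ?_
  induction n generalizing s x y e with
  | zero => simp [restart]
  | succ n ih =>
    rw [restart, restart]
    split_ifs
    · exact le_rfl
    · exact ih _ _ _ _

/-- There is no jump before t₀ with probability e^{-Λ}, Λ being the rate integrated up to t₀. On
that event the overshoot e 0 - Λ is again exponential and independent of the other thresholds, so
the sequence used after t₀ has the original law. -/
theorem lintegral_restart_succ (hF : ∀ y, Measurable fun v : ℝ × (ℕ → ℝ) => F v.1 y v.2) (n : ℕ)
    {s x : ℝ} (y : ℤˣ) (hs : s ≤ t₀) :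
    ∫⁻ e, S.restart t₀ F (n + 1) s x y e ∂expSeq =
      ENNReal.ofReal (Real.exp (-S.Lam s x y t₀)) * ∫⁻ e, F (line s x y t₀) y e ∂expSeq +
      ∫⁻ a in {a | S.nextT s x y a ≤ (t₀ : EReal)}, ∫⁻ v, S.restart t₀ F n (S.nextT s x y a).toReal
        (line s x y (S.nextT s x y a).toReal) (-y) v ∂expSeq ∂(expMeasure 1) := by
  have hm : Measurable fun e => S.restart t₀ F (n + 1) s x y e :=
    (measurable_restart hF (n + 1) y).comp ((measurable_const (a := (s, x))).prodMk measurable_id)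
  have hFm : Measurable fun e => F (line s x y t₀) y e :=
    (hF y).comp ((measurable_const (a := line s x y t₀)).prodMk measurable_id)
  have hT : Measurable (S.nextT s x y) := measurable_nextT'
  have hE : MeasurableSet {a | S.nextT s x y a ≤ (t₀ : EReal)} :=
    measurableSet_le hT measurable_const
  rw [lintegral_expSeq hm, ← lintegral_add_compl _ hE, add_comm]
  congr 1
  · set φ : ℝ → ℝ≥0∞ := fun a => ∫⁻ v, F (line s x y t₀) y (consSeq (a, v)) ∂expSeq with hφ
    have hφm : Measurable φ := Measurable.lintegral_prod_right' (ν := expSeq)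
      (f := fun p => F (line s x y t₀) y (consSeq p)) (hFm.comp measurable_consSeq)
    rw [lintegral_expSeq hFm, ← lintegral_exp_shift hφm (Lam_nonneg hs)]
    have hset : ({a | S.nextT s x y a ≤ (t₀ : EReal)}ᶜ : Set ℝ) =ᵐ[expMeasure 1]
        Ioi (S.Lam s x y t₀) := by
      filter_upwards [ae_exp_pos] with a ha
      refine propext ?_
      change ¬ (S.nextT s x y a ≤ (t₀ : EReal)) ↔ S.Lam s x y t₀ < a
      rw [not_le]; exact lt_nextT_iff hs ha
    rw [← setLIntegral_congr hset]
    refine setLIntegral_congr_fun hE.compl fun a ha => ?_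
    have ha' : (t₀ : EReal) < S.nextT s x y a := not_le.1 ha
    refine lintegral_congr fun v => ?_
    change (if (t₀ : EReal) < S.nextT s x y a then _ else _) = _
    rw [if_pos ha']; rfl
  · refine setLIntegral_congr_fun hE fun a ha => ?_
    have ha' : ¬ (t₀ : EReal) < S.nextT s x y a := not_lt.2 ha
    refine lintegral_congr fun v => ?_
    change (if (t₀ : EReal) < S.nextT s x y a then _ else _) = _
    rw [if_neg ha']; rfl

/-- The Markov property at time `t₀`, in the form of a comparison. -/
theorem lintegral_restart_le (hF : ∀ y, Measurable fun v : ℝ × (ℕ → ℝ) => F v.1 y v.2)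
    (hF' : ∀ y, Measurable fun v : ℝ × (ℕ → ℝ) => F' v.1 y v.2)
    (h : ∀ x y, ∫⁻ e, F x y e ∂expSeq ≤ ∫⁻ e, F' x y e ∂expSeq) (n : ℕ) {s x : ℝ} (y : ℤˣ)
    (hs : s ≤ t₀) :
    ∫⁻ e, S.restart t₀ F n s x y e ∂expSeq ≤ ∫⁻ e, S.restart t₀ F' n s x y e ∂expSeq := by
  induction n generalizing s x y with
  | zero => simp [restart]
  | succ n ih =>
    rw [lintegral_restart_succ hF n y hs, lintegral_restart_succ hF' n y hs]
    refine add_le_add (mul_le_mul' le_rfl (h _ _)) ?_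
    refine setLIntegral_mono' (measurableSet_le measurable_nextT' measurable_const) fun a ha => ?_
    refine ih (-y) ?_
    have h1 := EReal.coe_toReal (ne_top_of_le_ne_top (EReal.coe_ne_top t₀) ha)
      (nextT_ne_bot s x y a)
    have h2 : S.nextT s x y a ≤ (t₀ : EReal) := ha
    rw [← h1] at h2
    exact EReal.coe_le_coe_iff.1 h2

theorem exists_real_of_le {t x : ℝ} {y : ℤˣ} {e b : ℝ} (h : S.nextT t x y e ≤ (b : EReal)) :
    ∃ τ : ℝ, S.nextT t x y e = τ ∧ τ ≤ b := by
  have h1 := EReal.coe_toReal (h.trans_lt (EReal.coe_lt_top b)).ne (nextT_ne_bot t x y e)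
  refine ⟨_, h1.symm, ?_⟩
  rw [← h1] at h; exact EReal.coe_le_coe_iff.1 h

/-- After time `t₀` the trajectory is a trajectory started at time `t₀`. -/
theorem exists_restart (n : ℕ) {s x : ℝ} {y : ℤˣ} {e : ℕ → ℝ} (he : Good e) (hs : s ≤ t₀)
    (hn : (t₀ : EReal) < (S.chain s x y e n).time) :
    ∃ x' y' e', Good e' ∧ (∀ u, t₀ ≤ u → S.traj s x y e u = S.traj t₀ x' y' e' u) ∧
      ∀ F, S.restart t₀ F n s x y e = F x' y' e' := by
  induction n generalizing s x y e with
  | zero => exact absurd (EReal.coe_lt_coe_iff.1 hn) (not_lt.2 hs)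
  | succ n ih =>
    by_cases h : (t₀ : EReal) < S.nextT s x y (e 0)
    · have h0 := (lt_nextT_iff hs (he.1 0)).1 h
      have hg : Good (consSeq (e 0 - S.Lam s x y t₀, fun k => e (k + 1))) := by
        refine ⟨fun i => ?_, fun m => ?_⟩
        · cases i with
          | zero => exact sub_pos.2 h0
          | succ i => exact he.1 (i + 1)
        · obtain ⟨i, hi, h1⟩ := he.2 (m + 1)
          obtain ⟨j, rfl⟩ := Nat.exists_eq_succ_of_ne_zero (show i ≠ 0 by omega)
          exact ⟨j + 1, by omega, h1⟩
      refine ⟨line s x y t₀, y, _, hg, fun u hu => ?_, fun F => ?_⟩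
      · exact traj_restart he hg hs h0 rfl (fun k => rfl) hu
      · rw [restart, if_pos h]
    · obtain ⟨τ, hτ, hle⟩ := exists_real_of_le (not_lt.1 h)
      rw [chain_succ hτ] at hn
      obtain ⟨x', y', e', h1, h2, h3⟩ := ih he.tail hle hn
      refine ⟨x', y', e', h1, fun u hu => ?_, fun F => ?_⟩
      · rw [traj_of_le he hτ (hle.trans hu)]; exact h2 u hu
      · rw [restart, if_neg h, hτ, EReal.toReal_coe]; exact h3 F

/-- For a functional depending only on the state, `restart` reads off the state at t₀. Only an
inequality holds since n jumps may not suffice to reach t₀, in which case `restart` returns 0. -/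
theorem restart_le_of_le {a : ℝ≥0∞} (n : ℕ) {s x : ℝ} {y : ℤˣ} {e : ℕ → ℝ} {B : Set (ℝ × ℤˣ)}
    (he : Good e) (hs : s ≤ t₀) [∀ v, Decidable (v ∈ B)] :
    S.restart t₀ (fun x y _ => if (x, y) ∈ B then a else 0) n s x y e ≤
      if S.traj s x y e t₀ ∈ B then a else 0 := by
  obtain ⟨m, hm⟩ := exists_time_gt (S := S) he s x y t₀
  have hm' : (t₀ : EReal) < (S.chain s x y e (max n m)).time :=
    hm.trans_le (chain_time_mono s x y e (le_max_right _ _))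
  obtain ⟨x', y', e', h1, h2, h3⟩ := exists_restart (max n m) he hs hm'
  refine (restart_mono _ s x y e (le_max_left n m)).trans (le_of_eq ?_)
  rw [h2 t₀ le_rfl, traj_start h1]
  exact h3 _

end Dyn

/-- The law of the initial state and the thresholds. -/
theorem IsDriving.map_eq {Ω : Type*} [MeasurableSpace Ω] {P : Measure Ω} [IsProbabilityMeasure P]
    {X₀ : Ω → ℝ} {Y₀ : Ω → ℤˣ} {E : ℕ → Ω → ℝ} (h : IsDriving P X₀ Y₀ E) :
    P.map (fun ω => ((X₀ ω, Y₀ ω), fun k => E k ω)) =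
      (P.map fun ω => (X₀ ω, Y₀ ω)).prod expSeq := by
  have h1 := (indepFun_iff_map_prod_eq_prod_map_map
    (h.measurable_pos.prodMk h.measurable_vel).aemeasurable
    (measurable_pi_lambda _ h.measurable_clock).aemeasurable).1 h.indep_init
  have h2 := (iIndepFun_iff_map_fun_eq_infinitePi_map h.measurable_clock).1 h.indep_clock
  simp_rw [h.law_clock] at h2
  rw [h1, h2]; rfl

theorem IsDriving.ae_good {Ω : Type*} [MeasurableSpace Ω] {P : Measure Ω} [IsProbabilityMeasure P]
    {X₀ : Ω → ℝ} {Y₀ : Ω → ℤˣ} {E : ℕ → Ω → ℝ} (h : IsDriving P X₀ Y₀ E) :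
    ∀ᵐ ω ∂P, Dyn.Good fun k => E k ω := by
  have h2 := (iIndepFun_iff_map_fun_eq_infinitePi_map h.measurable_clock).1 h.indep_clock
  simp_rw [h.law_clock] at h2
  have := VelocityJump.ae_good
  unfold expSeq at this
  rw [← h2] at this
  exact ae_of_ae_map (measurable_pi_lambda _ h.measurable_clock).aemeasurable this

open Classical in
/-- The Markov property at time `t₀` for the random process: a functional of the process after
time `t₀`, conditioned on the state at time `t₀`. -/
theorem Dyn.exists_cond_bound (S : Dyn) {Ω : Type*} [MeasurableSpace Ω] {P : Measure Ω}
    [IsProbabilityMeasure P] {X₀ : Ω → ℝ} {Y₀ : Ω → ℤˣ} {E : ℕ → Ω → ℝ} (h : IsDriving P X₀ Y₀ E)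
    {s₀ t₀ : ℝ} (hs : s₀ ≤ t₀) {B : Set (ℝ × ℤˣ)} (hB : MeasurableSet B)
    {F : ℝ → ℤˣ → (ℕ → ℝ) → ℝ≥0∞} (hF : ∀ y, Measurable fun v : ℝ × (ℕ → ℝ) => F v.1 y v.2)
    {a : ℝ≥0∞} (ha : ∀ x y, (x, y) ∈ B → ∫⁻ e, F x y e ∂expSeq ≤ a) {A : Set Ω}
    (hA : A = {ω | S.traj s₀ (X₀ ω) (Y₀ ω) (fun k => E k ω) t₀ ∈ B}) (hA0 : P A ≠ 0) :
    ∃ Ψ : Ω → ℝ≥0∞, Measurable Ψ ∧ ∫⁻ ω, Ψ ω ∂(ProbabilityTheory.cond P A) ≤ a ∧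
      ∀ᵐ ω ∂(ProbabilityTheory.cond P A), ∃ x' y' e', Dyn.Good e' ∧ (x', y') ∈ B ∧
        (∀ u, t₀ ≤ u → S.traj s₀ (X₀ ω) (Y₀ ω) (fun k => E k ω) u = S.traj t₀ x' y' e' u) ∧
        F x' y' e' ≤ Ψ ω := by
  set Θ : Ω → (ℝ × ℤˣ) × (ℕ → ℝ) := fun ω => ((X₀ ω, Y₀ ω), fun k => E k ω) with hΘ
  have hΘm : Measurable Θ := (h.measurable_pos.prodMk h.measurable_vel).prodMk
    (measurable_pi_lambda _ h.measurable_clock)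
  set G : ℝ → ℤˣ → (ℕ → ℝ) → ℝ≥0∞ := fun x y e => if (x, y) ∈ B then F x y e else 0 with hG
  set C : ℝ≥0∞ → ℝ → ℤˣ → (ℕ → ℝ) → ℝ≥0∞ := fun a x y _ => if (x, y) ∈ B then a else 0 with hC
  have hset : ∀ y, MeasurableSet {v : ℝ × (ℕ → ℝ) | (v.1, y) ∈ B} := fun y =>
    (measurable_fst.prodMk measurable_const) hB
  have hGm : ∀ y, Measurable fun v : ℝ × (ℕ → ℝ) => G v.1 y v.2 := fun y =>
    Measurable.ite (hset y) (hF y) measurable_const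
  have hCm : ∀ a y, Measurable fun v : ℝ × (ℕ → ℝ) => C a v.1 y v.2 := fun a y =>
    Measurable.ite (hset y) measurable_const measurable_const
  -- functionals of the driving variables
  set R : (ℝ → ℤˣ → (ℕ → ℝ) → ℝ≥0∞) → ℕ → (ℝ × ℤˣ) × (ℕ → ℝ) → ℝ≥0∞ :=
    fun F n v => S.restart t₀ F n s₀ v.1.1 v.1.2 v.2 with hR
  have hRm : ∀ F : ℝ → ℤˣ → (ℕ → ℝ) → ℝ≥0∞,
      (∀ y, Measurable fun v : ℝ × (ℕ → ℝ) => F v.1 y v.2) → ∀ n, Measurable (R F n) := by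
    intro F hF n
    have h1 : Measurable fun v : (ℝ × (ℕ → ℝ)) × ℤˣ =>
        S.restart t₀ F n s₀ v.1.1 v.2 v.1.2 :=
      measurable_from_prod_countable_left fun y =>
        (Dyn.measurable_restart hF n y).comp
          ((measurable_const.prodMk measurable_fst).prodMk measurable_snd)
    exact h1.comp ((measurable_fst.fst.prodMk measurable_snd).prodMk measurable_fst.snd)
  have hmono : ∀ F, Monotone (R F) := fun F n m hnm v =>
    Dyn.restart_mono F s₀ v.1.1 v.1.2 v.2 hnm
  have hGC : ∀ x y, ∫⁻ e, G x y e ∂expSeq ≤ ∫⁻ e, C a x y e ∂expSeq := by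
    intro x y
    simp only [hG, hC]
    split_ifs with hxy
    · rw [lintegral_const, measure_univ, mul_one]; exact ha x y hxy
    · simp
  -- The comparison given the state at t₀ is integrated over the past and the initial law. The right
  -- side will be at most a·P(A), which after division by P(A) is the conditional bound.
  have hstep : ∀ n, ∫⁻ ω, R G n (Θ ω) ∂P ≤ ∫⁻ ω, R (C a) n (Θ ω) ∂P := by
    intro n
    rw [← lintegral_map (hRm G hGm n) hΘm, ← lintegral_map (hRm (C a) (hCm a) n) hΘm, h.map_eq,
      lintegral_prod _ (hRm G hGm n).aemeasurable,
      lintegral_prod _ (hRm (C a) (hCm a) n).aemeasurable]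
    exact lintegral_mono fun v => Dyn.lintegral_restart_le (S := S) (x := v.1) hGm (hCm a) hGC n v.2 hs
  have hkey : ∀ᵐ ω ∂P, ∃ x' y' e', Dyn.Good e' ∧
      (∀ u, t₀ ≤ u → S.traj s₀ (X₀ ω) (Y₀ ω) (fun k => E k ω) u = S.traj t₀ x' y' e' u) ∧
      (ω ∈ A ↔ (x', y') ∈ B) ∧ ∃ n, ∀ F, R F n (Θ ω) = F x' y' e' := by
    filter_upwards [h.ae_good] with ω hω
    obtain ⟨n, hn⟩ := Dyn.exists_time_gt (S := S) hω s₀ (X₀ ω) (Y₀ ω) t₀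
    obtain ⟨x', y', e', h1, h2, h3⟩ := Dyn.exists_restart n hω hs hn
    refine ⟨x', y', e', h1, h2, ?_, n, h3⟩
    rw [hA, mem_ofPred_eq, h2 t₀ le_rfl, Dyn.traj_start h1]
  -- the conditioning event is measurable up to a null set
  set A' : Set Ω := {ω | (⨆ n, R (C 1) n (Θ ω)) ≠ 0} with hA'
  have hA'm : MeasurableSet A' :=
    ((Measurable.iSup fun n => (hRm (C 1) (hCm 1) n).comp hΘm) (measurableSet_singleton 0)).compl
  have hAA' : A =ᵐ[P] A' := by
    filter_upwards [h.ae_good, hkey] with ω hω ⟨x', y', e', h1, h2, h3, n, h4⟩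
    refine propext ?_
    change ω ∈ A ↔ (⨆ n, R (C 1) n (Θ ω)) ≠ 0
    constructor
    · intro hm
      have h5 : R (C 1) n (Θ ω) = 1 := by rw [h4]; exact if_pos (h3.1 hm)
      have h6 := le_iSup (fun n => R (C 1) n (Θ ω)) n
      rw [h5] at h6
      exact (zero_lt_one.trans_le h6).ne'
    · intro hne
      by_contra hm
      refine hne (le_antisymm (iSup_le fun k => ?_) zero_le)
      have h5 := Dyn.restart_le_of_le (S := S) (t₀ := t₀) (a := 1) k (s := s₀) (x := X₀ ω)
        (y := Y₀ ω) (e := fun k => E k ω) (B := B) hω hs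
      rw [if_neg (by rw [hA] at hm; exact hm)] at h5
      exact h5
  have hres : P.restrict A = P.restrict A' := Measure.restrict_congr_set hAA'
  have hcond : ∀ᵐ ω ∂P, ∀ n, R (C a) n (Θ ω) ≤ A'.indicator (fun _ => a) ω := by
    filter_upwards [h.ae_good, hAA'] with ω hω hm n
    have hm' : ω ∈ A ↔ ω ∈ A' := iff_of_eq hm
    have h5 := Dyn.restart_le_of_le (S := S) (t₀ := t₀) (a := a) n (s := s₀) (x := X₀ ω)
        (y := Y₀ ω) (e := fun k => E k ω) (B := B) hω hs
    by_cases hmem : ω ∈ A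
    · rw [indicator_of_mem (hm'.1 hmem)]
      refine h5.trans ?_
      split_ifs <;> simp
    · rw [if_neg (by rw [hA] at hmem; exact hmem)] at h5
      exact h5.trans zero_le
  have hΨm : Measurable fun ω => ⨆ n, R G n (Θ ω) :=
    Measurable.iSup fun n => (hRm G hGm n).comp hΘm
  refine ⟨fun ω => ⨆ n, R G n (Θ ω), hΨm, ?_, ?_⟩
  · unfold ProbabilityTheory.cond
    rw [hres, lintegral_smul_measure, smul_eq_mul, measure_congr hAA']
    have h1 : ∫⁻ ω in A', ⨆ n, R G n (Θ ω) ∂P ≤ a * P A' := by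
      calc ∫⁻ ω in A', ⨆ n, R G n (Θ ω) ∂P ≤ ∫⁻ ω, ⨆ n, R G n (Θ ω) ∂P :=
            setLIntegral_le_lintegral _ _
        _ = ⨆ n, ∫⁻ ω, R G n (Θ ω) ∂P := lintegral_iSup (fun n => (hRm G hGm n).comp hΘm)
            fun n m hnm ω => hmono G hnm (Θ ω)
        _ ≤ ∫⁻ ω, A'.indicator (fun _ => a) ω ∂P := iSup_le fun n =>
            (hstep n).trans (lintegral_mono_ae (hcond.mono fun ω hω => hω n))
        _ = a * P A' := lintegral_indicator_const hA'm a
    rw [measure_congr hAA'] at hA0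
    calc (P A')⁻¹ * ∫⁻ ω in A', ⨆ n, R G n (Θ ω) ∂P ≤ (P A')⁻¹ * (a * P A') :=
          mul_le_mul' le_rfl h1
      _ = a := by
        rw [mul_comm a, ← mul_assoc, ENNReal.inv_mul_cancel hA0 (measure_ne_top P _), one_mul]
  · unfold ProbabilityTheory.cond
    refine Measure.ae_smul_measure ?_ _
    rw [hres, ae_restrict_iff' hA'm]
    filter_upwards [hkey, hAA'] with ω ⟨x', y', e', h1, h2, h3, n, h4⟩ hm hmem
    have hm' : ω ∈ A ↔ ω ∈ A' := iff_of_eq hm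
    have h5 := h3.1 (hm'.2 hmem)
    refine ⟨x', y', e', h1, h5, h2, ?_⟩
    have h6 : R G n (Θ ω) = F x' y' e' := by rw [h4]; exact if_pos h5
    rw [← h6]
    exact le_iSup (fun n => R G n (Θ ω)) n

end VelocityJump

/-! ### The two supersolutions: weighted time and exit side -/

namespace VelocityJump

namespace CuspData

variable (D : CuspData)

/-- The height climbed between `b y` and `z y` is `η`. -/
theorem integral_ρ (y : ℤˣ) :
    ∫ r in (0 : ℝ)..sg y * (D.z y - D.b y), D.ρ y (D.b y + sg y * r) = D.η := by
  have hℓ := D.sg_z_sub_b_pos y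
  have h1 : ∀ r ∈ uIcc 0 (sg y * (D.z y - D.b y)),
      HasDerivAt (fun r => D.f (D.b y + sg y * r)) (D.ρ y (D.b y + sg y * r)) r := by
    intro r hr
    rw [uIcc_of_le hℓ.le] at hr
    have h2 := sg_mul_sg_mul y r
    have h3 : sg y * (D.b y + sg y * r - D.b y) = r := by rw [add_sub_cancel_left, h2]
    rw [D.deriv_eq_ρ (by rw [h3]; exact hr.1) (by
      have h4 : sg y * (D.z y - (D.b y + sg y * r)) =
          sg y * (D.z y - D.b y) - sg y * (sg y * r) := by ring
      rw [h4, h2]; linarith [hr.2])]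
    have h5 := (D.hasDerivAt_f (D.b y + sg y * r)).comp r
      (((hasDerivAt_id r).const_mul (sg y)).const_add (D.b y))
    simpa [mul_comm, Function.comp_def] using h5
  have hcont : Continuous fun r => D.ρ y (D.b y + sg y * r) := by
    have := D.continuous_ρ y
    fun_prop
  rw [intervalIntegral.integral_eq_sub_of_hasDerivAt h1 (hcont.intervalIntegrable _ _),
    sg_mul_sg_mul, mul_zero, add_zero, add_sub_cancel, D.f_z, D.f_b]
  ring

/-- The rate at temperature one integrates to η over the climb, and the monotone p is bounded by its
values at the beginning and at the end of the climb. -/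
theorem climb_bounds {p : ℝ → ℝ} (hp : Monotone p) (y : ℤˣ) (t : ℝ) :
    D.η * p t ≤ (∫ r in (0 : ℝ)..sg y * (D.z y - D.b y),
      D.ρ y (D.b y + sg y * r) * p (t + r)) ∧
    (∫ r in (0 : ℝ)..sg y * (D.z y - D.b y), D.ρ y (D.b y + sg y * r) * p (t + r)) ≤
      D.η * p (t + sg y * (D.z y - D.b y)) := by
  have hℓ := (D.sg_z_sub_b_pos y).le
  have hcont : Continuous fun r => D.ρ y (D.b y + sg y * r) := by
    have := D.continuous_ρ y
    fun_prop
  have hi := hcont.intervalIntegrable (μ := volume) 0 (sg y * (D.z y - D.b y))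
  have hm : Monotone fun r => p (t + r) := fun _ _ h => hp (add_le_add_right h t)
  have hi' : IntervalIntegrable (fun r => D.ρ y (D.b y + sg y * r) * p (t + r)) volume 0
      (sg y * (D.z y - D.b y)) := (hm.intervalIntegrable).continuousOn_mul hcont.continuousOn
  rw [← D.integral_ρ y, ← intervalIntegral.integral_mul_const,
    ← intervalIntegral.integral_mul_const]
  constructor
  · exact intervalIntegral.integral_mono_on hℓ (hi.mul_const _) hi' fun r hr =>
      mul_le_mul_of_nonneg_left (hp (by linarith [hr.1])) (D.ρ_nonneg _ _)
  · exact intervalIntegral.integral_mono_on hℓ hi' (hi.mul_const _) fun r hr =>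
      mul_le_mul_of_nonneg_left (hp (by linarith [hr.2])) (D.ρ_nonneg _ _)

theorem g_b (α β q : ℝ) (y : ℤˣ) :
    D.g α β q (D.b y) = Real.exp (-(q * D.η)) * (α - β * D.cdf q (D.b y)) := by
  unfold g; rw [D.f_b]; ring_nf

theorem sg_z_sub_b_le (y : ℤˣ) : sg y * (D.z y - D.b y) ≤ D.L := by
  unfold L
  have := D.lt_left; have := D.lt_mid; have := D.lt_right
  rcases Int.units_eq_one_or y with rfl | rfl
  · simp; linarith
  · simp; linarith

/-- The supersolution for the time spent in the cusp. -/
noncomputable def costBarrier (p : ℝ → ℝ) (hp : Monotone p) (hp0 : ∀ t, 0 < p t) : Barrier D where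
  p := p
  α := 1
  β := 2
  -- K absorbs the corrections and 2 the climbing term κG ≤ 2, which makes V nonnegative.
  B := D.K + 2
  -- One unit pays for the running cost of the climb, the other for the term g in `entry`; both are
  -- at most e^{-qη}.
  κ := fun _ => 2
  -- Looking ahead by the whole length L makes q at least as large as p at any time of a climb, so
  -- that e^{-qη} is at most the true success probability.
  s := fun _ => D.L
  p_mono := hp
  p_pos := hp0
  abs_le_one := fun θ hθ => by rw [abs_le]; constructor <;> linarith [hθ.1, hθ.2]
  β_mem := by norm_num
  s_mem := fun _ => ⟨D.L_pos.le, le_rfl⟩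
  s_lip := fun x x' => by simp
  entry := fun y t => by
    set q := p (t + D.L) with hq
    have hq0 : 0 < q := hp0 _
    have hI := (D.climb_bounds hp y t).2
    have hp' : p (t + sg y * (D.z y - D.b y)) ≤ q := hp (by linarith [D.sg_z_sub_b_le y])
    have h1 : Real.exp (-(q * D.η)) ≤ Real.exp (-∫ r in (0 : ℝ)..sg y * (D.z y - D.b y),
        D.ρ y (D.b y + sg y * r) * p (t + r)) := by
      refine Real.exp_le_exp.2 (neg_le_neg (hI.trans ?_))
      rw [mul_comm]
      exact mul_le_mul_of_nonneg_right hp' D.η_pos.le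
    have h2 : 2 / D.Z q * (sg y * (D.z y - D.b y)) ≤ Real.exp (-(q * D.η)) := by
      have h3 := D.inner_le_Z hq0.le
      have h4 := D.short y
      have hZ := D.Z_pos q
      have h5 : (D.b 1 - D.b (-1)) ≤ Real.exp (-(q * D.η)) * D.Z q := by
        have h6 := mul_le_mul_of_nonneg_left h3 (Real.exp_pos (-(q * D.η))).le
        have h7 : Real.exp (-(q * D.η)) * ((D.b 1 - D.b (-1)) * Real.exp (q * D.η)) =
            D.b 1 - D.b (-1) := by
          rw [mul_comm (D.b 1 - D.b (-1)), ← mul_assoc, ← Real.exp_add]; simp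
        rw [h7] at h6; exact h6
      rw [div_mul_eq_mul_div, div_le_iff₀ hZ]
      linarith
    have h3 : -(sg y * D.g 1 2 q (D.b y)) ≤ Real.exp (-(q * D.η)) := by
      rw [D.g_b]
      have h4 := D.cdf_mem (q := q) (D.inner_sub (D.b_mem y))
      have h5 : |sg y * (Real.exp (-(q * D.η)) * (1 - 2 * D.cdf q (D.b y)))| ≤
          Real.exp (-(q * D.η)) := by
        rw [abs_mul, abs_sg, one_mul, abs_mul, abs_of_pos (Real.exp_pos _)]
        refine mul_le_of_le_one_right (Real.exp_pos _).le ?_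
        rw [abs_le]; constructor <;> linarith [h4.1, h4.2]
      exact (neg_le_abs _).trans h5
    linarith

/-- The supersolution for the probability of leaving the cusp at `z y₀`. -/
noncomputable def exitBarrier (p : ℝ → ℝ) (hp : Monotone p) (hp0 : ∀ t, 0 < p t) (y₀ : ℤˣ) :
    Barrier D where
  p := p
  α := sg y₀ / 2
  β := 0
  -- Both ends have the same height, so from inside either one is reached with probability near 1/2.
  -- The margin 1/12 covers corrections of size at most 1/12: V is nonnegative, at least 1 on exit
  -- at `z y₀`, and at most 1/2 + 1/12 + 1/12 = 2/3 on non-climbing states.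
  B := 1 / 2 + 1 / 12
  κ := fun y => -(sg y * sg y₀ / 2)
  -- The two climbs impose opposite demands. Towards `z y₀` the success probability needs an upper
  -- bound, so q must be p at the start of the climb and s vanishes at `b y₀`. Towards the other end
  -- it needs a lower bound, so the lookup must come no earlier than the end of the climb; `short`
  -- guarantees this, and the distance to `b y₀` is 1-Lipschitz.
  s := fun x => min D.L |x - D.b y₀|
  p_mono := hp
  p_pos := hp0
  abs_le_one := fun θ _ => by
    rw [zero_mul, sub_zero, abs_div, abs_sg]; norm_num
  β_mem := by norm_num
  s_mem := fun x => ⟨le_min D.L_pos.le (abs_nonneg _), min_le_left _ _⟩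
  s_lip := fun x x' => by
    refine (abs_min_sub_min_le_max _ _ _ _).trans (max_le (by simp) ?_)
    refine (abs_abs_sub_abs_le_abs_sub _ _).trans ?_
    rw [sub_sub_sub_cancel_right]
  entry := fun y t => by
    obtain ⟨hI1, hI2⟩ := D.climb_bounds hp y t
    rw [zero_div, zero_mul, zero_sub, D.g_b, zero_mul, sub_zero]
    rcases eq_or_ne y y₀ with rfl | hy
    · have h0 : min D.L |D.b y - D.b y| = 0 := by simp [D.L_pos.le]
      rw [h0, add_zero, sg_mul_self]
      have h1 : Real.exp (-∫ r in (0 : ℝ)..sg y * (D.z y - D.b y),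
          D.ρ y (D.b y + sg y * r) * p (t + r)) ≤ Real.exp (-(p t * D.η)) :=
        Real.exp_le_exp.2 (by linarith)
      have h2 : -(sg y * (Real.exp (-(p t * D.η)) * (sg y / 2))) =
          -(1 / 2) * Real.exp (-(p t * D.η)) := by
        linear_combination (-(1 / 2) * Real.exp (-(p t * D.η))) * sg_mul_self y
      rw [h2]; linarith
    · have hy' : y₀ = -y := by
        rcases Int.units_eq_one_or y with rfl | rfl <;>
          rcases Int.units_eq_one_or y₀ with rfl | rfl <;> simp at hy ⊢
      subst hy'
      have h0 : sg y * (D.z y - D.b y) ≤ min D.L |D.b y - D.b (-y)| := by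
        refine le_min (D.sg_z_sub_b_le y) ?_
        have h1 := D.short y
        have h2 := D.sg_b_sub_b y
        have h3 := le_abs_self (sg y * (D.b y - D.b (-y)))
        rw [abs_mul, abs_sg, one_mul] at h3
        linarith [D.sg_z_sub_b_pos y]
      set q := p (t + min D.L |D.b y - D.b (-y)|) with hq
      have hp' : p (t + sg y * (D.z y - D.b y)) ≤ q := hp (by linarith)
      have h1 : Real.exp (-(q * D.η)) ≤ Real.exp (-∫ r in (0 : ℝ)..sg y * (D.z y - D.b y),
          D.ρ y (D.b y + sg y * r) * p (t + r)) := by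
        refine Real.exp_le_exp.2 (neg_le_neg (hI2.trans ?_))
        rw [mul_comm]
        exact mul_le_mul_of_nonneg_right hp' D.η_pos.le
      rw [sg_neg]
      have h2 : -(sg y * (Real.exp (-(q * D.η)) * (-sg y / 2))) =
          1 / 2 * Real.exp (-(q * D.η)) := by
        linear_combination (1 / 2 * Real.exp (-(q * D.η))) * sg_mul_self y
      have h3 : -(sg y * -sg y / 2) = 1 / 2 := by linear_combination 1 / 2 * sg_mul_self y
      rw [h2, h3]; linarith

variable {D} {S : Dyn}

/-- The weight of a time at which the inverse temperature is `p`. -/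
noncomputable def timeWeight (D : CuspData) (S : Dyn) (s : ℝ) : ℝ≥0∞ :=
  ENNReal.ofReal (1 / D.Z (S.ε (s + D.L))⁻¹)

theorem measurable_timeWeight : Measurable (D.timeWeight S) := by
  have h1 := (Dyn.inv_mono (S := S)).measurable
  have h2 := D.continuous_Z.measurable
  unfold timeWeight
  exact ((h2.comp (h1.comp (by fun_prop))).const_div 1).ennreal_ofReal

theorem isBarrierFor_costBarrier (h : deriv D.f = deriv S.U) (t₀ : ℝ) :
    IsBarrierFor (D.costBarrier (fun t => (S.ε t)⁻¹) Dyn.inv_mono fun t => inv_pos.2 (S.pos t))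
      S t₀ (D.timeWeight S) fun _ => 0 where
  deriv_eq := h
  p_eq := rfl
  measurable_w := measurable_timeWeight
  w_le := fun s x => by
    refine ENNReal.ofReal_le_ofReal (le_of_eq ?_)
    simp only [Barrier.l, Barrier.q, costBarrier]
    rw [← div_div, div_self two_ne_zero]
  V_nonneg := fun t x y _ hx => by
    set A := D.costBarrier (fun t => (S.ε t)⁻¹) Dyn.inv_mono fun t => inv_pos.2 (S.pos t)
    have h1 := A.le_V (t := t) (y := y) hx
    have h2 := A.G_le_one (y := y) (t := t) hx
    have h3 : D.K * D.c (A.p t) ≤ D.K :=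
      mul_le_of_le_one_right D.K_nonneg (D.c_le_one (A.p_pos t).le)
    have h4 : A.B = D.K + 2 := rfl
    have h5 : A.κ y = 2 := rfl
    rw [h4, h5] at h1
    split_ifs at h1 <;> linarith
  c_le := fun t y _ => by
    set A := D.costBarrier (fun t => (S.ε t)⁻¹) Dyn.inv_mono fun t => inv_pos.2 (S.pos t)
    have hx : D.z y ∈ Icc (D.z (-1)) (D.z 1) :=
      (D.mem_cusp_iff y).2 ⟨by rw [D.sg_z_sub_z]; exact D.L_pos.le, by simp⟩
    have h1 := A.le_V (t := t) (y := y) hx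
    have h2 := A.G_le_one (y := y) (t := t) hx
    have h3 : D.K * D.c (A.p t) ≤ D.K :=
      mul_le_of_le_one_right D.K_nonneg (D.c_le_one (A.p_pos t).le)
    have h4 : A.B = D.K + 2 := rfl
    have h5 : A.κ y = 2 := rfl
    rw [h4, h5] at h1
    split_ifs at h1 <;> linarith

theorem isBarrierFor_exitBarrier (h : deriv D.f = deriv S.U) (y₀ : ℤˣ) {t₀ : ℝ}
    (hK : D.K * D.c (S.ε t₀)⁻¹ ≤ 1 / 12) :
    IsBarrierFor (D.exitBarrier (fun t => (S.ε t)⁻¹) Dyn.inv_mono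
      (fun t => inv_pos.2 (S.pos t)) y₀) S t₀ 0 fun y => if y = y₀ then 1 else 0 := by
  set A := D.exitBarrier (fun t => (S.ε t)⁻¹) Dyn.inv_mono (fun t => inv_pos.2 (S.pos t)) y₀
    with hA
  have hB : A.B = 1 / 2 + 1 / 12 := rfl
  have hκ : ∀ y, A.κ y = -(sg y * sg y₀ / 2) := fun y => rfl
  have hKt : ∀ t, t₀ ≤ t → D.K * D.c (A.p t) ≤ 1 / 12 := fun t ht =>
    (mul_le_mul_of_nonneg_left (D.c_anti (A.p_mono ht)) D.K_nonneg).trans hK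
  have hV : ∀ t x y, t₀ ≤ t → x ∈ Icc (D.z (-1)) (D.z 1) → 0 ≤ A.V t x y := by
    intro t x y ht hx
    have h1 := A.le_V (t := t) (y := y) hx
    have h2 := A.G_le_one (y := y) (t := t) hx
    have h3 := hKt t ht
    have h4 : A.κ y * A.G y t x ≤ 1 / 2 := by
      have h5 : |A.κ y| = 1 / 2 := by
        rw [hκ, abs_neg, abs_div, abs_mul, abs_sg, abs_sg]; norm_num
      have h6 := le_abs_self (A.κ y * A.G y t x)
      rw [abs_mul, h5, abs_of_pos (A.G_pos _ _ _)] at h6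
      linarith
    rw [hB] at h1
    split_ifs at h1 <;> linarith
  refine ⟨h, rfl, measurable_const, fun s x => zero_le, hV,
    fun t y ht => ?_⟩
  have hx : D.z y ∈ Icc (D.z (-1)) (D.z 1) :=
    (D.mem_cusp_iff y).2 ⟨by rw [D.sg_z_sub_z]; exact D.L_pos.le, by simp⟩
  split_ifs with hy
  · subst hy
    have h1 := A.le_V (t := t) (y := y) hx
    rw [if_pos (D.sg_z_sub_b_pos y), hB, hκ, sg_mul_self] at h1
    have h2 : A.G y t (D.z y) = 1 := by simp [Barrier.G]
    rw [h2] at h1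
    linarith [hKt t ht]
  · exact hV t _ y ht hx

/-- Monotone convergence along the number of jumps. -/
theorem lintegral_iSup_J {A : Barrier D} {t₀ : ℝ} {w : ℝ → ℝ≥0∞} {c : ℤˣ → ℝ}
    (h : IsBarrierFor A S t₀ w c) {t x : ℝ} (y : ℤˣ) (ht : t₀ ≤ t)
    (hx : x ∈ Icc (D.z (-1)) (D.z 1)) :
    ∫⁻ e, ⨆ n, S.J D w (fun y => ENNReal.ofReal (c y)) n t x y e ∂expSeq ≤
      ENNReal.ofReal (A.V t x y) := by
  rw [lintegral_iSup]
  · exact iSup_le fun n => h.lintegral_J_le n y ht hx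
  · exact fun n => (Dyn.measurable_J h.measurable_w _ n y).comp
      ((measurable_const (a := (t, x))).prodMk measurable_id)
  · exact fun n m hnm e => Dyn.J_mono w _ t x y e hnm

/-- For a state that is not climbing the bound is B + K + β/2 with B = K + 2 and β = 2. -/
theorem lintegral_cost_le (h : deriv D.f = deriv S.U) (t : ℝ) {x : ℝ} {y : ℤˣ}
    (hx : x ∈ Icc (D.z (-1)) (D.z 1)) (hy : sg y * (x - D.b y) ≤ 0) :
    ∫⁻ e, ⨆ n, S.J D (D.timeWeight S) (fun _ => ENNReal.ofReal 0) n t x y e ∂expSeq ≤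
      ENNReal.ofReal (2 * D.K + 3) := by
  refine (lintegral_iSup_J (isBarrierFor_costBarrier h t) y le_rfl hx).trans
    (ENNReal.ofReal_le_ofReal ?_)
  set A := D.costBarrier (fun t => (S.ε t)⁻¹) Dyn.inv_mono fun t => inv_pos.2 (S.pos t)
  have h1 := A.V_le (t := t) (y := y) hx
  have h3 : D.K * D.c (A.p t) ≤ D.K :=
    mul_le_of_le_one_right D.K_nonneg (D.c_le_one (A.p_pos t).le)
  have h4 : A.B = D.K + 2 := rfl
  have h5 : A.β = 2 := rfl
  rw [h4, h5, if_neg (not_lt.2 hy)] at h1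
  linarith

theorem lintegral_exit_le (h : deriv D.f = deriv S.U) (y₀ : ℤˣ) {t : ℝ}
    (hK : D.K * D.c (S.ε t)⁻¹ ≤ 1 / 12) {x : ℝ} {y : ℤˣ}
    (hx : x ∈ Icc (D.z (-1)) (D.z 1)) (hy : sg y * (x - D.b y) ≤ 0) :
    ∫⁻ e, ⨆ n, S.J D 0 (fun y => ENNReal.ofReal (if y = y₀ then 1 else 0)) n t x y e ∂expSeq ≤
      ENNReal.ofReal (2 / 3) := by
  refine (lintegral_iSup_J (isBarrierFor_exitBarrier h y₀ hK) y le_rfl hx).trans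
    (ENNReal.ofReal_le_ofReal ?_)
  set A := D.exitBarrier (fun t => (S.ε t)⁻¹) Dyn.inv_mono (fun t => inv_pos.2 (S.pos t)) y₀
  have h1 := A.V_le (t := t) (y := y) hx
  have h3 : D.K * D.c (A.p t) ≤ 1 / 12 := hK
  have h4 : A.B = 1 / 2 + 1 / 12 := rfl
  have h5 : A.β = 0 := rfl
  rw [h4, h5, if_neg (not_lt.2 hy)] at h1
  linarith

end CuspData

end VelocityJump

namespace VelocityJump

/-! ### Morse functions on the line -/

section Morse

variable {U : ℝ → ℝ}

theorem IsMorse.comp_neg (hM : IsMorse U) : IsMorse fun x => U (-x) := by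
  intro x hx
  have h1 : deriv (fun x => U (-x)) = fun x => -deriv U (-x) := by
    funext x; exact deriv_comp_neg U x
  rw [h1] at hx ⊢
  have h2 : deriv (fun x => -deriv U (-x)) x = deriv (deriv U) (-x) := by
    have h3 := deriv_comp_neg (deriv U) x
    rw [deriv.fun_neg, h3, neg_neg]
  rw [h2]
  exact hM _ (by simpa using hx)

theorem contDiff_deriv (hU : ContDiff ℝ (⊤ : ℕ∞) U) : ContDiff ℝ (⊤ : ℕ∞) (deriv U) :=
  (contDiff_infty_iff_deriv.1 hU).2

/-- The critical points of a Morse function are isolated. -/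
theorem IsMorse.eventually_deriv_ne (hM : IsMorse U) (hU : ContDiff ℝ (⊤ : ℕ∞) U) (a : ℝ) :
    ∀ᶠ x in nhdsWithin a {a}ᶜ, deriv U x ≠ 0 := by
  by_cases h : deriv U a = 0
  · have hd : HasDerivAt (deriv U) (deriv (deriv U) a) a :=
      ((contDiff_deriv hU).differentiable (by simp) a).hasDerivAt
    exact hd.eventually_ne (hM a h)
  · exact ((contDiff_deriv hU).continuous.continuousAt.eventually_ne h).filter_mono
      nhdsWithin_le_nhds

/-- A Morse function that is maximal at the right end of an interval increases up to it. -/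
theorem IsMorse.exists_deriv_pos_left (hM : IsMorse U) (hU : ContDiff ℝ (⊤ : ℕ∞) U) {a b : ℝ}
    (hab : b < a) (h : ∀ x ∈ Ioo b a, U x < U a) :
    ∃ r > 0, ∀ x ∈ Ioo (a - r) a, 0 < deriv U x := by
  obtain ⟨r, hr, hball⟩ := Metric.mem_nhdsWithin_iff.1 (hM.eventually_deriv_ne hU a)
  have hcd := (contDiff_deriv hU).continuous
  have hne : ∀ x ∈ Ioo (a - r) a, deriv U x ≠ 0 := fun x hx =>
    hball ⟨by rw [Metric.mem_ball, Real.dist_eq, abs_sub_lt_iff]; constructor <;>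
      linarith [hx.1, hx.2], by simpa using hx.2.ne⟩
  refine ⟨r, hr, fun x hx => ?_⟩
  by_contra hc
  have hx0 : deriv U x < 0 := lt_of_le_of_ne (not_lt.1 hc) (hne x hx)
  have hneg : ∀ x' ∈ Ioo (a - r) a, deriv U x' < 0 := by
    intro x' hx'
    by_contra hc'
    have hx0' : 0 ≤ deriv U x' := not_lt.1 hc'
    obtain ⟨u, hu, hu0⟩ := intermediate_value_uIcc (a := x) (b := x') hcd.continuousOn
      (show (0 : ℝ) ∈ uIcc (deriv U x) (deriv U x') from mem_uIcc.2 (Or.inl ⟨hx0.le, hx0'⟩))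
    refine hne u ?_ hu0
    rcases mem_uIcc.1 hu with h1 | h1
    · exact ⟨hx.1.trans_le h1.1, h1.2.trans_lt hx'.2⟩
    · exact ⟨hx'.1.trans_le h1.1, h1.2.trans_lt hx.2⟩
  -- The derivative has constant sign next to a. A negative sign would make U decrease towards a,
  -- contradicting U u < U a.
  set u := max ((a + b) / 2) (a - r / 2) with hu
  have hu1 : (a + b) / 2 ≤ u := le_max_left _ _
  have hu2 : a - r / 2 ≤ u := le_max_right _ _
  have hu3 : u < a := max_lt (by linarith) (by linarith)
  have hanti : StrictAntiOn U (Icc u a) := by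
    refine strictAntiOn_of_deriv_neg (convex_Icc _ _) hU.continuous.continuousOn fun v hv => ?_
    rw [interior_Icc] at hv
    exact hneg v ⟨by linarith [hv.1], hv.2⟩
  have h1 := hanti (left_mem_Icc.2 hu3.le) (right_mem_Icc.2 hu3.le) hu3
  have h2 := h u ⟨by linarith, hu3⟩
  linarith

theorem IsMorse.exists_deriv_neg_right (hM : IsMorse U) (hU : ContDiff ℝ (⊤ : ℕ∞) U) {a b : ℝ}
    (hab : a < b) (h : ∀ x ∈ Ioo a b, U x < U a) :
    ∃ r > 0, ∀ x ∈ Ioo a (a + r), deriv U x < 0 := by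
  obtain ⟨r, hr, h1⟩ := hM.comp_neg.exists_deriv_pos_left (hU.comp contDiff_neg)
    (a := -a) (b := -b) (by linarith) fun x hx => by
      rw [neg_neg]; exact h (-x) ⟨by linarith [hx.2], by linarith [hx.1]⟩
  refine ⟨r, hr, fun x hx => ?_⟩
  have h2 := h1 (-x) ⟨by linarith [hx.2], by linarith [hx.1]⟩
  rw [deriv_comp_neg U (-x), neg_neg] at h2
  linarith

/-- Second derivative test applied to U - k(x - a)², whose second derivative at a is still positive
when k is a quarter of that of U. -/
theorem exists_quadratic_lower (hU : ContDiff ℝ (⊤ : ℕ∞) U) {a : ℝ} (h1 : deriv U a = 0)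
    (h2 : 0 < deriv (deriv U) a) :
    ∃ k > 0, ∀ᶠ x in nhds a, U a + k * (x - a) ^ 2 ≤ U x := by
  set k := deriv (deriv U) a / 4 with hk
  have hd1 : ∀ x, HasDerivAt (fun x => U x - k * (x - a) ^ 2) (deriv U x - 2 * k * (x - a)) x := by
    intro x
    have h3 := (hU.differentiable (by simp) x).hasDerivAt
    have h4 := (((hasDerivAt_id x).sub_const a).pow 2).const_mul k
    exact (h3.sub h4).congr_deriv (by simp; ring)
  have hd2 : HasDerivAt (fun x => deriv U x - 2 * k * (x - a)) (deriv (deriv U) a - 2 * k) a := by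
    have h3 := ((contDiff_deriv hU).differentiable (by simp) a).hasDerivAt
    have h4 := ((hasDerivAt_id a).sub_const a).const_mul (2 * k)
    exact (h3.sub h4).congr_deriv (by simp)
  have hd : deriv (fun x => U x - k * (x - a) ^ 2) = fun x => deriv U x - 2 * k * (x - a) :=
    funext fun x => (hd1 x).deriv
  have hmin : IsLocalMin (fun x => U x - k * (x - a) ^ 2) a := by
    refine isLocalMin_of_deriv_deriv_pos ?_ ?_ (hd1 a).continuousAt
    · rw [hd, hd2.deriv]; linarith
    · rw [hd]; simp [h1]
  refine ⟨k, by linarith, ?_⟩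
  filter_upwards [hmin] with x hx
  simp only [sub_self] at hx
  linarith

/-- At a local minimum a Morse function grows at least quadratically. -/
theorem IsMorse.exists_quadratic_lower (hM : IsMorse U) (hU : ContDiff ℝ (⊤ : ℕ∞) U) {a : ℝ}
    (ha : IsLocalMin U a) : ∃ k > 0, ∀ᶠ x in nhds a, U a + k * (x - a) ^ 2 ≤ U x := by
  have h1 := ha.deriv_eq_zero
  rcases (hM a h1).lt_or_gt with h2 | h2
  -- With a negative second derivative, the same bound for -U would force values strictly below U a
  -- arbitrarily close to a.
  · exfalso
    have e1 : deriv (fun x => -U x) = fun x => -deriv U x := by funext x; exact deriv.fun_neg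
    obtain ⟨k, hk, h3⟩ := VelocityJump.exists_quadratic_lower (U := fun x => -U x) hU.neg (a := a)
      (by rw [e1]; simp [h1]) (by rw [e1, deriv.fun_neg]; linarith)
    obtain ⟨r, hr, hball⟩ := Metric.eventually_nhds_iff.1 (h3.and ha)
    obtain ⟨h4, h5⟩ := @hball (a + r / 2) (by
      rw [Real.dist_eq, add_sub_cancel_left, abs_of_pos (by linarith)]; linarith)
    have : 0 < k * (a + r / 2 - a) ^ 2 := by
      rw [add_sub_cancel_left]; positivity
    linarith
  · exact VelocityJump.exists_quadratic_lower hU h1 h2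

theorem lintegral_gaussian_le {b a : ℝ} (hb : 0 < b) :
    ∫⁻ x, ENNReal.ofReal (Real.exp (-(b * (x - a) ^ 2))) = ENNReal.ofReal (√(Real.pi / b)) := by
  have h1 := lintegral_sub_right_eq_self (μ := (volume : Measure ℝ))
    (fun x : ℝ => ENNReal.ofReal (Real.exp (-(b * x ^ 2)))) a
  rw [h1, ← integral_gaussian b, ofReal_integral_eq_lintegral_ofReal (integrable_exp_neg_mul_sq hb)
    (Filter.Eventually.of_forall fun x => (Real.exp_pos _).le)]
  simp only [neg_mul]

/-- An upper bound in Laplace's method. -/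
theorem exists_laplace_bound {h : ℝ → ℝ} (hh : Continuous h) {s : Set ℝ} (hs : IsCompact s)
    (hq : ∀ a ∈ s, ∃ k > 0, ∀ᶠ x in nhdsWithin a s, k * (x - a) ^ 2 ≤ h x) :
    ∃ C, 0 ≤ C ∧ ∀ q, 0 < q → ∫⁻ x in s, ENNReal.ofReal (Real.exp (-(q * h x))) ≤
      ENNReal.ofReal (C / √q) := by
  -- Bounds of the form C/√q add up under unions, so by compactness one neighbourhood of each point
  -- is enough; there the integral is dominated by a Gaussian one.
  refine IsCompact.induction_on (p := fun t => ∃ C, 0 ≤ C ∧ ∀ q, 0 < q →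
    ∫⁻ x in t, ENNReal.ofReal (Real.exp (-(q * h x))) ≤ ENNReal.ofReal (C / √q)) hs
    ⟨0, le_rfl, by simp⟩ ?_ ?_ ?_
  · rintro t t' htt' ⟨C, hC, h1⟩
    exact ⟨C, hC, fun q hq => (lintegral_mono_set htt').trans (h1 q hq)⟩
  · rintro t t' ⟨C, hC, h1⟩ ⟨C', hC', h1'⟩
    refine ⟨C + C', add_nonneg hC hC', fun q hq => (lintegral_union_le _ _ _).trans ?_⟩
    rw [add_div, ENNReal.ofReal_add (by positivity) (by positivity)]
    exact add_le_add (h1 q hq) (h1' q hq)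
  · intro a ha
    obtain ⟨k, hk, h1⟩ := hq a ha
    refine ⟨{x | k * (x - a) ^ 2 ≤ h x}, h1, √(Real.pi / k), Real.sqrt_nonneg _, fun q hq => ?_⟩
    have hm : MeasurableSet {x | k * (x - a) ^ 2 ≤ h x} :=
      measurableSet_le (by fun_prop) hh.measurable
    have h2 : √(Real.pi / k) / √q = √(Real.pi / (q * k)) := by
      rw [← Real.sqrt_div (by positivity), div_div, mul_comm k]
    rw [h2, ← lintegral_gaussian_le (a := a) (mul_pos hq hk)]
    refine (setLIntegral_mono' hm fun x hx => ?_).trans (setLIntegral_le_lintegral _ _)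
    refine ENNReal.ofReal_le_ofReal (Real.exp_le_exp.2 (neg_le_neg ?_))
    rw [mul_assoc]
    exact mul_le_mul_of_nonneg_left hx hq.le

end Morse

end VelocityJump

/-! ### The geometry of a Morse cusp and its partition function -/

namespace VelocityJump

section Geometry

variable {U : ℝ → ℝ} {zl zr : ℝ}

theorem IsCusp.exists_isMinOn (hC : IsCusp U zl zr) (hU : Continuous U) :
    ∃ a ∈ Ioo zl zr, ∀ x ∈ Icc zl zr, U a ≤ U x := by
  obtain ⟨a, ha, hmin⟩ := isCompact_Icc.exists_isMinOn (nonempty_Icc.2 hC.lt.le) hU.continuousOn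
  have hm : (zl + zr) / 2 ∈ Ioo zl zr := ⟨by linarith [hC.lt], by linarith [hC.lt]⟩
  have h1 := hmin (Ioo_subset_Icc_self hm)
  have h2 := hC.below _ hm
  have h1' : U a ≤ U ((zl + zr) / 2) := h1
  refine ⟨a, ⟨lt_of_le_of_ne ha.1 ?_, lt_of_le_of_ne ha.2 ?_⟩, fun x hx => hmin hx⟩
  · rintro rfl; linarith
  · rintro rfl; linarith [hC.ends_eq]

theorem cuspDepth_eq {a : ℝ} (ha : a ∈ Ioo zl zr) (hmin : ∀ x ∈ Icc zl zr, U a ≤ U x) :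
    cuspDepth U zl zr = U zl - U a := by
  unfold cuspDepth
  congr 1
  refine IsLeast.csInf_eq ⟨mem_image_of_mem _ ha, ?_⟩
  rintro _ ⟨x, hx, rfl⟩
  exact hmin x (Ioo_subset_Icc_self hx)

/-- The geometry of a cusp of a Morse function. -/
theorem IsCusp.exists_cuspData (hC : IsCusp U zl zr) (hU : ContDiff ℝ (⊤ : ℕ∞) U)
    (hM : IsMorse U) : ∃ D : CuspData, deriv D.f = deriv U ∧ (∀ x, D.f x = U x - U zl) ∧
      D.z 1 = zr ∧ D.z (-1) = zl ∧ D.d = cuspDepth U zl zr ∧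
      ∀ x y, (x, y) ∈ nonExitingSet U zl zr → x ∈ Ioo zl zr ∧ sg y * (x - D.b y) ≤ 0 := by
  have hlt := hC.lt
  have hcd := (contDiff_deriv hU).continuous
  obtain ⟨rr, hrr, hr⟩ := hM.exists_deriv_pos_left hU hlt fun x hx => by
    rw [← hC.ends_eq]; exact hC.below x hx
  obtain ⟨rl, hrl, hl⟩ := hM.exists_deriv_neg_right hU hlt hC.below
  -- Half radii keep U strictly monotone on the end pieces of length δ. The quarter of the length
  -- leaves an inner interval of at least half the cusp, as `short` requires.
  set δ := min (min (rr / 2) (rl / 2)) ((zr - zl) / 4) with hδ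
  have hδ0 : 0 < δ := lt_min (lt_min (by linarith) (by linarith)) (by linarith)
  have hδr : δ < rr := ((min_le_left _ _).trans (min_le_left _ _)).trans_lt (by linarith)
  have hδl : δ < rl := ((min_le_left _ _).trans (min_le_right _ _)).trans_lt (by linarith)
  have hδ4 : δ ≤ (zr - zl) / 4 := min_le_right _ _
  have hmonoR : StrictMonoOn U (Icc (zr - δ) zr) := by
    refine strictMonoOn_of_deriv_pos (convex_Icc _ _) hU.continuous.continuousOn fun v hv => ?_
    rw [interior_Icc] at hv
    exact hr v ⟨by linarith [hv.1], hv.2⟩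
  have hmonoL : StrictAntiOn U (Icc zl (zl + δ)) := by
    refine strictAntiOn_of_deriv_neg (convex_Icc _ _) hU.continuous.continuousOn fun v hv => ?_
    rw [interior_Icc] at hv
    exact hl v ⟨hv.1, by linarith [hv.2]⟩
  have hderR : ∀ x ∈ Icc (zr - δ) zr, 0 ≤ deriv U x := by
    have hcl : IsClosed {x | 0 ≤ deriv U x} := isClosed_le continuous_const hcd
    intro x hx
    rw [← closure_Ioo (by linarith)] at hx
    exact closure_minimal (fun v hv => (hr v ⟨by linarith [hv.1], hv.2⟩).le) hcl hx
  have hderL : ∀ x ∈ Icc zl (zl + δ), deriv U x ≤ 0 := by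
    have hcl : IsClosed {x | deriv U x ≤ 0} := isClosed_le hcd continuous_const
    intro x hx
    rw [← closure_Ioo (by linarith)] at hx
    exact closure_minimal (fun v hv => (hl v ⟨hv.1, by linarith [hv.2]⟩).le) hcl hx
  -- the height of the potential in the middle of the cusp
  obtain ⟨m, hm, hmax⟩ := isCompact_Icc.exists_isMaxOn
    (nonempty_Icc.2 (show zl + δ ≤ zr - δ by linarith)) hU.continuous.continuousOn
  set η := U zl - U m with hη
  have hη0 : 0 < η := sub_pos.2 (hC.below m ⟨by linarith [hm.1], by linarith [hm.2]⟩)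
  have hmid : ∀ x ∈ Icc (zl + δ) (zr - δ), U x ≤ U zl - η := fun x hx => by
    have : U x ≤ U m := hmax hx
    linarith
  obtain ⟨bR, hbR, hUbR⟩ := intermediate_value_Icc (show zr - δ ≤ zr by linarith)
    (f := U) hU.continuous.continuousOn (show U zl - η ∈ Icc (U (zr - δ)) (U zr) from
      ⟨hmid _ ⟨by linarith, le_rfl⟩, by rw [← hC.ends_eq]; linarith⟩)
  obtain ⟨bL, hbL, hUbL⟩ := intermediate_value_Icc' (show zl ≤ zl + δ by linarith)
    (f := U) hU.continuous.continuousOn (show U zl - η ∈ Icc (U (zl + δ)) (U zl) from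
      ⟨hmid _ ⟨le_rfl, by linarith⟩, by linarith⟩)
  have hbR' : bR < zr := lt_of_le_of_ne hbR.2 (by
    rintro rfl; rw [← hC.ends_eq] at hUbR; linarith)
  have hbL' : zl < bL := lt_of_le_of_ne hbL.1 (by rintro rfl; linarith)
  have hleb : ∀ x ∈ Icc bL bR, U x ≤ U zl - η := by
    intro x hx
    rcases le_total x (zl + δ) with h1 | h1
    · rw [← hUbL]
      exact hmonoL.antitoneOn hbL ⟨hbL.1.trans hx.1, h1⟩ hx.1
    rcases le_total (zr - δ) x with h2 | h2
    · rw [← hUbR]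
      exact hmonoR.monotoneOn ⟨h2, hx.2.trans hbR.2⟩ hbR hx.2
    · exact hmid x ⟨h1, h2⟩
  obtain ⟨a, ha, hmin⟩ := hC.exists_isMinOn hU.continuous
  have hd := cuspDepth_eq ha hmin
  obtain ⟨M, hMb⟩ := (isCompact_Icc (a := zl) (b := zr)).exists_bound_of_continuousOn
    hcd.continuousOn
  have hderiv : deriv (fun x => U x - U zl) = deriv U := by
    funext x; exact deriv_sub_const _
  have hne : (-1 : ℤˣ) ≠ 1 := by decide
  -- the local extrema are deep
  have hext : ∀ x ∈ extremaIn U zl zr, U x ≤ U zl - η := by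
    rintro x ⟨hx, hx'⟩
    have h0 := hx'.deriv_eq_zero
    refine hmid x ⟨?_, ?_⟩
    · by_contra hc
      exact (hl x ⟨hx.1, by linarith [not_le.1 hc]⟩).ne h0
    · by_contra hc
      exact (hr x ⟨by linarith [not_le.1 hc], hx.2⟩).ne' h0
  have hamem : a ∈ extremaIn U zl zr := ⟨ha, Or.inl (by
    filter_upwards [Ioo_mem_nhds ha.1 ha.2] with x hx
    exact hmin x (Ioo_subset_Icc_self hx))⟩
  have hsup1 : sSup (U '' extremaIn U zl zr) ≤ U zl - η := by
    refine csSup_le ⟨_, mem_image_of_mem _ hamem⟩ ?_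
    rintro _ ⟨x, hx, rfl⟩; exact hext x hx
  have hsup2 : U a ≤ sSup (U '' extremaIn U zl zr) := by
    refine le_csSup ⟨U zl - η, ?_⟩ (mem_image_of_mem _ hamem)
    rintro _ ⟨x, hx, rfl⟩; exact hext x hx
  -- All local extrema lie at height at most U zl - η, so the exit height u is at least η, whereas U
  -- exceeds U zl - η beyond `bR`. The minimizer a shows that the set under the supremum is
  -- nonempty. Hence a state climbing beyond `bR` belongs to the exiting set.
  have hright : innerRight U zl zr ≤ bR := by
    refine csSup_le ⟨a, ha, ?_⟩ ?_
    · rw [← hC.ends_eq]; unfold exitHeight; linarith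
    · rintro x ⟨hx, hx'⟩
      rw [← hC.ends_eq] at hx'
      unfold exitHeight at hx'
      by_contra hc
      have h1 := hmonoR hbR ⟨hbR.1.trans (not_le.1 hc).le, hx.2.le⟩ (not_le.1 hc)
      linarith
  have hleft : bL ≤ innerLeft U zl zr := by
    refine le_csInf ⟨a, ha, ?_⟩ ?_
    · unfold exitHeight; linarith
    · rintro x ⟨hx, hx'⟩
      unfold exitHeight at hx'
      by_contra hc
      have h1 := hmonoL ⟨hx.1.le, (not_le.1 hc).le.trans hbL.2⟩ hbL (not_le.1 hc)
      linarith
  refine ⟨{ f := fun x => U x - U zl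
            z := fun y => if y = 1 then zr else zl
            b := fun y => if y = 1 then bR else bL
            η := η
            d := cuspDepth U zl zr
            M := M
            contDiff := (hU.sub contDiff_const).of_le (by exact_mod_cast le_top)
            η_pos := hη0
            lt_left := by simpa [hne] using hbL'
            lt_mid := by simp [hne]; linarith [hbL.2, hbR.1]
            lt_right := by simpa using hbR'
            f_z := fun y => by split_ifs <;> simp [hC.ends_eq]
            f_b := fun y => by split_ifs <;> linarith
            f_le := fun x hx => by
              simp only [hne, if_false, if_true] at hx
              linarith [hleb x hx]
            f_nonpos := fun x hx => by
              simp only [hne, if_false, if_true] at hx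
              rcases hx.1.eq_or_lt with rfl | h1
              · simp
              rcases hx.2.eq_or_lt with rfl | h2
              · simp [hC.ends_eq]
              · linarith [hC.below x ⟨h1, h2⟩]
            le_f := fun x hx => by
              simp only [hne, if_false, if_true] at hx
              linarith [hmin x hx]
            deriv_le := fun x hx => by
              simp only [hne, if_false, if_true] at hx
              rw [hderiv]; exact hMb x hx
            uphill := fun y x h1 h2 => by
              rw [hderiv]
              rcases Int.units_eq_one_or y with rfl | rfl
              · simp only [sg_one, one_mul, if_true] at h1 h2 ⊢
                exact hderR x ⟨by linarith [hbR.1], by linarith⟩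
              · simp only [sg_neg, sg_one, hne, if_false] at h1 h2 ⊢
                linarith [hderL x ⟨by linarith, by linarith [hbL.2]⟩]
            short := fun y => by
              rcases Int.units_eq_one_or y with rfl | rfl
              · simp only [sg_one, one_mul, if_true, hne, if_false]
                linarith [hbR.1, hbL.2]
              · simp only [sg_neg, sg_one, hne, if_false, if_true]
                linarith [hbR.1, hbL.2] }, hderiv, fun x => rfl, by simp, by simp [hne], rfl, ?_⟩
  rintro x y ⟨⟨hx, _⟩, hA⟩
  refine ⟨hx, ?_⟩
  have hx' : x ∈ Ioo zl zr := hx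
  rcases Int.units_eq_one_or y with rfl | rfl
  · simp only [sg_one, one_mul, if_true]
    by_contra hc
    exact hA (Or.inr ⟨⟨by linarith [not_le.1 hc], hx'.2⟩, rfl⟩)
  · simp only [sg_neg, sg_one, hne, if_false]
    by_contra hc
    exact hA (Or.inl ⟨⟨hx'.1, by linarith [not_le.1 hc]⟩, rfl⟩)

/-- Laplace's method for the partition function of a cusp. -/
theorem CuspData.exists_Z_le (D : CuspData) (hU : ContDiff ℝ (⊤ : ℕ∞) U)
    (hM : IsMorse U) (hC : IsCusp U zl zr) (hf : ∀ x, D.f x = U x - U zl)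
    (hzr : D.z 1 = zr) (hzl : D.z (-1) = zl) :
    ∃ C, 0 ≤ C ∧ ∀ q, 0 < q →
      D.Z q ≤ C / √q * Real.exp (q * cuspDepth U zl zr) := by
  obtain ⟨a, ha, hmin⟩ := hC.exists_isMinOn hU.continuous
  have hd := cuspDepth_eq ha hmin
  have hcont : Continuous fun x => U x - U a := hU.continuous.sub continuous_const
  obtain ⟨C, hC0, hlap⟩ := exists_laplace_bound hcont (isCompact_Icc (a := zl) (b := zr)) (by
    intro x hx
    rcases (sub_nonneg.2 (hmin x hx)).eq_or_lt with h0 | h0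
    · have hxa : U x = U a := by linarith
      have hxI : x ∈ Ioo zl zr := by
        have h1 := hC.below a ha
        refine ⟨lt_of_le_of_ne hx.1 ?_, lt_of_le_of_ne hx.2 ?_⟩
        · rintro rfl; linarith
        · rintro rfl; linarith [hC.ends_eq]
      have hloc : IsLocalMin U x := by
        filter_upwards [Ioo_mem_nhds hxI.1 hxI.2] with v hv
        rw [hxa]; exact hmin v (Ioo_subset_Icc_self hv)
      obtain ⟨k, hk, h1⟩ := hM.exists_quadratic_lower hU hloc
      refine ⟨k, hk, (h1.filter_mono nhdsWithin_le_nhds).mono fun v hv => ?_⟩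
      linarith
    -- Away from the minimizers the height is strictly positive, so near x any quadratic works; k =
    -- 1 is chosen.
    · refine ⟨1, one_pos, Filter.Eventually.filter_mono nhdsWithin_le_nhds ?_⟩
      have h1 : Continuous fun v => U v - U a - 1 * (v - x) ^ 2 := by fun_prop
      have h2 := h1.continuousAt.eventually
        (lt_mem_nhds (show 0 < U x - U a - 1 * (x - x) ^ 2 by simpa using h0))
      exact h2.mono fun v hv => by linarith)
  refine ⟨C, hC0, fun q hq => ?_⟩
  have h1 := hlap q hq
  have hi : Integrable (fun x => Real.exp (-(q * (U x - U a)))) (volume.restrict (Icc zl zr)) :=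
    (Continuous.continuousOn (by fun_prop)).integrableOn_compact isCompact_Icc
  rw [← ofReal_integral_eq_lintegral_ofReal hi
    (Filter.Eventually.of_forall fun x => (Real.exp_pos _).le)] at h1
  have h2 := (ENNReal.ofReal_le_ofReal_iff (by positivity)).1 h1
  have h3 : D.Z q = Real.exp (q * cuspDepth U zl zr) *
      ∫ x in Icc zl zr, Real.exp (-(q * (U x - U a))) := by
    unfold CuspData.Z CuspData.N
    rw [hzr, hzl, intervalIntegral.integral_of_le hC.lt.le, integral_Icc_eq_integral_Ioc,
      ← integral_const_mul]
    refine integral_congr_ae (Filter.Eventually.of_forall fun x => ?_)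
    simp only [hf, hd]
    rw [← Real.exp_add]
    congr 1; ring
  rw [h3, mul_comm]
  exact mul_le_mul_of_nonneg_right h2 (Real.exp_pos _).le

theorem measurableSet_nonExitingSet : MeasurableSet (nonExitingSet U zl zr) := by
  unfold nonExitingSet exitingSet
  exact (measurableSet_Ioo.prod MeasurableSet.univ).diff
    ((measurableSet_Ioo.prod (measurableSet_singleton _)).union
      (measurableSet_Ioo.prod (measurableSet_singleton _)))

end Geometry

end VelocityJump

namespace VelocityJump

/-! ### Reduction to schedules on the whole line -/

theorem nextJumpTime_congr {U ε ε' : ℝ → ℝ} (h : ∀ t, 0 ≤ t → ε t = ε' t) (e : ℝ) {T : JumpState}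
    (hT : 0 ≤ T.time) : nextJumpTime U ε e T = nextJumpTime U ε' e T := by
  unfold nextJumpTime
  congr 2
  ext t
  refine and_congr_right fun ht => ?_
  have h0 : 0 ≤ T.time.toReal := EReal.toReal_nonneg hT
  have h1 : T.time.toReal ≤ t := by
    have h2 := EReal.coe_toReal (ht.trans (EReal.coe_lt_top t)).ne
      ((EReal.bot_lt_coe 0).trans_le hT).ne'
    rw [← h2] at ht
    exact (EReal.coe_lt_coe_iff.1 ht).le
  have h3 : ∫ r in T.time.toReal..t,
      jumpRate U ε r (T.pos + ((T.vel : ℤ) : ℝ) * (r - T.time.toReal)) T.vel =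
      ∫ r in T.time.toReal..t,
      jumpRate U ε' r (T.pos + ((T.vel : ℤ) : ℝ) * (r - T.time.toReal)) T.vel := by
    refine intervalIntegral.integral_congr fun r hr => ?_
    rw [uIcc_of_le h1] at hr
    simp only [jumpRate, h r (h0.trans hr.1)]
  rw [h3]

theorem path_congr {U ε ε' : ℝ → ℝ} (h : ∀ t, 0 ≤ t → ε t = ε' t) {s₀ : ℝ} (hs : 0 ≤ s₀)
    (x : ℝ) (y : ℤˣ) (e : ℕ → ℝ) (t : ℝ) : path U ε s₀ x y e t = path U ε' s₀ x y e t := by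
  have h1 : ∀ i, jumpChain U ε s₀ x y e i = jumpChain U ε' s₀ x y e i ∧
      0 ≤ (jumpChain U ε s₀ x y e i).time := by
    intro i
    induction i with
    | zero => exact ⟨rfl, EReal.coe_nonneg.2 hs⟩
    | succ i ih =>
      refine ⟨?_, ih.2.trans (Dyn.time_le_nextJumpTime U ε (e i) _)⟩
      rw [jumpChain, jumpChain, ← ih.1, nextJumpTime_congr h (e i) ih.2]
  have h2 : jumpChain U ε s₀ x y e = jumpChain U ε' s₀ x y e := funext fun i => (h1 i).1
  unfold path jumpCount
  rw [h2]

/-- The dynamics with the schedule extended to negative times. -/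
noncomputable def IsCoolingSchedule.dyn {ε : ℝ → ℝ} (hε : IsCoolingSchedule ε) {U : ℝ → ℝ}
    (hU : Continuous (deriv U)) : Dyn where
  U := U
  ε := fun t => ε (max t 0)
  cont := hU
  pos := fun _ => hε.pos _ (le_max_right _ _)
  anti := fun _ _ h => hε.antitone (mem_Ici.2 (le_max_right _ _)) (mem_Ici.2 (le_max_right _ _))
    (max_le_max_right 0 h)

theorem IsCoolingSchedule.traj_eq {ε : ℝ → ℝ} (hε : IsCoolingSchedule ε) {U : ℝ → ℝ}
    (hU : Continuous (deriv U)) {s₀ : ℝ} (hs : 0 ≤ s₀) (x : ℝ) (y : ℤˣ) (e : ℕ → ℝ) (t : ℝ) :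
    path U ε s₀ x y e t = (hε.dyn hU).traj s₀ x y e t :=
  path_congr (ε' := fun t => ε (max t 0)) (fun t ht => by rw [max_eq_left ht]) hs x y e t

namespace CuspData

variable {D : CuspData} {S : Dyn} {t₀ d C : ℝ}

/-- The weighted time until an exit time, in terms of the time weight of the supersolution. -/
theorem lintegral_weight_le {ε : ℝ → ℝ} (ht₀ : 0 ≤ t₀) (hε : ∀ t, 0 ≤ t → S.ε t = ε t)
    (hC : 0 ≤ C) (hZ : ∀ q, 0 < q → D.Z q ≤ C / √q * Real.exp (q * d)) (τ : EReal) :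
    ∫⁻ s in {s : ℝ | t₀ < s ∧ (s : EReal) < τ}, ENNReal.ofReal (weight ε d s) ≤
      ENNReal.ofReal C *
        (1 + ∫⁻ s in {s : ℝ | t₀ < s ∧ (s : EReal) < τ}, D.timeWeight S s) := by
  have hmeas : ∀ a : ℝ, MeasurableSet {s : ℝ | a < s ∧ (s : EReal) < τ} := fun a =>
    measurableSet_Ioi.inter (measurableSet_lt measurable_coe_real_ereal measurable_const)
  have hinv : ∀ s, 0 < (S.ε s)⁻¹ := fun s => inv_pos.2 (S.pos s)
  have hw : ∀ s, t₀ < s → ENNReal.ofReal (weight ε d s) ≤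
      ENNReal.ofReal C * ENNReal.ofReal (1 / D.Z (S.ε s)⁻¹) := by
    intro s hs
    rw [← ENNReal.ofReal_mul hC]
    refine ENNReal.ofReal_le_ofReal ?_
    have h0 : 0 < ε s := by rw [← hε s (by linarith)]; exact S.pos s
    have h1 := hZ _ (hinv s)
    have h2 : weight ε d s = √(S.ε s)⁻¹ * Real.exp (-((S.ε s)⁻¹ * d)) := by
      rw [hε s (by linarith)]
      unfold weight
      rw [Real.rpow_neg h0.le, ← Real.sqrt_eq_rpow, Real.sqrt_inv]
      congr 2
      field_simp
    have h3 : 0 < √(S.ε s)⁻¹ := Real.sqrt_pos.2 (hinv s)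
    rw [h2, mul_one_div, le_div_iff₀ (D.Z_pos _)]
    refine (mul_le_mul_of_nonneg_left h1 (by positivity)).trans (le_of_eq ?_)
    have h4 : Real.exp (-((S.ε s)⁻¹ * d)) * Real.exp ((S.ε s)⁻¹ * d) = 1 := by
      rw [← Real.exp_add]; simp
    calc _ = (√(S.ε s)⁻¹ / √(S.ε s)⁻¹) * C *
          (Real.exp (-((S.ε s)⁻¹ * d)) * Real.exp ((S.ε s)⁻¹ * d)) := by ring
      _ = C := by rw [h4, div_self h3.ne']; ring
  have hm : Measurable fun s => ENNReal.ofReal (1 / D.Z (S.ε s)⁻¹) :=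
    ((D.continuous_Z.measurable.comp (Dyn.inv_mono (S := S)).measurable).const_div 1).ennreal_ofReal
  refine (setLIntegral_mono' (hmeas t₀) fun s hs => hw s hs.1).trans ?_
  rw [lintegral_const_mul _ hm]
  refine mul_le_mul' le_rfl ?_
  -- The time weight is evaluated at s + L, so the domain is shifted by L. The initial stretch of
  -- length L contributes at most 1 because Z ≥ L.
  have hsub : {s : ℝ | t₀ < s ∧ (s : EReal) < τ} ⊆
      Ioc t₀ (t₀ + D.L) ∪ {s : ℝ | t₀ + D.L < s ∧ (s : EReal) < τ} := fun s hs => by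
    rcases le_or_gt s (t₀ + D.L) with h | h
    · exact Or.inl ⟨hs.1, h⟩
    · exact Or.inr ⟨h, hs.2⟩
  refine (lintegral_mono_set hsub).trans ((lintegral_union_le _ _ _).trans (add_le_add ?_ ?_))
  · have h1 : ∀ s ∈ Ioc t₀ (t₀ + D.L), ENNReal.ofReal (1 / D.Z (S.ε s)⁻¹) ≤
        ENNReal.ofReal (1 / D.L) := fun s _ =>
      ENNReal.ofReal_le_ofReal (one_div_le_one_div_of_le D.L_pos (D.L_le_Z (hinv s).le))
    refine (setLIntegral_mono' measurableSet_Ioc h1).trans ?_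
    rw [setLIntegral_const, Real.volume_Ioc, ← ENNReal.ofReal_mul (by have := D.L_pos; positivity),
      add_sub_cancel_left, one_div_mul_cancel D.L_pos.ne', ENNReal.ofReal_one]
  · rw [← lintegral_indicator (hmeas _), ← lintegral_indicator (hmeas _),
      ← lintegral_add_right_eq_self _ D.L]
    refine lintegral_mono fun s => ?_
    by_cases hs : s + D.L ∈ {s : ℝ | t₀ + D.L < s ∧ (s : EReal) < τ}
    · have hs' : s ∈ {s : ℝ | t₀ < s ∧ (s : EReal) < τ} :=
        ⟨by linarith [hs.1], lt_of_le_of_lt (EReal.coe_le_coe_iff.2 (by linarith [D.L_pos])) hs.2⟩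
      rw [indicator_of_mem hs, indicator_of_mem hs']
      exact le_rfl
    · rw [indicator_of_notMem hs]; exact zero_le

theorem measurable_iSup_J {w : ℝ → ℝ≥0∞} (hw : Measurable w) (c : ℤˣ → ℝ≥0∞) (t : ℝ) (y : ℤˣ) :
    Measurable fun v : ℝ × (ℕ → ℝ) => ⨆ n, S.J D w c n t v.1 y v.2 :=
  Measurable.iSup fun n => (Dyn.measurable_J hw c n y).comp
    ((measurable_const.prodMk measurable_fst).prodMk measurable_snd)

theorem exists_inv_temp (D : CuspData) :
    ∃ ε₀ : ℝ, 0 < ε₀ ∧ ∀ ε, 0 < ε → ε ≤ ε₀ → D.K * D.c ε⁻¹ ≤ 1 / 12 := by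
  have hη := D.η_pos
  have hK := D.K_nonneg
  -- Since q·c(q) ≤ 2/η, the inequality q ≥ 24K/η forces K·c(q) ≤ 1/12; adding 1 keeps the inverse
  -- defined when K = 0.
  refine ⟨(24 * D.K / D.η + 1)⁻¹, by positivity, fun ε h0 h1 => ?_⟩
  have h2 : 24 * D.K / D.η ≤ ε⁻¹ := by
    have := inv_anti₀ h0 h1
    rw [inv_inv] at this; linarith
  have h3 := D.mul_c_le ε⁻¹
  have h4 := mul_le_mul_of_nonneg_right h2 (D.c_pos ε⁻¹).le
  have h5 : 24 * D.K / D.η * D.c ε⁻¹ ≤ 2 / D.η := h4.trans h3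
  rw [div_mul_eq_mul_div, div_le_div_iff_of_pos_right hη] at h5
  linarith

end CuspData

/-! ### Conclusion -/

/-- The exit from the cusp, conditioned on a state that does not climb out directly. -/
theorem Dyn.cond_exit (S : Dyn) (D : CuspData) (hD : deriv D.f = deriv S.U) {Ω : Type*}
    [MeasurableSpace Ω] {P : Measure Ω} [IsProbabilityMeasure P] {X₀ : Ω → ℝ} {Y₀ : Ω → ℤˣ}
    {E : ℕ → Ω → ℝ} (h : IsDriving P X₀ Y₀ E) {s₀ t₀ d C : ℝ} (hs : s₀ ≤ t₀) (ht₀ : 0 ≤ t₀)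
    {B : Set (ℝ × ℤˣ)} (hB : MeasurableSet B)
    (hBD : ∀ x y, (x, y) ∈ B → x ∈ Ioo (D.z (-1)) (D.z 1) ∧ sg y * (x - D.b y) ≤ 0)
    (hK : D.K * D.c (S.ε t₀)⁻¹ ≤ 1 / 12) {ε : ℝ → ℝ} (hε : ∀ t, 0 ≤ t → S.ε t = ε t)
    (hC : 0 ≤ C) (hZ : ∀ q, 0 < q → D.Z q ≤ C / √q * Real.exp (q * d))
    (hdiv : ∫⁻ s in Ioi t₀, ENNReal.ofReal (weight ε d s) = ∞) {A : Set Ω}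
    (hA : A = {ω | S.traj s₀ (X₀ ω) (Y₀ ω) (fun k => E k ω) t₀ ∈ B}) (hA0 : P A ≠ 0)
    {X : Ω → ℝ → ℝ} (hX : ∀ ω t, X ω t = (S.traj s₀ (X₀ ω) (Y₀ ω) (fun k => E k ω) t).1) :
    ∫⁻ ω, (∫⁻ s in {s : ℝ | t₀ < s ∧ (s : EReal) < exitTime (D.z (-1)) (D.z 1) t₀ (X ω)},
        ENNReal.ofReal (weight ε d s)) ∂(ProbabilityTheory.cond P A) ≤
      ENNReal.ofReal (C * (2 * D.K + 4)) ∧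
    ∀ y, ENNReal.ofReal (1 / 3) ≤ ProbabilityTheory.cond P A
      {ω | exitTime (D.z (-1)) (D.z 1) t₀ (X ω) ≠ ⊤ ∧
        X ω (exitTime (D.z (-1)) (D.z 1) t₀ (X ω)).toReal = D.z y} := by
  have hprob : IsProbabilityMeasure (ProbabilityTheory.cond P A) :=
    cond_isProbabilityMeasure hA0
  set τ : Ω → EReal := fun ω => exitTime (D.z (-1)) (D.z 1) t₀ (X ω) with hτ
  have hexit : ∀ ω x' y' e', (∀ u, t₀ ≤ u →
      S.traj s₀ (X₀ ω) (Y₀ ω) (fun k => E k ω) u = S.traj t₀ x' y' e' u) →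
      τ ω = S.tau D t₀ x' y' e' := by
    intro ω x' y' e' hu
    simp only [hτ, Dyn.tau, exitTime]
    congr 2
    ext t
    refine and_congr_right fun ht => ?_
    rw [hX, hu t ht.le]
  have hIcc : ∀ x y, (x, y) ∈ B → x ∈ Icc (D.z (-1)) (D.z 1) := fun x y hxy =>
    Ioo_subset_Icc_self (hBD x y hxy).1
  -- the weighted time
  obtain ⟨Ψ, hΨm, hΨ, hΨae⟩ := S.exists_cond_bound h hs hB
    (fun y => CuspData.measurable_iSup_J (D := D) (S := S) CuspData.measurable_timeWeight
      (fun _ => ENNReal.ofReal 0) t₀ y)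
    (fun x y hxy => CuspData.lintegral_cost_le hD t₀ (hIcc x y hxy) (hBD x y hxy).2) hA hA0
  have hcost : ∀ᵐ ω ∂(ProbabilityTheory.cond P A),
      ∫⁻ s in {s : ℝ | t₀ < s ∧ (s : EReal) < τ ω}, ENNReal.ofReal (weight ε d s) ≤
        ENNReal.ofReal C * (1 + Ψ ω) := by
    filter_upwards [hΨae] with ω ⟨x', y', e', he', hB', hu, hle⟩
    refine (CuspData.lintegral_weight_le (D := D) (S := S) ht₀ hε hC hZ (τ ω)).trans ?_
    refine mul_le_mul' le_rfl (add_le_add le_rfl (le_trans ?_ hle))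
    rw [hexit ω x' y' e' hu]
    exact Dyn.cost_le_iSup_J _ _ he' (hBD x' y' hB').1
  -- If the process never left the cusp, its weighted time would be the divergent integral, but that
  -- time is almost surely finite.
  have hfin : ∀ᵐ ω ∂(ProbabilityTheory.cond P A), τ ω ≠ ⊤ := by
    filter_upwards [hcost, ae_lt_top hΨm (hΨ.trans_lt ENNReal.ofReal_lt_top).ne] with ω h1 h2 h3
    have h4 : {s : ℝ | t₀ < s ∧ (s : EReal) < τ ω} = Ioi t₀ := by
      ext s; simp [h3, EReal.coe_lt_top]
    rw [h4, hdiv] at h1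
    exact (ENNReal.mul_lt_top ENNReal.ofReal_lt_top
      (ENNReal.add_lt_top.2 ⟨ENNReal.one_lt_top, h2⟩)).not_ge h1
  refine ⟨?_, fun y => ?_⟩
  · refine (lintegral_mono_ae hcost).trans ?_
    rw [lintegral_const_mul _ (hΨm.const_add 1), lintegral_add_left measurable_const,
      lintegral_const, measure_univ, mul_one, ENNReal.ofReal_mul hC]
    refine mul_le_mul' le_rfl ((add_le_add le_rfl hΨ).trans ?_)
    rw [← ENNReal.ofReal_one, ← ENNReal.ofReal_add zero_le_one (by linarith [D.K_nonneg])]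
    exact ENNReal.ofReal_le_ofReal (by linarith)
  -- The upper bound 2/3 is applied to the opposite end -y. As an exit occurs almost surely, the end
  -- `z y` has probability at least 1/3.
  · obtain ⟨Φ, hΦm, hΦ, hΦae⟩ := S.exists_cond_bound h hs hB
      (fun y' => CuspData.measurable_iSup_J (D := D) (S := S) (w := 0) measurable_const
        (fun y' => ENNReal.ofReal (if y' = -y then 1 else 0)) t₀ y')
      (fun x y' hxy => CuspData.lintegral_exit_le hD (-y) hK (hIcc x y' hxy) (hBD x y' hxy).2)
      hA hA0
    set Q := {ω | τ ω ≠ ⊤ ∧ X ω (τ ω).toReal = D.z y} with hQ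
    have hcover : ∀ᵐ ω ∂(ProbabilityTheory.cond P A), ω ∈ Q ∪ {ω | 1 ≤ Φ ω} := by
      filter_upwards [hfin, hΦae] with ω hfω ⟨x', y', e', he', hB', hu, hle⟩
      have hx' := (hBD x' y' hB').1
      have hτω := hexit ω x' y' e' hu
      have hle₀ := Dyn.le_tau (S := S) (D := D) t₀ x' y' e'
      have hreal := EReal.coe_toReal hfω
        (by rw [hτω]; exact ((EReal.bot_lt_coe t₀).trans_le hle₀).ne')
      obtain ⟨n, hn⟩ := Dyn.exists_time_gt (S := S) he' t₀ x' y' (τ ω).toReal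
      rw [hreal, hτω] at hn
      obtain ⟨y'', h1, h2⟩ := Dyn.exit_position n he' hx' hn
      rcases eq_or_ne y'' y with rfl | hne
      · refine Or.inl ⟨hfω, ?_⟩
        have h3 : t₀ ≤ (τ ω).toReal := by
          rw [← hτω, ← hreal] at hle₀
          exact EReal.coe_le_coe_iff.1 hle₀
        rw [hX, hu _ h3, hτω, h1]
      · have hy'' : y'' = -y := by
          rcases Int.units_eq_one_or y with rfl | rfl <;>
            rcases Int.units_eq_one_or y'' with rfl | rfl <;> simp at hne ⊢
        refine Or.inr (le_trans ?_ hle)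
        have h3 := h2 0 fun y' => ENNReal.ofReal (if y' = -y then 1 else 0)
        rw [if_pos hy'', ENNReal.ofReal_one] at h3
        exact h3.trans (le_iSup (fun n => S.J D 0
          (fun y' => ENNReal.ofReal (if y' = -y then 1 else 0)) n t₀ x' y' e') n)
    have h1 : ProbabilityTheory.cond P A {ω | 1 ≤ Φ ω} ≤ ENNReal.ofReal (2 / 3) := by
      have := mul_meas_ge_le_lintegral (μ := ProbabilityTheory.cond P A) hΦm 1
      rw [one_mul] at this
      exact this.trans hΦ
    have h2 : (1 : ℝ≥0∞) ≤ ProbabilityTheory.cond P A Q + ENNReal.ofReal (2 / 3) := by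
      calc (1 : ℝ≥0∞) = ProbabilityTheory.cond P A univ := measure_univ.symm
        _ ≤ ProbabilityTheory.cond P A (Q ∪ {ω | 1 ≤ Φ ω}) :=
          measure_mono_ae (hcover.mono fun ω hω _ => hω)
        _ ≤ _ := (measure_union_le _ _).trans (add_le_add le_rfl h1)
    have h3 : ENNReal.ofReal (1 / 3) + ENNReal.ofReal (2 / 3) = 1 := by
      rw [← ENNReal.ofReal_add (by norm_num) (by norm_num)]; norm_num
    rw [← h3] at h2
    exact (ENNReal.add_le_add_iff_right ENNReal.ofReal_ne_top).1 h2

end VelocityJump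
theorem mainTheorem6
    (U : ℝ → ℝ) (hU : ContDiff ℝ (⊤ : ℕ∞) U) (hMorse : VelocityJump.IsMorse U)
    (zl zr : ℝ) (hC : VelocityJump.IsCusp U zl zr) :
    ∃ ε₀ c : ℝ, 0 < ε₀ ∧ 0 < c ∧
      ∀ (ε : ℝ → ℝ), VelocityJump.IsCoolingSchedule ε →
      ∀ (Ω : Type*) [MeasurableSpace Ω] (P : Measure Ω) [IsProbabilityMeasure P]
        (X₀ : Ω → ℝ) (Y₀ : Ω → ℤˣ) (E : ℕ → Ω → ℝ), VelocityJump.IsDriving P X₀ Y₀ E →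
      ∀ (s₀ t₀ : ℝ), 0 ≤ s₀ → s₀ ≤ t₀ → 0 < t₀ → ε t₀ ≤ ε₀ →
      ∫⁻ s in Ioi t₀,
        ENNReal.ofReal (VelocityJump.weight ε (VelocityJump.cuspDepth U zl zr) s) = ∞ →
      ∀ A : Set Ω,
      A = {ω | VelocityJump.process U ε s₀ X₀ Y₀ E t₀ ω ∈ VelocityJump.nonExitingSet U zl zr} →
      P A ≠ 0 →
        ∫⁻ ω, (∫⁻ s in {s : ℝ | t₀ < s ∧
              (s : EReal) < VelocityJump.cuspExitTime U ε s₀ X₀ Y₀ E zl zr t₀ ω},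
            ENNReal.ofReal (VelocityJump.weight ε (VelocityJump.cuspDepth U zl zr) s))
          ∂(ProbabilityTheory.cond P A) ≤ ENNReal.ofReal c ∧
        ∀ z ∈ ({zl, zr} : Set ℝ),
          ENNReal.ofReal (1 / c) ≤ ProbabilityTheory.cond P A
            {ω | VelocityJump.cuspExitTime U ε s₀ X₀ Y₀ E zl zr t₀ ω ≠ ⊤ ∧
              (VelocityJump.process U ε s₀ X₀ Y₀ E
                (VelocityJump.cuspExitTime U ε s₀ X₀ Y₀ E zl zr t₀ ω).toReal ω).1 = z} := by
  obtain ⟨D, hderiv, hf, hzr, hzl, hd, hB⟩ := hC.exists_cuspData hU hMorse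
  obtain ⟨C, hC0, hZ⟩ := D.exists_Z_le hU hMorse hC hf hzr hzl
  obtain ⟨ε₀, hε₀, hK⟩ := D.exists_inv_temp
  have hK0 := D.K_nonneg
  have hcd := (VelocityJump.contDiff_deriv hU).continuous
  -- The summand 3 makes 1/c at most 1/3, so one constant serves both conclusions.
  refine ⟨ε₀, C * (2 * D.K + 4) + 3, hε₀, by positivity, ?_⟩
  intro ε hε Ω _ P _ X₀ Y₀ E hE s₀ t₀ hs₀ hst ht₀ hεt hdiv A hA hA0
  have hSε : ∀ t, 0 ≤ t → (hε.dyn hcd).ε t = ε t := fun t ht => by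
    change ε (max t 0) = ε t
    rw [max_eq_left ht]
  have hpath : ∀ ω t, VelocityJump.process U ε s₀ X₀ Y₀ E t ω =
      (hε.dyn hcd).traj s₀ (X₀ ω) (Y₀ ω) (fun k => E k ω) t := fun ω t =>
    hε.traj_eq hcd hs₀ _ _ _ _
  have key := (hε.dyn hcd).cond_exit D hderiv hE hst ht₀.le
    VelocityJump.measurableSet_nonExitingSet
    (fun x y hxy => by rw [hzr, hzl]; exact hB x y hxy)
    (hK _ ((hε.dyn hcd).pos t₀) (by rw [hSε t₀ ht₀.le]; exact hεt)) hSε hC0 hZ hdiv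
    (A := A) (by simp_rw [hA, hpath]) hA0
    (X := fun ω t => (VelocityJump.process U ε s₀ X₀ Y₀ E t ω).1) fun ω t => by rw [hpath]
  rw [hzr, hzl] at key
  refine ⟨key.1.trans (ENNReal.ofReal_le_ofReal (by linarith)), fun z hz => ?_⟩
  have h3 : ENNReal.ofReal (1 / (C * (2 * D.K + 4) + 3)) ≤ ENNReal.ofReal (1 / 3) :=
    ENNReal.ofReal_le_ofReal (one_div_le_one_div_of_le (by norm_num)
      (le_add_of_nonneg_left (by positivity)))
  rcases hz with rfl | hz
  · have h4 := key.2 (-1)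
    rw [hzl] at h4
    exact h3.trans h4
  · have h4 := key.2 1
    rw [hzr] at h4
    rw [mem_singleton_iff.1 hz]
    exact h3.trans h4
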